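/- Let $0<\alpha<\pi$ and let $K=\{(r\cos\theta,r\sin\theta): r>0,\ -\alpha<\theta<\alpha\}\subset\mathbb R^2$ be the open sector of angle $2\alpha$. Put $e_r=(\cos\theta,\sin\theta)$, $e_\theta=(-\sin\theta,\cos\theta)$ and write a vector field on $K$ as $u=u^r e_r+u^\theta e_\theta$. A *self-similar (SS) solution* in $K$ is a pair $(u,p)$ with $u\in C^2(K;\mathbb R^2)\cap C(\overline K\setminus\{0\};\mathbb R^2)$ and $p\in C^1(K)$ such that $$-\Delta u+(u\cdot\nabla)u+\nabla p=0,\qquad \operatorname{div}u=0\qquad\text{in }K,$$ $u=0$ on $\partial K\setminus\{0\}$ (no slip), and $u(x)=\lambda u(\lambda x)$, $p(x)=\lambda^2p(\lambda x)$ for all $x\in K$ and $\lambda>0$. It has *flux* $\Phi\in\mathbb R$ if $\int_{-\alpha}^{\alpha}u^r(r,\theta)\,r\,d\theta=\Phi$ for all $r>0$. For an SS solution the function $f(\theta)=r\,u^r(r,\theta)$ does not depend on $r$. For non-negative integers $(m_+,m_-)\neq(0,0)$, the solution is *of type $(m_+,m_-)$* if $\{\theta\in(-\alpha,\alpha): f(\theta)>0\}$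 consists of exactly $m_+$ maximal intervals (connected components) and $\{\theta\in(-\alpha,\alpha): f(\theta)<0\}$ of exactly $m_-$ maximal intervals. Then the following hold. 1. Every SS solution in $K$ satisfies $u^\theta\equiv 0$ in $K$. 2. If $\frac{\pi}{2}\le\alpha<\pi$, there is no SS solution of type $(1,0)$. If $0<\alpha<\frac{\pi}{2}$, there is a number $\Phi_{\max}^{(1,0)}(\alpha)>0$ such that an SS solution of type $(1,0)$ with flux $\Phi$ exists if $0<\Phi<\Phi_{\max}^{(1,0)}(\alpha)$, and none exists if $\Phi>\Phi_{\max}^{(1,0)}(\alpha)$. 3. Let $m_+,m_-$ be non-negative integers with $|m_+-m_-|\le 1$ and $(m_+,m_-)\ne(0,0),(1,0),(2,1)$. Then there is a number $\Phi_{\max}^{(m_+,m_-)}(\alpha)\in\mathbb R$ such that an SS solution of type $(m_+,m_-)$ with flux $\Phi$ exists if $\Phi<\Phi_{\max}^{(m_+,m_-)}(\alpha)$, and none exists if $\Phi>\Phi_{\max}^{(m_+,m_-)}(\alpha)$. 4. If $0<\alpha\le\frac{\pi}{2}$, then there is a number $\Phi_{\max}^{(2,1)}(\alpha)\in\mathbb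 R$ such that an SS solution of type $(2,1)$ with flux $\Phi$ exists if $\Phi<\Phi_{\max}^{(2,1)}(\alpha)$, and none exists if $\Phi>\Phi_{\max}^{(2,1)}(\alpha)$. -/

import Mathlib

open Set
open scoped Laplacian

noncomputable section

/-- The Euclidean plane. -/
abbrev Plane : Type := EuclideanSpace ℝ (Fin 2)

/-- The radial unit vector `e_r(θ) = (cos θ, sin θ)`. -/
def radialVec (θ : ℝ) : Plane := !₂[Real.cos θ, Real.sin θ]

/-- The angular unit vector `e_θ(θ) = (-sin θ, cos θ)`. -/
def angularVec (θ : ℝ) : Plane := !₂[-Real.sin θ, Real.cos θ]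

/-- The open sector `K = {(r, θ) : r > 0, -α < θ < α}` with half-angle `α`. -/
def sector (α : ℝ) : Set Plane :=
  {x | ∃ r : ℝ, 0 < r ∧ ∃ θ ∈ Ioo (-α) α, x = r • radialVec θ}

/-- The radial component `u^r` of the vector field `u` at the point with polar coordinates
`(r, θ)`. -/
def radialPart (u : Plane → Plane) (r θ : ℝ) : ℝ :=
  inner ℝ (u (r • radialVec θ)) (radialVec θ)

/-- The angular component `u^θ` of the vector field `u` at the point with polar coordinates
`(r, θ)`. -/
def angularPart (u : Plane → Plane) (r θ : ℝ) : ℝ :=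
  inner ℝ (u (r • radialVec θ)) (angularVec θ)

/-- The divergence `∂₁ u₁ + ∂₂ u₂` of a plane vector field. -/
def planeDiv (u : Plane → Plane) (x : Plane) : ℝ :=
  ∑ i : Fin 2, (fderiv ℝ u x (EuclideanSpace.single i 1)) i

/-- `(u, p)` is a (classical) self-similar solution of the steady Navier-Stokes equations in the
sector `K` of half-angle `α`, with the no-slip boundary condition.  The values of `u` and `p`
outside of `closure K \ {0}`, respectively outside of `K`, play no role. -/
structure IsSelfSimilarSolution (α : ℝ) (u : Plane → Plane) (p : Plane → ℝ) : Prop where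
  /-- `u` is of class `C²` in the sector -/
  contDiffOn_velocity : ContDiffOn ℝ 2 u (sector α)
  /-- `p` is of class `C¹` in the sector -/
  contDiffOn_pressure : ContDiffOn ℝ 1 p (sector α)
  /-- `u` is continuous up to the boundary, except at the vertex -/
  continuousOn_velocity : ContinuousOn u (closure (sector α) \ {0})
  /-- the momentum equation `-Δu + (u · ∇)u + ∇p = 0` -/
  momentum : ∀ x ∈ sector α, -(Δ u) x + fderiv ℝ u x (u x) + gradient p x = 0
  /-- the incompressibility condition `div u = 0` -/
  div_eq_zero : ∀ x ∈ sector α, planeDiv u x = 0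
  /-- the no-slip condition `u = 0` on the boundary, except at the vertex -/
  no_slip : ∀ x ∈ frontier (sector α) \ {0}, u x = 0
  /-- self-similarity of the velocity: `u(x) = λ u(λx)` -/
  selfSimilar_velocity : ∀ l : ℝ, 0 < l → ∀ x ∈ sector α, u x = l • u (l • x)
  /-- self-similarity of the pressure: `p(x) = λ² p(λx)` -/
  selfSimilar_pressure : ∀ l : ℝ, 0 < l → ∀ x ∈ sector α, p x = l ^ 2 * p (l • x)

/-- The flux condition: the flux of `u` through every arc `{(r, θ) : -α < θ < α}`, `r > 0`,
equals `Φ`. -/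
def HasFlux (α : ℝ) (u : Plane → Plane) (Φ : ℝ) : Prop :=
  ∀ r : ℝ, 0 < r → ∫ θ in (-α)..α, radialPart u r θ * r = Φ

/-- The number of maximal intervals (connected components) of a set of reals, possibly `⊤`. -/
def numIntervals (S : Set ℝ) : ℕ∞ :=
  (connectedComponentIn S '' S).encard

/-- The vector field `u` in the sector of half-angle `α` is of type `(m₊, m₋)`: on `(-α, α)`, the
profile `f(θ) = r u^r(r, θ)` is positive on exactly `m₊` and negative on exactly `m₋` maximal
intervals.  As `f` does not depend on `r` for a self-similar field, it is taken at `r = 1`. -/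
def HasType (α : ℝ) (u : Plane → Plane) (mPlus mMinus : ℕ) : Prop :=
  numIntervals {θ | θ ∈ Ioo (-α) α ∧ 0 < radialPart u 1 θ} = (mPlus : ℕ∞) ∧
  numIntervals {θ | θ ∈ Ioo (-α) α ∧ radialPart u 1 θ < 0} = (mMinus : ℕ∞)

/-- There is a self-similar solution of type `(m₊, m₋)` with flux `Φ` in the sector of
half-angle `α`. -/
def ExistsSolution (α : ℝ) (mPlus mMinus : ℕ) (Φ : ℝ) : Prop :=
  ∃ (u : Plane → Plane) (p : Plane → ℝ),
    IsSelfSimilarSolution α u p ∧ HasFlux α u Φ ∧ HasType α u mPlus mMinus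

end

/-! A field homogeneous of degree -1 is determined by its values on the unit arc. Incompressibility
makes the angular component constant in the angle, and no slip makes it zero. The tangential
momentum equation then gives the pressure profile as `2 f` plus a constant, and the radial one
becomes `f'' = c - 4 f - f ^ 2` with `f (±α) = 0`. This reduction is an equivalence
(`IsSelfSimilarSolution.exists_profile`, `IsProfile.isSelfSimilarSolution`), so everything is a
question about an autonomous scalar equation.

Its energy integral makes `f' ^ 2` a cubic in `f` whose roots sum to `-6`. On a maximal interval of
constant sign, with extreme value `a`, the normalized height `s = f / a` satisfies `s' ^ 2 = 2/3 (1
- s) (Q + (6 + a) s + a s ^ 2)`, and `s = cos φ ^ 2` turns duration and integral of the hump into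
`humpTime a Q` and `humpFlux a Q`. The constants of the equation fix `a` and `Q` for each sign, so
humps of one sign are all congruent (`HumpData.unique`). If both signs occur, with extreme values
`a` and `-b`, the third root is `-(6 + a - b)` and lies below `-b`, that is, `2 b < 6 + a`. A
profile with `m` positive and `n` negative humps then satisfies `m T₊ + n T₋ = 2 α` and `m F₊ + n F₋
= Φ`. Conversely, when `|m - n| ≤ 1`, an arc of the periodic solution with these parameters is such
a profile (`existsProfile_of_osc`).

What remains is the range of the flux along the curve of parameters with duration `2 α`. In
coordinates where the duration strictly decreases in the second variable this curve is a continuous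
graph. If its projection is an interval and the flux is bounded above, the intermediate value
theorem fills all values between an attained flux and the supremum
(`IsDecreasingFamily.exists_threshold`). Each type thus needs a monotone coordinate, connectedness
of the projection, an upper bound, and small fluxes.

A positive hump lasts less than `π`, and its flux tends to `0` with its height. For a negative hump
the duration diverges logarithmically as `Q` approaches `2 b - 6`, which gives arbitrarily high
humps, and Chebyshev's inequality makes the flux tend to `-∞`. For oscillating profiles
`exists_oscFlux_le` bounds the flux by `C - α a / 2`. If `m ≤ n`, the duration increases in `b` at
fixed `a`. For `(m + 1, m)` this fails, and the lines `a - 2 b = c` are used instead. There the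
duration is shown to decrease in `a` where `a ^ 2 > -c (12 + c)`; the estimate `two_pi_lt_of_saddle`
shows that the discarded parameters have too long a duration. For `m = 1` that conclusion needs `α ≤
π / 2`, which is why type `(2, 1)` is separate. -/

/-! ### The polar frame -/

theorem radialVec_zero (θ : ℝ) : radialVec θ 0 = Real.cos θ := rfl
theorem radialVec_one (θ : ℝ) : radialVec θ 1 = Real.sin θ := rfl
theorem angularVec_zero (θ : ℝ) : angularVec θ 0 = -Real.sin θ := rfl
theorem angularVec_one (θ : ℝ) : angularVec θ 1 = Real.cos θ := rfl

theorem inner_plane (x y : Plane) : inner ℝ x y = x 0 * y 0 + x 1 * y 1 := by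
  simp [PiLp.inner_apply, Fin.sum_univ_two]
  ring

theorem norm_sq_plane (x : Plane) : ‖x‖ ^ 2 = x 0 ^ 2 + x 1 ^ 2 := by
  rw [← real_inner_self_eq_norm_sq, inner_plane]
  ring

theorem norm_radialVec (θ : ℝ) : ‖radialVec θ‖ = 1 := by
  have h := norm_sq_plane (radialVec θ)
  rw [radialVec_zero, radialVec_one, Real.cos_sq_add_sin_sq] at h
  nlinarith [norm_nonneg (radialVec θ)]

theorem inner_radialVec_radialVec (θ : ℝ) : inner ℝ (radialVec θ) (radialVec θ) = 1 := by
  rw [real_inner_self_eq_norm_sq, norm_radialVec, one_pow]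

theorem inner_angularVec_angularVec (θ : ℝ) : inner ℝ (angularVec θ) (angularVec θ) = 1 := by
  rw [inner_plane, angularVec_zero, angularVec_one]
  linarith [Real.cos_sq_add_sin_sq θ]

theorem inner_radialVec_angularVec (θ : ℝ) : inner ℝ (radialVec θ) (angularVec θ) = 0 := by
  rw [inner_plane, angularVec_zero, angularVec_one, radialVec_zero, radialVec_one]
  ring

theorem inner_angularVec_radialVec (θ : ℝ) : inner ℝ (angularVec θ) (radialVec θ) = 0 := by
  rw [real_inner_comm, inner_radialVec_angularVec]

theorem polar_decomposition (θ : ℝ) (v : Plane) :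
    v = inner ℝ v (radialVec θ) • radialVec θ + inner ℝ v (angularVec θ) • angularVec θ := by
  have h := Real.cos_sq_add_sin_sq θ
  ext i
  fin_cases i
  · simp only [inner_plane, PiLp.add_apply, PiLp.smul_apply, smul_eq_mul, radialVec_zero,
      radialVec_one, angularVec_zero, angularVec_one, Fin.zero_eta]
    linear_combination (-v 0) * h
  · simp only [inner_plane, PiLp.add_apply, PiLp.smul_apply, smul_eq_mul, radialVec_zero,
      radialVec_one, angularVec_zero, angularVec_one, Fin.mk_one]
    linear_combination (-v 1) * h

theorem radialVec_eq (θ : ℝ) : radialVec θ = Real.cos θ • EuclideanSpace.single 0 1 +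
    Real.sin θ • EuclideanSpace.single 1 1 := by
  ext i; fin_cases i <;> simp [radialVec]

theorem angularVec_eq (θ : ℝ) : angularVec θ = (-Real.sin θ) • EuclideanSpace.single 0 1 +
    Real.cos θ • EuclideanSpace.single 1 1 := by
  ext i; fin_cases i <;> simp [angularVec]

theorem hasDerivAt_radialVec (θ : ℝ) : HasDerivAt radialVec (angularVec θ) θ := by
  rw [funext radialVec_eq, angularVec_eq]
  exact ((Real.hasDerivAt_cos θ).smul_const _).add ((Real.hasDerivAt_sin θ).smul_const _)

theorem hasDerivAt_angularVec (θ : ℝ) : HasDerivAt angularVec (-radialVec θ) θ := by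
  rw [funext angularVec_eq, radialVec_eq, neg_add, ← neg_smul, ← neg_smul]
  exact ((Real.hasDerivAt_sin θ).neg.smul_const _).add ((Real.hasDerivAt_cos θ).smul_const _)

theorem contDiff_radialVec : ContDiff ℝ 2 radialVec := by
  rw [contDiff_euclidean]
  intro i
  fin_cases i
  · exact Real.contDiff_cos
  · exact Real.contDiff_sin

theorem contDiff_angularVec : ContDiff ℝ 2 angularVec := by
  rw [contDiff_euclidean]
  intro i
  fin_cases i
  · exact Real.contDiff_sin.neg
  · exact Real.contDiff_cos

/-- The rotated orthonormal frame at the angle `θ`. -/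
noncomputable def polarBasis (θ : ℝ) : OrthonormalBasis (Fin 2) ℝ Plane :=
  OrthonormalBasis.mk (v := ![radialVec θ, angularVec θ])
    (by
      rw [orthonormal_iff_ite]
      intro i j
      fin_cases i <;> fin_cases j <;>
        simp [inner_radialVec_radialVec, inner_angularVec_angularVec, inner_radialVec_angularVec,
          inner_angularVec_radialVec, -inner_self_eq_norm_sq_to_K])
    (by
      intro v _
      rw [polar_decomposition θ v]
      refine Submodule.add_mem _ (Submodule.smul_mem _ _ (Submodule.subset_span ⟨0, rfl⟩))
        (Submodule.smul_mem _ _ (Submodule.subset_span ⟨1, rfl⟩)))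

theorem polarBasis_zero (θ : ℝ) : polarBasis θ 0 = radialVec θ := by
  simp [polarBasis]

theorem polarBasis_one (θ : ℝ) : polarBasis θ 1 = angularVec θ := by
  simp [polarBasis]

/-- The divergence is the trace of the derivative, hence may be computed in the rotated orthonormal
frame. -/
theorem planeDiv_eq_polar (u : Plane → Plane) (x : Plane) (θ : ℝ) :
    planeDiv u x = inner ℝ (fderiv ℝ u x (radialVec θ)) (radialVec θ) +
      inner ℝ (fderiv ℝ u x (angularVec θ)) (angularVec θ) := by
  have h := Real.cos_sq_add_sin_sq θ
  rw [inner_plane, inner_plane, radialVec_zero, radialVec_one, angularVec_zero, angularVec_one,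
    radialVec_eq, angularVec_eq, planeDiv, Fin.sum_univ_two]
  simp only [map_add, map_smul, PiLp.add_apply, PiLp.smul_apply, smul_eq_mul]
  set A := fderiv ℝ u x (EuclideanSpace.single 0 1)
  set B := fderiv ℝ u x (EuclideanSpace.single 1 1)
  linear_combination (-(A 0) - B 1) * h

theorem laplacian_eq_polar (u : Plane → Plane) (x : Plane) (θ : ℝ) :
    (Δ u) x = fderiv ℝ (fderiv ℝ u) x (radialVec θ) (radialVec θ) +
      fderiv ℝ (fderiv ℝ u) x (angularVec θ) (angularVec θ) := by
  rw [InnerProductSpace.laplacian_eq_iteratedFDeriv_orthonormalBasis u (polarBasis θ)]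
  simp [Fin.sum_univ_two, polarBasis_zero, polarBasis_one, iteratedFDeriv_two_apply]

/-! ### Geometry of the sector -/

theorem norm_smul_radialVec {r : ℝ} (hr : 0 < r) (θ : ℝ) : ‖r • radialVec θ‖ = r := by
  rw [norm_smul, norm_radialVec, mul_one, Real.norm_of_nonneg hr.le]

/-- The polar angle of a point of the plane. -/
noncomputable def planeArg (x : Plane) : ℝ := Complex.arg ⟨x 0, x 1⟩

theorem planeArg_smul_radialVec {r θ : ℝ} (hr : 0 < r) (h : θ ∈ Ioc (-Real.pi) Real.pi) :
    planeArg (r • radialVec θ) = θ := by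
  have h1 := Complex.arg_mul_cos_add_sin_mul_I hr h
  rw [planeArg]
  convert! h1 using 2
  apply Complex.ext <;>
    simp [radialVec, ← Complex.ofReal_cos, ← Complex.ofReal_sin]

theorem norm_smul_radialVec_planeArg (x : Plane) : ‖x‖ • radialVec (planeArg x) = x := by
  have hn : ‖(⟨x 0, x 1⟩ : ℂ)‖ = ‖x‖ := by
    have h1 := Complex.sq_norm (⟨x 0, x 1⟩ : ℂ)
    rw [Complex.normSq_mk] at h1
    have h2 := norm_sq_plane x
    exact (sq_eq_sq₀ (norm_nonneg _) (norm_nonneg _)).1 (by rw [h1, h2]; ring)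
  have h := Complex.norm_mul_cos_add_sin_mul_I (⟨x 0, x 1⟩ : ℂ)
  rw [hn] at h
  have h0 := congrArg Complex.re h
  have h1 := congrArg Complex.im h
  simp [← Complex.ofReal_cos, ← Complex.ofReal_sin] at h0 h1
  ext i
  fin_cases i
  · simpa [radialVec, planeArg] using h0
  · simpa [radialVec, planeArg] using h1

theorem planeArg_mem (x : Plane) : planeArg x ∈ Ioc (-Real.pi) Real.pi := Complex.arg_mem_Ioc _

theorem cos_planeArg_mul_norm (x : Plane) : ‖x‖ * Real.cos (planeArg x) = x 0 := by
  conv_rhs => rw [← norm_smul_radialVec_planeArg x]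
  simp [radialVec]

theorem mem_sector_iff {α : ℝ} (hα : α < Real.pi) {x : Plane} :
    x ∈ sector α ↔ x ≠ 0 ∧ planeArg x ∈ Ioo (-α) α := by
  constructor
  · rintro ⟨r, hr, θ, hθ, rfl⟩
    rw [planeArg_smul_radialVec hr ⟨by linarith [hθ.1], by linarith [hθ.2]⟩]
    refine ⟨?_, hθ⟩
    rw [← norm_pos_iff, norm_smul_radialVec hr]
    exact hr
  · rintro ⟨h0, h⟩
    exact ⟨‖x‖, norm_pos_iff.2 h0, planeArg x, h, (norm_smul_radialVec_planeArg x).symm⟩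

theorem abs_lt_iff_cos_lt {α θ : ℝ} (hα₀ : 0 ≤ α) (hα : α ≤ Real.pi) (hθ : |θ| ≤ Real.pi) :
    |θ| < α ↔ Real.cos α < Real.cos θ := by
  rw [← Real.cos_abs θ]
  exact (Real.strictAntiOn_cos.lt_iff_gt ⟨hα₀, hα⟩ ⟨abs_nonneg _, hθ⟩).symm

/-- Since cosine is strictly decreasing on `[0, π]`, the angular condition becomes a strict
inequality between continuous functions, from which openness and the closure can be read off. -/
theorem sector_eq {α : ℝ} (hα₀ : 0 < α) (hα : α < Real.pi) :
    sector α = {x : Plane | ‖x‖ * Real.cos α < x 0} := by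
  ext x
  rw [mem_sector_iff hα, mem_ofPred_eq]
  rcases eq_or_ne x 0 with rfl | hx
  · simp
  have hp : 0 < ‖x‖ := norm_pos_iff.2 hx
  rw [← cos_planeArg_mul_norm x, mul_lt_mul_iff_right₀ hp,
    ← abs_lt_iff_cos_lt hα₀.le hα.le (abs_le.2 ⟨(planeArg_mem x).1.le, (planeArg_mem x).2⟩), abs_lt]
  simp [hx]

theorem isOpen_sector {α : ℝ} (hα₀ : 0 < α) (hα : α < Real.pi) : IsOpen (sector α) := by
  rw [sector_eq hα₀ hα]
  exact isOpen_lt (by fun_prop) (by fun_prop)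

theorem planeArg_mem_Icc_of_mem_closure {α : ℝ} (hα₀ : 0 < α) (hα : α < Real.pi) {x : Plane}
    (hx : x ∈ closure (sector α)) (h0 : x ≠ 0) : planeArg x ∈ Icc (-α) α := by
  have hc : IsClosed {x : Plane | ‖x‖ * Real.cos α ≤ x 0} :=
    isClosed_le (by fun_prop) (by fun_prop)
  have h1 : x ∈ {x : Plane | ‖x‖ * Real.cos α ≤ x 0} := by
    refine closure_minimal ?_ hc hx
    rw [sector_eq hα₀ hα]
    exact fun y (hy : ‖y‖ * Real.cos α < y 0) => mem_ofPred_eq ▸ hy.le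
  have hp : 0 < ‖x‖ := norm_pos_iff.2 h0
  rw [mem_ofPred_eq, ← cos_planeArg_mul_norm x, mul_le_mul_iff_right₀ hp, ← Real.cos_abs (planeArg x),
    Real.strictAntiOn_cos.le_iff_ge ⟨hα₀.le, hα.le⟩
      ⟨abs_nonneg _, abs_le.2 ⟨(planeArg_mem x).1.le, (planeArg_mem x).2⟩⟩, abs_le] at h1
  exact h1

theorem smul_radialVec_mem_closure {α r θ : ℝ} (hα₀ : 0 < α) (hr : 0 < r) (hθ : θ ∈ Icc (-α) α) :
    r • radialVec θ ∈ closure (sector α) := by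
  have hc : Continuous fun θ => r • radialVec θ :=
    contDiff_radialVec.continuous.const_smul r
  have hm : MapsTo (fun θ => r • radialVec θ) (Ioo (-α) α) (sector α) :=
    fun t ht => ⟨r, hr, t, ht, rfl⟩
  have := hm.closure hc
  rw [closure_Ioo (by linarith)] at this
  exact this hθ

theorem frontier_sector_planeArg {α : ℝ} (hα₀ : 0 < α) (hα : α < Real.pi) {x : Plane}
    (hx : x ∈ frontier (sector α)) (h0 : x ≠ 0) : planeArg x = -α ∨ planeArg x = α := by
  rw [(isOpen_sector hα₀ hα).frontier_eq] at hx
  have h1 := planeArg_mem_Icc_of_mem_closure hα₀ hα hx.1 h0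
  have h2 := hx.2
  rw [mem_sector_iff hα] at h2
  by_contra! h
  exact h2 ⟨h0, lt_of_le_of_ne h1.1 (Ne.symm h.1), lt_of_le_of_ne h1.2 h.2⟩

theorem smul_radialVec_mem_frontier {α r θ : ℝ} (hα₀ : 0 < α) (hα : α < Real.pi) (hr : 0 < r)
    (hθ : θ = -α ∨ θ = α) : r • radialVec θ ∈ frontier (sector α) \ {0} := by
  have hI : θ ∈ Icc (-α) α := by rcases hθ with rfl | rfl <;> constructor <;> linarith
  refine ⟨?_, ?_⟩
  · rw [(isOpen_sector hα₀ hα).frontier_eq]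
    refine ⟨smul_radialVec_mem_closure hα₀ hr hI, fun h => ?_⟩
    rw [mem_sector_iff hα, planeArg_smul_radialVec hr ⟨by linarith [hI.1], by linarith [hI.2]⟩] at h
    rcases hθ with rfl | rfl
    · exact lt_irrefl _ h.2.1
    · exact lt_irrefl _ h.2.2
  · rw [mem_singleton_iff, ← norm_eq_zero, norm_smul_radialVec hr]
    exact hr.ne'

/-- The polar angle is the imaginary part of the principal logarithm, which is smooth off the slit.
-/
theorem contDiffAt_planeArg {x : Plane} (h : planeArg x ≠ Real.pi) (h0 : x ≠ 0) :
    ContDiffAt ℝ 2 planeArg x := by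
  have hs : (⟨x 0, x 1⟩ : ℂ) ∈ Complex.slitPlane := by
    rw [Complex.mem_slitPlane_iff_arg]
    refine ⟨h, fun hz => h0 ?_⟩
    have h0 := congrArg Complex.re hz
    have h1 := congrArg Complex.im hz
    ext i
    fin_cases i
    · simpa using h0
    · simpa using h1
  have hlog : ContDiffAt ℝ 2 Complex.log (⟨x 0, x 1⟩ : ℂ) :=
    (Complex.contDiffAt_log hs).restrict_scalars ℝ
  have hlin : ContDiff ℝ 2 fun x : Plane => (⟨x 0, x 1⟩ : ℂ) := by
    have : (fun x : Plane => (⟨x 0, x 1⟩ : ℂ)) =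
        fun x : Plane => (x 0 : ℂ) + (x 1 : ℂ) * Complex.I := by
      funext x
      apply Complex.ext <;> simp
    rw [this]
    have h0 : ContDiff ℝ 2 fun x : Plane => x 0 := contDiff_euclidean.1 contDiff_id 0
    have h1 : ContDiff ℝ 2 fun x : Plane => x 1 := contDiff_euclidean.1 contDiff_id 1
    exact (Complex.ofRealCLM.contDiff.comp h0).add
      ((Complex.ofRealCLM.contDiff.comp h1).mul contDiff_const)
  have := (Complex.imCLM.contDiff.contDiffAt).comp x (hlog.comp x hlin.contDiffAt)
  refine this.congr_of_eventuallyEq (Filter.Eventually.of_forall fun y => ?_)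
  simp [planeArg, Complex.log_im]

/-! ### Polar calculus for homogeneous fields -/

theorem homogeneous_neg_one {α : ℝ} {u : Plane → Plane}
    (h : ∀ l : ℝ, 0 < l → ∀ x ∈ sector α, u x = l • u (l • x)) {r θ : ℝ} (hr : 0 < r)
    (hθ : θ ∈ Ioo (-α) α) : u (r • radialVec θ) = r⁻¹ • u (radialVec θ) := by
  have h1 := h r hr (radialVec θ) ⟨1, one_pos, θ, hθ, (one_smul _ _).symm⟩
  rw [h1, smul_smul, inv_mul_cancel₀ hr.ne', one_smul]

theorem homogeneous_neg_two {α : ℝ} {p : Plane → ℝ}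
    (h : ∀ l : ℝ, 0 < l → ∀ x ∈ sector α, p x = l ^ 2 * p (l • x)) {r θ : ℝ} (hr : 0 < r)
    (hθ : θ ∈ Ioo (-α) α) : p (r • radialVec θ) = (r ^ 2)⁻¹ * p (radialVec θ) := by
  have h1 := h r hr (radialVec θ) ⟨1, one_pos, θ, hθ, (one_smul _ _).symm⟩
  rw [h1]
  field_simp

theorem hasDerivAt_smul_const_id {E : Type*} [NormedAddCommGroup E] [NormedSpace ℝ E] (v : E)
    (r : ℝ) : HasDerivAt (fun r : ℝ => r • v) v r := by
  simpa using (hasDerivAt_id r).smul_const v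

theorem fderiv_radialVec_of_homogeneous {α : ℝ} (hα₀ : 0 < α) (hα : α < Real.pi)
    {u : Plane → Plane} (hu : ContDiffOn ℝ 2 u (sector α))
    (h : ∀ l : ℝ, 0 < l → ∀ x ∈ sector α, u x = l • u (l • x)) {r θ : ℝ} (hr : 0 < r)
    (hθ : θ ∈ Ioo (-α) α) :
    fderiv ℝ u (r • radialVec θ) (radialVec θ) = (-(r ^ 2)⁻¹) • u (radialVec θ) := by
  have hx : r • radialVec θ ∈ sector α := ⟨r, hr, θ, hθ, rfl⟩
  have hd := ((hu.contDiffAt ((isOpen_sector hα₀ hα).mem_nhds hx)).differentiableAt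
    (by norm_num)).hasFDerivAt
  have h1 := hd.comp_hasDerivAt r (hasDerivAt_smul_const_id (radialVec θ) r)
  have h2 := (hasDerivAt_inv hr.ne').smul_const (u (radialVec θ))
  refine h1.unique (h2.congr_of_eventuallyEq ?_)
  filter_upwards [lt_mem_nhds hr] with s hs using homogeneous_neg_one h hs hθ

theorem hasDerivAt_smul_radialVec (r θ : ℝ) :
    HasDerivAt (fun θ => r • radialVec θ) (r • angularVec θ) θ :=
  (hasDerivAt_radialVec θ).const_smul r

theorem fderiv_angularVec_of_homogeneous {α : ℝ} (hα₀ : 0 < α) (hα : α < Real.pi)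
    {u : Plane → Plane} (hu : ContDiffOn ℝ 2 u (sector α))
    (h : ∀ l : ℝ, 0 < l → ∀ x ∈ sector α, u x = l • u (l • x)) {r θ : ℝ} (hr : 0 < r)
    (hθ : θ ∈ Ioo (-α) α) {U' : Plane} (hU : HasDerivAt (fun θ => u (radialVec θ)) U' θ) :
    fderiv ℝ u (r • radialVec θ) (angularVec θ) = (r ^ 2)⁻¹ • U' := by
  have hx : r • radialVec θ ∈ sector α := ⟨r, hr, θ, hθ, rfl⟩
  have hd := ((hu.contDiffAt ((isOpen_sector hα₀ hα).mem_nhds hx)).differentiableAt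
    (by norm_num)).hasFDerivAt
  have h1 := hd.comp_hasDerivAt θ (hasDerivAt_smul_radialVec r θ)
  have h3 := h1.unique ((hU.const_smul r⁻¹).congr_of_eventuallyEq (by
    filter_upwards [isOpen_Ioo.mem_nhds hθ] with s hs using homogeneous_neg_one h hr hs))
  rw [map_smul] at h3
  have h4 := congrArg (fun v => r⁻¹ • v) h3
  simp only [smul_smul, inv_mul_cancel₀ hr.ne', one_smul] at h4
  rw [h4]
  congr 1
  field_simp

theorem fderiv_pressure_radialVec {α : ℝ} (hα₀ : 0 < α) (hα : α < Real.pi)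
    {p : Plane → ℝ} (hp : ContDiffOn ℝ 1 p (sector α))
    (h : ∀ l : ℝ, 0 < l → ∀ x ∈ sector α, p x = l ^ 2 * p (l • x)) {r θ : ℝ} (hr : 0 < r)
    (hθ : θ ∈ Ioo (-α) α) :
    fderiv ℝ p (r • radialVec θ) (radialVec θ) = -2 * (r ^ 3)⁻¹ * p (radialVec θ) := by
  have hx : r • radialVec θ ∈ sector α := ⟨r, hr, θ, hθ, rfl⟩
  have hd := ((hp.contDiffAt ((isOpen_sector hα₀ hα).mem_nhds hx)).differentiableAt
    (by norm_num)).hasFDerivAt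
  have h1 := hd.comp_hasDerivAt r (hasDerivAt_smul_const_id (radialVec θ) r)
  have h2 := ((hasDerivAt_pow 2 r).inv (pow_ne_zero 2 hr.ne')).mul_const (p (radialVec θ))
  rw [h1.unique (h2.congr_of_eventuallyEq (by
    filter_upwards [lt_mem_nhds hr] with s hs using homogeneous_neg_two h hs hθ))]
  field_simp
  norm_num
  ring

theorem fderiv_pressure_angularVec {α : ℝ} (hα₀ : 0 < α) (hα : α < Real.pi)
    {p : Plane → ℝ} (hp : ContDiffOn ℝ 1 p (sector α))
    (h : ∀ l : ℝ, 0 < l → ∀ x ∈ sector α, p x = l ^ 2 * p (l • x)) {r θ : ℝ} (hr : 0 < r)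
    (hθ : θ ∈ Ioo (-α) α) {P' : ℝ} (hP : HasDerivAt (fun θ => p (radialVec θ)) P' θ) :
    fderiv ℝ p (r • radialVec θ) (angularVec θ) = (r ^ 3)⁻¹ * P' := by
  have hx : r • radialVec θ ∈ sector α := ⟨r, hr, θ, hθ, rfl⟩
  have hd := ((hp.contDiffAt ((isOpen_sector hα₀ hα).mem_nhds hx)).differentiableAt
    (by norm_num)).hasFDerivAt
  have h1 := hd.comp_hasDerivAt θ (hasDerivAt_smul_radialVec r θ)
  have h3 := h1.unique ((hP.const_mul (r ^ 2)⁻¹).congr_of_eventuallyEq (by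
    filter_upwards [isOpen_Ioo.mem_nhds hθ] with s hs using homogeneous_neg_two h hr hs))
  rw [map_smul, smul_eq_mul] at h3
  have h4 : fderiv ℝ p (r • radialVec θ) (angularVec θ) = r⁻¹ * ((r ^ 2)⁻¹ * P') := by
    rw [← h3]; field_simp
  rw [h4]
  field_simp

/-- The second radial derivative of `r⁻¹ U` contributes `2 r⁻³ U`. In the angular direction,
differentiating the frame vector as well produces a first radial derivative, which turns `r⁻³ U''`
into `r⁻³ (U'' - U)`. -/
theorem laplacian_of_homogeneous {α : ℝ} (hα₀ : 0 < α) (hα : α < Real.pi)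
    {u : Plane → Plane} (hu : ContDiffOn ℝ 2 u (sector α))
    (h : ∀ l : ℝ, 0 < l → ∀ x ∈ sector α, u x = l • u (l • x)) {r θ : ℝ} (hr : 0 < r)
    (hθ : θ ∈ Ioo (-α) α) {U' : ℝ → Plane} {U'' : Plane}
    (hU : ∀ θ ∈ Ioo (-α) α, HasDerivAt (fun θ => u (radialVec θ)) (U' θ) θ)
    (hU' : HasDerivAt U' U'' θ) :
    (Δ u) (r • radialVec θ) = (r ^ 3)⁻¹ • (U'' + u (radialVec θ)) := by
  have hx : r • radialVec θ ∈ sector α := ⟨r, hr, θ, hθ, rfl⟩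
  have hc : ContDiffAt ℝ 1 (fderiv ℝ u) (r • radialVec θ) :=
    (hu.contDiffAt ((isOpen_sector hα₀ hα).mem_nhds hx)).fderiv_right (by norm_num)
  have hd := (hc.differentiableAt (by norm_num)).hasFDerivAt
  have hrr : fderiv ℝ (fderiv ℝ u) (r • radialVec θ) (radialVec θ) (radialVec θ) =
      (2 * (r ^ 3)⁻¹) • u (radialVec θ) := by
    have h0 : HasDerivAt (fun s : ℝ => fderiv ℝ u (s • radialVec θ))
        (fderiv ℝ (fderiv ℝ u) (r • radialVec θ) (radialVec θ)) r :=
      hd.comp_hasDerivAt r (hasDerivAt_smul_const_id (radialVec θ) r)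
    have h1 := h0.clm_apply (hasDerivAt_const r (radialVec θ))
    have h2 := ((hasDerivAt_pow 2 r).inv (pow_ne_zero 2 hr.ne')).neg.smul_const (u (radialVec θ))
    have h3 := h1.unique (h2.congr_of_eventuallyEq (by
      filter_upwards [lt_mem_nhds hr] with s hs using
        fderiv_radialVec_of_homogeneous hα₀ hα hu h hs hθ))
    rw [map_zero, add_zero] at h3
    rw [h3]
    congr 1
    field_simp
    norm_num
    ring
  have htt : fderiv ℝ (fderiv ℝ u) (r • radialVec θ) (angularVec θ) (angularVec θ) =
      (r ^ 3)⁻¹ • (U'' - u (radialVec θ)) := by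
    have h0 : HasDerivAt (fun s : ℝ => fderiv ℝ u (r • radialVec s))
        (fderiv ℝ (fderiv ℝ u) (r • radialVec θ) (r • angularVec θ)) θ :=
      hd.comp_hasDerivAt θ (hasDerivAt_smul_radialVec r θ)
    have h1 := h0.clm_apply (hasDerivAt_angularVec θ)
    have h3 := h1.unique ((hU'.const_smul (r ^ 2)⁻¹).congr_of_eventuallyEq (by
      filter_upwards [isOpen_Ioo.mem_nhds hθ] with s hs using
        fderiv_angularVec_of_homogeneous hα₀ hα hu h hr hs (hU s hs)))
    simp only [map_smul, smul_apply, map_neg] at h3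
    rw [fderiv_radialVec_of_homogeneous hα₀ hα hu h hr hθ, ← neg_smul, neg_neg] at h3
    have h4 := congrArg (fun v => r⁻¹ • (v - (r ^ 2)⁻¹ • u (radialVec θ))) h3
    simp only [add_sub_cancel_right, smul_smul, inv_mul_cancel₀ hr.ne', one_smul] at h4
    rw [h4, ← smul_sub, smul_smul]
    congr 1
    field_simp
  rw [laplacian_eq_polar u _ θ, hrr, htt]
  module

theorem inner_gradient_eq (p : Plane → ℝ) (x v : Plane) :
    inner ℝ (gradient p x) v = fderiv ℝ p x v := by
  rw [gradient, InnerProductSpace.toDual_symm_apply]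

theorem eq_const_of_hasDerivAt_zero {a b : ℝ} {h : ℝ → ℝ}
    (hd : ∀ t ∈ Ioo a b, HasDerivAt h 0 t) : ∃ k, ∀ t ∈ Ioo a b, h t = k := by
  obtain ⟨k, hk⟩ := isOpen_Ioo.exists_is_const_of_deriv_eq_zero isPreconnected_Ioo
    (fun t ht => (hd t ht).differentiableAt.differentiableWithinAt) (fun t ht => (hd t ht).deriv)
  exact ⟨k, hk⟩

/-! ### The Jeffery-Hamel equation -/

/-- `f` is a Jeffery-Hamel profile on `[-α, α]` with derivative `g` and constant `c`. -/
structure IsProfile (α : ℝ) (f g : ℝ → ℝ) (c : ℝ) : Prop where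
  continuousOn : ContinuousOn f (Icc (-α) α)
  left : f (-α) = 0
  right : f α = 0
  hasDerivAt : ∀ t ∈ Ioo (-α) α, HasDerivAt f (g t) t
  hasDerivAt' : ∀ t ∈ Ioo (-α) α, HasDerivAt g (c - 4 * f t - f t ^ 2) t

/-! ### From a self-similar solution to its profile -/

theorem IsSelfSimilarSolution.continuousOn_angle {α : ℝ} (hα₀ : 0 < α)
    {u : Plane → Plane} {p : Plane → ℝ} (h : IsSelfSimilarSolution α u p) :
    ContinuousOn (fun θ => u (radialVec θ)) (Icc (-α) α) := by
  refine h.continuousOn_velocity.comp contDiff_radialVec.continuous.continuousOn fun θ hθ => ?_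
  refine ⟨?_, ?_⟩
  · simpa using smul_radialVec_mem_closure hα₀ one_pos hθ
  · rw [mem_singleton_iff, ← norm_eq_zero, norm_radialVec]
    exact one_ne_zero

theorem IsSelfSimilarSolution.boundary {α : ℝ} (hα₀ : 0 < α) (hα : α < Real.pi)
    {u : Plane → Plane} {p : Plane → ℝ} (h : IsSelfSimilarSolution α u p) {θ : ℝ}
    (hθ : θ = -α ∨ θ = α) {r : ℝ} (hr : 0 < r) : u (r • radialVec θ) = 0 :=
  h.no_slip _ (smul_radialVec_mem_frontier hα₀ hα hr hθ)

theorem IsSelfSimilarSolution.contDiffOn_angle {α : ℝ}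
    {u : Plane → Plane} {p : Plane → ℝ} (h : IsSelfSimilarSolution α u p) :
    ContDiffOn ℝ 2 (fun θ => u (radialVec θ)) (Ioo (-α) α) :=
  h.contDiffOn_velocity.comp contDiff_radialVec.contDiffOn
    fun θ hθ => ⟨1, one_pos, θ, hθ, (one_smul _ _).symm⟩

/-- On the unit arc `div u = 0` reads `U' · e_θ = U · e_r`, which is exactly the vanishing of the
derivative of `U · e_θ`. The constant is evaluated at the boundary, where continuity and no slip
give zero. -/
theorem IsSelfSimilarSolution.angularPart_one {α : ℝ} (hα₀ : 0 < α) (hα : α < Real.pi)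
    {u : Plane → Plane} {p : Plane → ℝ} (h : IsSelfSimilarSolution α u p) {θ : ℝ}
    (hθ : θ ∈ Ioo (-α) α) : inner ℝ (u (radialVec θ)) (angularVec θ) = 0 := by
  set w : ℝ → ℝ := fun θ => inner ℝ (u (radialVec θ)) (angularVec θ) with hw
  have hd : ∀ t ∈ Ioo (-α) α, HasDerivAt w 0 t := by
    intro t ht
    have hU : HasDerivAt (fun θ => u (radialVec θ)) (deriv (fun θ => u (radialVec θ)) t) t :=
      ((h.contDiffOn_angle.contDiffAt (isOpen_Ioo.mem_nhds ht)).differentiableAt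
        (by norm_num)).hasDerivAt
    have h1 := hU.inner ℝ (hasDerivAt_angularVec t)
    have h2 := h.div_eq_zero (radialVec t) ⟨1, one_pos, t, ht, (one_smul _ _).symm⟩
    have h3 := fderiv_radialVec_of_homogeneous hα₀ hα h.contDiffOn_velocity
      h.selfSimilar_velocity one_pos ht
    have h4 := fderiv_angularVec_of_homogeneous hα₀ hα h.contDiffOn_velocity
      h.selfSimilar_velocity one_pos ht hU
    simp only [one_smul, one_pow, inv_one, neg_smul] at h3 h4
    rw [planeDiv_eq_polar u _ t, h3, h4, inner_neg_left] at h2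
    rw [inner_neg_right, h2] at h1
    exact h1
  obtain ⟨k, hk⟩ := eq_const_of_hasDerivAt_zero hd
  have hc : ContinuousOn w (Icc (-α) α) :=
    (h.continuousOn_angle hα₀).inner contDiff_angularVec.continuous.continuousOn
  have hα1 : w α = 0 := by
    have := h.boundary hα₀ hα (Or.inr rfl) one_pos
    rw [one_smul] at this
    simp [hw, this]
  have hcl : closure (Ioo (-α) α) = Icc (-α) α := closure_Ioo (by linarith)
  have hα2 : w α = k := by
    have h1 : EqOn w (fun _ => k) (Ioo (-α) α) := hk
    have h2 := h1.of_subset_closure hc continuousOn_const Ioo_subset_Icc_self hcl.ge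
    exact h2 ⟨by linarith, le_rfl⟩
  change w θ = 0
  rw [hk θ hθ, ← hα2, hα1]

theorem IsSelfSimilarSolution.angularPart_eq_zero {α : ℝ} (hα₀ : 0 < α) (hα : α < Real.pi)
    {u : Plane → Plane} {p : Plane → ℝ} (h : IsSelfSimilarSolution α u p) {r θ : ℝ} (hr : 0 < r)
    (hθ : θ ∈ Ioo (-α) α) : angularPart u r θ = 0 := by
  rw [angularPart, homogeneous_neg_one h.selfSimilar_velocity hr hθ, real_inner_smul_left,
    h.angularPart_one hα₀ hα hθ, mul_zero]

theorem IsSelfSimilarSolution.exists_profile {α : ℝ} (hα₀ : 0 < α) (hα : α < Real.pi)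
    {u : Plane → Plane} {p : Plane → ℝ} (h : IsSelfSimilarSolution α u p) :
    ∃ g c, IsProfile α (radialPart u 1) g c := by
  set U : ℝ → Plane := fun θ => u (radialVec θ) with hUdef
  set f : ℝ → ℝ := radialPart u 1 with hf
  have hfU : ∀ θ, f θ = inner ℝ (U θ) (radialVec θ) := fun θ => by
    simp [hf, radialPart, hUdef]
  have hUf : ∀ θ ∈ Ioo (-α) α, U θ = f θ • radialVec θ := fun θ hθ => by
    rw [polar_decomposition θ (U θ), ← hfU, h.angularPart_one hα₀ hα hθ, zero_smul, add_zero]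
  have hfc : ContDiffOn ℝ 2 f (Ioo (-α) α) :=
    (h.contDiffOn_angle.inner ℝ contDiff_radialVec.contDiffOn).congr fun θ _ => hfU θ
  have hd1 : ∀ t ∈ Ioo (-α) α, HasDerivAt f (deriv f t) t := fun t ht =>
    ((hfc.contDiffAt (isOpen_Ioo.mem_nhds ht)).differentiableAt (by norm_num)).hasDerivAt
  have hd2 : ∀ t ∈ Ioo (-α) α, HasDerivAt (deriv f) (deriv (deriv f) t) t := by
    have h2 : ContDiffOn ℝ (1 + 1) f (Ioo (-α) α) := by convert! hfc using 1
    have h3 := ((contDiffOn_succ_iff_deriv_of_isOpen isOpen_Ioo).1 h2).2.2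
    intro t ht
    exact ((h3.contDiffAt (isOpen_Ioo.mem_nhds ht)).differentiableAt (by norm_num)).hasDerivAt
  set P : ℝ → ℝ := fun θ => p (radialVec θ) with hP
  have hPd : ∀ t ∈ Ioo (-α) α, HasDerivAt P (deriv P t) t := by
    intro t ht
    have : ContDiffOn ℝ 1 P (Ioo (-α) α) := h.contDiffOn_pressure.comp
      (contDiff_radialVec.of_le (by norm_num)).contDiffOn
      fun θ hθ => ⟨1, one_pos, θ, hθ, (one_smul _ _).symm⟩
    exact ((this.contDiffAt (isOpen_Ioo.mem_nhds ht)).differentiableAt (by norm_num)).hasDerivAt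
  have hU1 : ∀ t ∈ Ioo (-α) α, HasDerivAt U (f t • angularVec t + deriv f t • radialVec t) t := by
    intro t ht
    refine ((hd1 t ht).smul (hasDerivAt_radialVec t)).congr_of_eventuallyEq ?_
    filter_upwards [isOpen_Ioo.mem_nhds ht] with s hs using hUf s hs
  -- These are the radial and tangential components of the momentum equation. The second makes `P -
  -- 2 f` a constant `k`, and eliminating `P` from the first gives the equation of the profile with
  -- `c = -2 k`.
  have key : ∀ t ∈ Ioo (-α) α, deriv (deriv f) t + f t ^ 2 + 2 * P t = 0 ∧
      deriv P t - 2 * deriv f t = 0 := by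
    intro t ht
    have hU2 := ((hd1 t ht).smul (hasDerivAt_angularVec t)).add
      ((hd2 t ht).smul (hasDerivAt_radialVec t))
    have hm := h.momentum (radialVec t) ⟨1, one_pos, t, ht, (one_smul _ _).symm⟩
    have hL := laplacian_of_homogeneous hα₀ hα h.contDiffOn_velocity h.selfSimilar_velocity
      one_pos ht hU1 hU2
    have hA := fderiv_radialVec_of_homogeneous hα₀ hα h.contDiffOn_velocity
      h.selfSimilar_velocity one_pos ht
    have hp1 := fderiv_pressure_radialVec hα₀ hα h.contDiffOn_pressure
      h.selfSimilar_pressure one_pos ht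
    have hp2 := fderiv_pressure_angularVec hα₀ hα h.contDiffOn_pressure
      h.selfSimilar_pressure one_pos ht (hPd t ht)
    simp only [one_smul, one_pow, inv_one, neg_smul, one_mul, mul_one] at hL hA hp1 hp2
    have hu : u (radialVec t) = f t • radialVec t := hUf t ht
    rw [hL, hu, map_smul, hA, hu] at hm
    have e1 := congrArg (fun v => inner ℝ v (radialVec t)) hm
    have e2 := congrArg (fun v => inner ℝ v (angularVec t)) hm
    simp only [inner_add_left, inner_neg_left, real_inner_smul_left, inner_radialVec_radialVec,
      inner_angularVec_angularVec, inner_radialVec_angularVec, inner_angularVec_radialVec,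
      inner_gradient_eq, hp1, hp2, inner_zero_left, smul_neg] at e1 e2
    constructor
    · change _ + _ + 2 * p (radialVec t) = 0
      linarith
    · linarith
  have hk : ∀ t ∈ Ioo (-α) α, HasDerivAt (fun t => P t - 2 * f t) 0 t := by
    intro t ht
    have := (hPd t ht).sub ((hd1 t ht).const_mul 2)
    rwa [(key t ht).2] at this
  obtain ⟨k, hk⟩ := eq_const_of_hasDerivAt_zero hk
  refine ⟨deriv f, -2 * k, ?_, ?_, ?_, hd1, ?_⟩
  · exact ((h.continuousOn_angle hα₀).inner contDiff_radialVec.continuous.continuousOn).congr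
      fun θ _ => hfU θ
  · rw [hf, radialPart, h.boundary hα₀ hα (Or.inl rfl) one_pos, inner_zero_left]
  · rw [hf, radialPart, h.boundary hα₀ hα (Or.inr rfl) one_pos, inner_zero_left]
  · intro t ht
    convert! hd2 t ht using 1
    linarith [(key t ht).1, hk t ht]

theorem hasFlux_iff {α : ℝ} (hα₀ : 0 < α) (hα : α < Real.pi)
    {u : Plane → Plane} {p : Plane → ℝ} (h : IsSelfSimilarSolution α u p) (Φ : ℝ) :
    HasFlux α u Φ ↔ ∫ θ in (-α)..α, radialPart u 1 θ = Φ := by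
  have key : ∀ r : ℝ, 0 < r → ∫ θ in (-α)..α, radialPart u r θ * r =
      ∫ θ in (-α)..α, radialPart u 1 θ := by
    intro r hr
    refine intervalIntegral.integral_congr fun θ hθ => ?_
    rw [uIcc_of_le (by linarith)] at hθ
    -- Self-similarity is assumed in the open sector only, so the two boundary angles are settled by
    -- no slip.
    by_cases hb : θ = -α ∨ θ = α
    · simp only [radialPart]
      rw [h.boundary hα₀ hα hb one_pos, h.boundary hα₀ hα hb hr]
      simp
    · push Not at hb
      have hθ' : θ ∈ Ioo (-α) α := ⟨lt_of_le_of_ne hθ.1 (Ne.symm hb.1), lt_of_le_of_ne hθ.2 hb.2⟩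
      simp only [radialPart]
      rw [homogeneous_neg_one h.selfSimilar_velocity hr hθ', one_smul, real_inner_smul_left]
      field_simp
  constructor
  · intro hF
    rw [← key 1 one_pos]
    exact hF 1 one_pos
  · intro hF r hr
    rw [key r hr, hF]

/-! ### From a profile to a self-similar solution -/

theorem IsProfile.contDiffOn {α c : ℝ} {f g : ℝ → ℝ} (h : IsProfile α f g c) :
    ContDiffOn ℝ 2 f (Ioo (-α) α) := by
  have hf : DifferentiableOn ℝ f (Ioo (-α) α) := fun t ht =>
    (h.hasDerivAt t ht).differentiableAt.differentiableWithinAt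
  have hg : DifferentiableOn ℝ g (Ioo (-α) α) := fun t ht =>
    (h.hasDerivAt' t ht).differentiableAt.differentiableWithinAt
  have h2 : ContDiffOn ℝ (1 + 1) f (Ioo (-α) α) := by
    rw [contDiffOn_succ_iff_deriv_of_isOpen isOpen_Ioo]
    refine ⟨hf, by simp, ?_⟩
    have hgc : ContDiffOn ℝ (0 + 1) g (Ioo (-α) α) := by
      rw [contDiffOn_succ_iff_deriv_of_isOpen isOpen_Ioo]
      refine ⟨hg, by simp, ?_⟩
      rw [contDiffOn_zero]
      have hc := hf.continuousOn
      exact ((continuousOn_const.sub (hc.const_mul 4)).sub (hc.pow 2)).congr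
        fun t ht => (h.hasDerivAt' t ht).deriv
    rw [zero_add] at hgc
    exact hgc.congr fun t ht => (h.hasDerivAt t ht).deriv
  convert! h2 using 1

/-- The self-similar velocity field with radial profile `f`. -/
noncomputable def profileVelocity (f : ℝ → ℝ) (x : Plane) : Plane :=
  (f (planeArg x) / ‖x‖ ^ 2) • x

/-- The pressure of the self-similar velocity field with radial profile `f`. -/
noncomputable def profilePressure (f : ℝ → ℝ) (c : ℝ) (x : Plane) : ℝ :=
  (2 * f (planeArg x) - c / 2) / ‖x‖ ^ 2

theorem profileVelocity_eq (f : ℝ → ℝ) (x : Plane) :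
    profileVelocity f x = (f (planeArg x) * (‖x‖ ^ 2)⁻¹) • x := by
  rw [profileVelocity, div_eq_mul_inv]

theorem profilePressure_eq (f : ℝ → ℝ) (c : ℝ) (x : Plane) :
    profilePressure f c x = (2 * f (planeArg x) - c / 2) * (‖x‖ ^ 2)⁻¹ := by
  rw [profilePressure, div_eq_mul_inv]

theorem profileVelocity_polar {f : ℝ → ℝ} {r θ : ℝ} (hr : 0 < r)
    (hθ : θ ∈ Ioc (-Real.pi) Real.pi) :
    profileVelocity f (r • radialVec θ) = (r⁻¹ * f θ) • radialVec θ := by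
  rw [profileVelocity, planeArg_smul_radialVec hr hθ, norm_smul_radialVec hr, smul_smul]
  congr 1
  field_simp

theorem profilePressure_polar {f : ℝ → ℝ} {c r θ : ℝ} (hr : 0 < r)
    (hθ : θ ∈ Ioc (-Real.pi) Real.pi) :
    profilePressure f c (r • radialVec θ) = (r ^ 2)⁻¹ * (2 * f θ - c / 2) := by
  rw [profilePressure, planeArg_smul_radialVec hr hθ, norm_smul_radialVec hr]
  field_simp

theorem contDiffAt_norm_sq_inv {x : Plane} (h0 : x ≠ 0) :
    ContDiffAt ℝ 2 (fun x : Plane => (‖x‖ ^ 2)⁻¹) x :=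
  (contDiff_norm_sq ℝ).contDiffAt.inv (pow_ne_zero 2 (norm_ne_zero_iff.2 h0))

/-- The same polar formulas are read backwards. The pressure profile `2 f - c / 2` is the only one
compatible with both components of the momentum equation. -/
theorem IsProfile.isSelfSimilarSolution {α c : ℝ} (hα₀ : 0 < α) (hα : α < Real.pi) {f g : ℝ → ℝ}
    (h : IsProfile α f g c) :
    IsSelfSimilarSolution α (profileVelocity f) (profilePressure f c) := by
  have hmem : ∀ {θ : ℝ}, θ ∈ Ioo (-α) α → θ ∈ Ioc (-Real.pi) Real.pi := fun hθ =>
    ⟨by linarith [hθ.1], by linarith [hθ.2]⟩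
  have hfarg : ContDiffOn ℝ 2 (fun x => f (planeArg x)) (sector α) := by
    intro x hx
    rw [mem_sector_iff hα] at hx
    exact ((h.contDiffOn.contDiffAt (isOpen_Ioo.mem_nhds hx.2)).comp x
      (contDiffAt_planeArg (by linarith [hx.2.2]) hx.1)).contDiffWithinAt
  have hnorm : ContDiffOn ℝ 2 (fun x : Plane => (‖x‖ ^ 2)⁻¹) (sector α) := fun x hx =>
    (contDiffAt_norm_sq_inv ((mem_sector_iff hα).1 hx).1).contDiffWithinAt
  have hu : ContDiffOn ℝ 2 (profileVelocity f) (sector α) := by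
    rw [funext (profileVelocity_eq f)]
    exact (hfarg.mul hnorm).smul contDiffOn_id
  have hp : ContDiffOn ℝ 1 (profilePressure f c) (sector α) := by
    rw [funext (profilePressure_eq f c)]
    exact (((contDiffOn_const.mul hfarg).sub contDiffOn_const).mul hnorm).of_le (by norm_num)
  have hsu : ∀ l : ℝ, 0 < l → ∀ x ∈ sector α, profileVelocity f x = l • profileVelocity f (l • x) := by
    rintro l hl _ ⟨r, hr, θ, hθ, rfl⟩
    rw [smul_smul l r, profileVelocity_polar hr (hmem hθ),
      profileVelocity_polar (mul_pos hl hr) (hmem hθ), smul_smul]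
    congr 1
    field_simp
  have hsp : ∀ l : ℝ, 0 < l → ∀ x ∈ sector α,
      profilePressure f c x = l ^ 2 * profilePressure f c (l • x) := by
    rintro l hl _ ⟨r, hr, θ, hθ, rfl⟩
    rw [smul_smul l r, profilePressure_polar hr (hmem hθ),
      profilePressure_polar (mul_pos hl hr) (hmem hθ)]
    field_simp
  have hU : ∀ θ ∈ Ioo (-α) α, profileVelocity f (radialVec θ) = f θ • radialVec θ := by
    intro θ hθ
    have := profileVelocity_polar (f := f) one_pos (hmem hθ)
    rwa [one_smul, inv_one, one_mul] at this
  have hP : ∀ θ ∈ Ioo (-α) α, profilePressure f c (radialVec θ) = 2 * f θ - c / 2 := by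
    intro θ hθ
    have := profilePressure_polar (f := f) (c := c) one_pos (hmem hθ)
    rwa [one_smul, one_pow, inv_one, one_mul] at this
  have hU1 : ∀ t ∈ Ioo (-α) α, HasDerivAt (fun θ => profileVelocity f (radialVec θ))
      (f t • angularVec t + g t • radialVec t) t := by
    intro t ht
    refine ((h.hasDerivAt t ht).smul (hasDerivAt_radialVec t)).congr_of_eventuallyEq ?_
    filter_upwards [isOpen_Ioo.mem_nhds ht] with s hs using hU s hs
  have hP1 : ∀ t ∈ Ioo (-α) α, HasDerivAt (fun θ => profilePressure f c (radialVec θ))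
      (2 * g t) t := by
    intro t ht
    refine (((h.hasDerivAt t ht).const_mul 2).sub_const (c / 2)).congr_of_eventuallyEq ?_
    filter_upwards [isOpen_Ioo.mem_nhds ht] with s hs using hP s hs
  refine ⟨hu, hp, ?_, ?_, ?_, ?_, hsu, hsp⟩
  · have h1 : ContinuousOn (fun x => f (planeArg x)) (closure (sector α) \ {0}) := by
      intro x hx
      have hI := planeArg_mem_Icc_of_mem_closure hα₀ hα hx.1 hx.2
      have hc := (contDiffAt_planeArg (by linarith [hI.2]) hx.2).continuousAt.continuousWithinAt
        (s := closure (sector α) \ {0})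
      exact (h.continuousOn _ hI).comp hc
        fun y hy => planeArg_mem_Icc_of_mem_closure hα₀ hα hy.1 hy.2
    have h2 : ContinuousOn (fun x : Plane => (‖x‖ ^ 2)⁻¹) (closure (sector α) \ {0}) := fun x hx =>
      (contDiffAt_norm_sq_inv hx.2).continuousAt.continuousWithinAt
    rw [funext (profileVelocity_eq f)]
    exact (h1.mul h2).smul continuousOn_id
  · rintro _ ⟨r, hr, t, ht, rfl⟩
    have hU2 := ((h.hasDerivAt t ht).smul (hasDerivAt_angularVec t)).add
      ((h.hasDerivAt' t ht).smul (hasDerivAt_radialVec t))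
    have hL := laplacian_of_homogeneous hα₀ hα hu hsu hr ht hU1 hU2
    have hA := fderiv_radialVec_of_homogeneous hα₀ hα hu hsu hr ht
    have hp1 := fderiv_pressure_radialVec hα₀ hα hp hsp hr ht
    have hp2 := fderiv_pressure_angularVec hα₀ hα hp hsp hr ht (hP1 t ht)
    rw [hU t ht] at hL hA
    rw [hP t ht] at hp1
    rw [hL, profileVelocity_polar hr (hmem ht), map_smul, hA,
      polar_decomposition t (gradient (profilePressure f c) (r • radialVec t)), inner_gradient_eq,
      inner_gradient_eq, hp1, hp2]
    have hr3 : r⁻¹ * (r ^ 2)⁻¹ = (r ^ 3)⁻¹ := by field_simp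
    have : r⁻¹ * f t * (-(r ^ 2)⁻¹ * f t) = -(r ^ 3)⁻¹ * f t ^ 2 := by rw [← hr3]; ring
    simp only [smul_smul]
    rw [this]
    module
  · rintro _ ⟨r, hr, t, ht, rfl⟩
    rw [planeDiv_eq_polar _ _ t, fderiv_radialVec_of_homogeneous hα₀ hα hu hsu hr ht,
      fderiv_angularVec_of_homogeneous hα₀ hα hu hsu hr ht (hU1 t ht), hU t ht]
    simp only [inner_add_left, real_inner_smul_left, inner_radialVec_radialVec,
      inner_angularVec_angularVec, inner_radialVec_angularVec]
    ring
  · rintro x ⟨hx, h0⟩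
    rw [profileVelocity]
    rcases frontier_sector_planeArg hα₀ hα hx h0 with h1 | h1
    · rw [h1, h.left, zero_div, zero_smul]
    · rw [h1, h.right, zero_div, zero_smul]

theorem radialPart_profileVelocity {α : ℝ} (hα : α < Real.pi) {f : ℝ → ℝ} {θ : ℝ}
    (hθ : θ ∈ Icc (-α) α) : radialPart (profileVelocity f) 1 θ = f θ := by
  rw [radialPart, profileVelocity_polar one_pos ⟨by linarith [hθ.1], by linarith [hθ.2]⟩,
    real_inner_smul_left, inner_radialVec_radialVec, inv_one, one_mul, mul_one]

/-- The sets of positivity and negativity of `f` on `(-α, α)` have `mPlus` and `mMinus`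
components. -/
def ProfileType (α : ℝ) (f : ℝ → ℝ) (mPlus mMinus : ℕ) : Prop :=
  numIntervals {θ | θ ∈ Ioo (-α) α ∧ 0 < f θ} = (mPlus : ℕ∞) ∧
  numIntervals {θ | θ ∈ Ioo (-α) α ∧ f θ < 0} = (mMinus : ℕ∞)

/-- There is a Jeffery-Hamel profile of type `(mPlus, mMinus)` with integral `Φ`. -/
def ExistsProfile (α : ℝ) (mPlus mMinus : ℕ) (Φ : ℝ) : Prop :=
  ∃ f g c, IsProfile α f g c ∧ ∫ θ in (-α)..α, f θ = Φ ∧ ProfileType α f mPlus mMinus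

theorem existsSolution_iff {α : ℝ} (hα₀ : 0 < α) (hα : α < Real.pi) (mPlus mMinus : ℕ) (Φ : ℝ) :
    ExistsSolution α mPlus mMinus Φ ↔ ExistsProfile α mPlus mMinus Φ := by
  constructor
  · rintro ⟨u, p, h, hF, hT⟩
    obtain ⟨g, c, hp⟩ := h.exists_profile hα₀ hα
    exact ⟨_, g, c, hp, (hasFlux_iff hα₀ hα h Φ).1 hF, hT⟩
  · rintro ⟨f, g, c, hp, hF, hT⟩
    have hs := hp.isSelfSimilarSolution hα₀ hα
    refine ⟨_, _, hs, (hasFlux_iff hα₀ hα hs Φ).2 ?_, ?_⟩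
    · rw [← hF]
      refine intervalIntegral.integral_congr fun θ hθ => ?_
      rw [uIcc_of_le (by linarith)] at hθ
      exact radialPart_profileVelocity hα hθ
    · have h1 : {θ | θ ∈ Ioo (-α) α ∧ 0 < radialPart (profileVelocity f) 1 θ} =
          {θ | θ ∈ Ioo (-α) α ∧ 0 < f θ} := by
        ext θ
        exact and_congr_right fun hθ => by
          rw [radialPart_profileVelocity hα (Ioo_subset_Icc_self hθ)]
      have h2 : {θ | θ ∈ Ioo (-α) α ∧ radialPart (profileVelocity f) 1 θ < 0} =
          {θ | θ ∈ Ioo (-α) α ∧ f θ < 0} := by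
        ext θ
        exact and_congr_right fun hθ => by
          rw [radialPart_profileVelocity hα (Ioo_subset_Icc_self hθ)]
      rw [HasType, h1, h2]
      exact hT

/-! ### Counting the components of a set of reals -/

/-- A component of an open set of reals is open and connected, hence an open interval. An end point
belonging to `S` could be adjoined to it, against maximality. -/
theorem connectedComponentIn_eq_Ioo {S : Set ℝ} (hS : IsOpen S) {a b : ℝ} (hab : S ⊆ Ioo a b)
    {x : ℝ} (hx : x ∈ S) : ∃ l r, connectedComponentIn S x = Ioo l r ∧ x ∈ Ioo l r ∧ l ∉ S ∧ r ∉ S ∧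
      a ≤ l ∧ r ≤ b := by
  set C := connectedComponentIn S x with hC
  have hCS : C ⊆ S := connectedComponentIn_subset S x
  have hCo : IsOpen C := hS.connectedComponentIn
  have hCc : IsConnected C := isConnected_connectedComponentIn_iff.2 hx
  have hbb : BddBelow C := ⟨a, fun y hy => (hab (hCS hy)).1.le⟩
  have hba : BddAbove C := ⟨b, fun y hy => (hab (hCS hy)).2.le⟩
  have hsub : C ⊆ Ioo (sInf C) (sSup C) := by
    intro y hy
    obtain ⟨ε, hε, hball⟩ := Metric.isOpen_iff.1 hCo y hy
    have h1 : y - ε / 2 ∈ C := hball (by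
      rw [Metric.mem_ball, Real.dist_eq, abs_lt]; constructor <;> linarith)
    have h2 : y + ε / 2 ∈ C := hball (by
      rw [Metric.mem_ball, Real.dist_eq, abs_lt]; constructor <;> linarith)
    exact ⟨by linarith [csInf_le hbb h1], by linarith [le_csSup hba h2]⟩
  have heq : C = Ioo (sInf C) (sSup C) := hsub.antisymm (hCc.Ioo_csInf_csSup_subset hbb hba)
  have hxC : x ∈ C := mem_connectedComponentIn hx
  refine ⟨sInf C, sSup C, heq, hsub hxC, ?_, ?_, le_csInf ⟨x, hxC⟩ fun y hy => (hab (hCS hy)).1.le,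
    csSup_le ⟨x, hxC⟩ fun y hy => (hab (hCS hy)).2.le⟩
  · intro hl
    have h1 : Ico (sInf C) (sSup C) ⊆ C := by
      refine isPreconnected_Ico.subset_connectedComponentIn (Ioo_subset_Ico_self (hsub hxC)) ?_
      intro y hy
      rcases hy.1.eq_or_lt with h | h
      · rwa [← h]
      · exact hCS (heq.ge ⟨h, hy.2⟩)
    exact lt_irrefl _ (hsub (h1 ⟨le_rfl, (hsub hxC).1.trans (hsub hxC).2⟩)).1
  · intro hl
    have h1 : Ioc (sInf C) (sSup C) ⊆ C := by
      refine isPreconnected_Ioc.subset_connectedComponentIn (Ioo_subset_Ioc_self (hsub hxC)) ?_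
      intro y hy
      rcases hy.2.eq_or_lt with h | h
      · rwa [h]
      · exact hCS (heq.ge ⟨hy.1, h⟩)
    exact lt_irrefl _ (hsub (h1 ⟨(hsub hxC).1.trans (hsub hxC).2, le_rfl⟩)).2

/-- A finite `numIntervals` makes `S` a finite disjoint union of measurable components. This
converts the number of humps into a factor in the total duration and flux. -/
theorem setIntegral_eq_card_mul {S : Set ℝ} (hS : IsOpen S) {m : ℕ}
    (hm : numIntervals S = (m : ℕ∞)) {F : ℝ → ℝ} (hF : MeasureTheory.IntegrableOn F S) {v : ℝ}
    (hv : ∀ x ∈ S, ∫ t in connectedComponentIn S x, F t = v) : ∫ t in S, F t = m * v := by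
  have hfin : (connectedComponentIn S '' S).Finite := by
    rw [← Set.encard_lt_top_iff]
    rw [numIntervals] at hm
    rw [hm]
    exact ENat.natCast_lt_top m
  have hU : S = ⋃ i ∈ hfin.toFinset, id i := by
    ext y
    simp only [Finite.mem_toFinset, mem_iUnion, id_eq, exists_prop]
    constructor
    · exact fun hy => ⟨_, ⟨y, hy, rfl⟩, mem_connectedComponentIn hy⟩
    · rintro ⟨_, ⟨x, _, rfl⟩, hy⟩
      exact connectedComponentIn_subset S x hy
  have hcard : hfin.toFinset.card = m := by
    have h1 := hfin.encard_eq_coe_toFinset_card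
    rw [numIntervals, h1] at hm
    exact_mod_cast hm
  conv_lhs => rw [hU]
  rw [MeasureTheory.integral_biUnion_finset]
  · rw [← hcard, ← nsmul_eq_mul]
    refine Finset.sum_eq_card_nsmul fun i hi => ?_
    obtain ⟨x, hx, rfl⟩ := hfin.mem_toFinset.1 hi
    exact hv x hx
  · intro i hi
    obtain ⟨x, hx, rfl⟩ := hfin.mem_toFinset.1 hi
    exact hS.connectedComponentIn.measurableSet
  · intro i hi j hj hij
    obtain ⟨x, hx, rfl⟩ := hfin.mem_toFinset.1 hi
    obtain ⟨y, hy, rfl⟩ := hfin.mem_toFinset.1 hj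
    refine Set.disjoint_left.2 fun z hzx hzy => hij ?_
    rw [connectedComponentIn_eq hzx, connectedComponentIn_eq hzy]
  · intro i hi
    obtain ⟨x, hx, rfl⟩ := hfin.mem_toFinset.1 hi
    exact hF.mono_set (connectedComponentIn_subset S x)

theorem numIntervals_eq_zero_iff {S : Set ℝ} : numIntervals S = 0 ↔ S = ∅ := by
  rw [numIntervals, Set.encard_eq_zero, image_eq_empty]

theorem numIntervals_of_isPreconnected {S : Set ℝ} (hS : IsPreconnected S) (hn : S.Nonempty) :
    numIntervals S = 1 := by
  have : connectedComponentIn S '' S = {S} := by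
    ext C
    rw [mem_singleton_iff]
    constructor
    · rintro ⟨x, hx, rfl⟩
      exact hS.connectedComponentIn hx
    · rintro rfl
      obtain ⟨x, hx⟩ := hn
      exact ⟨x, hx, hS.connectedComponentIn hx⟩
  rw [numIntervals, this, encard_singleton]

/-- No node belongs to the union, and a connected subset of the line containing points on both sides
of a node would contain the node. Adjacent gaps are therefore never merged. -/
theorem numIntervals_biUnion_Ioo {x : ℕ → ℝ} (hx : StrictMono x) (J : Finset ℕ) :
    numIntervals (⋃ j ∈ J, Ioo (x j) (x (j + 1))) = (J.card : ℕ∞) := by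
  set S := ⋃ j ∈ J, Ioo (x j) (x (j + 1)) with hS
  have hmem : ∀ y, y ∈ S ↔ ∃ j ∈ J, y ∈ Ioo (x j) (x (j + 1)) := by
    intro y; simp only [hS, mem_iUnion, exists_prop]
  have hnot : ∀ k, x k ∉ S := by
    intro k hk
    obtain ⟨j, _, h1, h2⟩ := (hmem _).1 hk
    have h1 := hx.lt_iff_lt.1 h1
    have h2 := hx.lt_iff_lt.1 h2
    omega
  have hcomp : ∀ j ∈ J, ∀ y ∈ Ioo (x j) (x (j + 1)),
      connectedComponentIn S y = Ioo (x j) (x (j + 1)) := by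
    intro j hj y hy
    have hyS : y ∈ S := (hmem y).2 ⟨j, hj, hy⟩
    refine Subset.antisymm ?_ (isPreconnected_Ioo.subset_connectedComponentIn hy
      fun z hz => (hmem z).2 ⟨j, hj, hz⟩)
    intro z hz
    have hoc : OrdConnected (connectedComponentIn S y) :=
      isPreconnected_connectedComponentIn.ordConnected
    by_contra hne
    rw [mem_Ioo, not_and_or, not_lt, not_lt] at hne
    rcases hne with h | h
    · exact hnot j (connectedComponentIn_subset S y
        (hoc.out hz (mem_connectedComponentIn hyS) ⟨h, hy.1.le⟩))
    · exact hnot (j + 1) (connectedComponentIn_subset S y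
        (hoc.out (mem_connectedComponentIn hyS) hz ⟨hy.2.le, h⟩))
  have himg : connectedComponentIn S '' S = (fun j => Ioo (x j) (x (j + 1))) '' (J : Set ℕ) := by
    ext C
    constructor
    · rintro ⟨y, hy, rfl⟩
      obtain ⟨j, hj, hyj⟩ := (hmem y).1 hy
      exact ⟨j, hj, (hcomp j hj y hyj).symm⟩
    · rintro ⟨j, hj, rfl⟩
      have hlt : x j < x (j + 1) := hx (Nat.lt_succ_self j)
      have hy : (x j + x (j + 1)) / 2 ∈ Ioo (x j) (x (j + 1)) := ⟨by linarith, by linarith⟩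
      exact ⟨_, (hmem _).2 ⟨j, hj, hy⟩, hcomp j hj _ hy⟩
  have hinj : InjOn (fun j => Ioo (x j) (x (j + 1))) (J : Set ℕ) := by
    intro i _ j _ hij
    have hi : x i < x (i + 1) := hx (Nat.lt_succ_self i)
    have hj : x j < x (j + 1) := hx (Nat.lt_succ_self j)
    have h1 := congrArg sInf hij
    simp only [csInf_Ioo hi, csInf_Ioo hj] at h1
    exact hx.injective h1
  rw [numIntervals, himg, hinj.encard_image, Set.encard_coe_eq_coe_finsetCard]

/-! ### Autonomous scalar equations -/

/-- Separation of variables: `y` is the inverse of the time map `∫ 1 / g`. The bound `g ≤ M` gives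
this map slope at least `1 / M`, so it is onto and the solution exists for all times. -/
theorem exists_autonomous_solution {g : ℝ → ℝ} (hg : Continuous g) (hpos : ∀ y, 0 < g y) {M : ℝ}
    (hM : ∀ y, g y ≤ M) : ∃ y : ℝ → ℝ, StrictMono y ∧ Function.Surjective y ∧ y 0 = 0 ∧
      ∀ t, HasDerivAt y (g (y t)) t := by
  have hMpos : 0 < M := (hpos 0).trans_le (hM 0)
  have hinv : Continuous fun y => (g y)⁻¹ := hg.inv₀ fun y => (hpos y).ne'
  set τ : ℝ → ℝ := fun y => ∫ s in (0 : ℝ)..y, (g s)⁻¹ with hτ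
  have hd : ∀ y, HasDerivAt τ (g y)⁻¹ y := fun y => hinv.integral_hasStrictDerivAt 0 y |>.hasDerivAt
  have hmono : StrictMono τ := strictMono_of_deriv_pos fun y => by
    rw [(hd y).deriv]; exact inv_pos.2 (hpos y)
  have hcont : Continuous τ := continuous_iff_continuousAt.2 fun y => (hd y).continuousAt
  have hslope : Monotone fun y => τ y - M⁻¹ * y := by
    refine monotone_of_deriv_nonneg (fun y => ?_) fun y => ?_
    · exact ((hd y).sub ((hasDerivAt_id y).const_mul M⁻¹)).differentiableAt
    · have := ((hd y).sub ((hasDerivAt_id y).const_mul M⁻¹)).deriv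
      simp only [id] at this
      erw [this]
      rw [mul_one, sub_nonneg]
      exact inv_anti₀ (hpos y) (hM y)
  have hτ0 : τ 0 = 0 := by simp [hτ]
  have hsurj : Function.Surjective τ := by
    refine hcont.surjective ?_ ?_
    · refine Filter.tendsto_atTop_mono' _ ?_
        (Filter.tendsto_id.const_mul_atTop (inv_pos.2 hMpos))
      filter_upwards [Filter.eventually_ge_atTop 0] with y hy
      have := hslope hy
      simp only [hτ0, mul_zero, sub_zero] at this
      simp only [id]
      linarith
    · refine Filter.tendsto_atBot_mono' _ ?_
        (Filter.tendsto_id.const_mul_atBot (inv_pos.2 hMpos))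
      filter_upwards [Filter.eventually_le_atBot 0] with y hy
      have := hslope hy
      simp only [hτ0, mul_zero, sub_zero] at this
      simp only [id]
      linarith
  set e := hmono.orderIsoOfSurjective τ hsurj with he
  have hright : ∀ t, τ (e.symm t) = t := fun t => e.apply_symm_apply t
  refine ⟨e.symm, e.symm.strictMono, e.symm.surjective, ?_, fun t => ?_⟩
  · exact hmono.injective (by rw [hright, hτ0])
  · have := HasDerivAt.of_local_left_inverse (f := τ) (g := e.symm) (a := t)
      e.symm.continuous.continuousAt (hd _) (inv_ne_zero (hpos _).ne')
      (Filter.Eventually.of_forall hright)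
    rwa [inv_inv] at this

/-- Change of variables along a solution of `y' = g(y)`. -/
theorem integral_autonomous {g : ℝ → ℝ} (hg : Continuous g) (hpos : ∀ y, 0 < g y) {y : ℝ → ℝ}
    (hy : ∀ t, HasDerivAt y (g (y t)) t) {F : ℝ → ℝ} (hF : Continuous F) (a b : ℝ) :
    ∫ t in a..b, F (y t) = ∫ s in (y a)..(y b), F s / g s := by
  have hyc : Continuous y := continuous_iff_continuousAt.2 fun t => (hy t).continuousAt
  rw [← intervalIntegral.integral_comp_mul_deriv (g := fun s => F s / g s)
    (fun t _ => hy t) (hg.comp hyc).continuousOn (hF.div hg fun s => (hpos s).ne')]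
  refine intervalIntegral.integral_congr fun t _ => ?_
  simp only [Function.comp]
  have := (hpos (y t)).ne'
  field_simp

theorem countable_of_eventually_notMem {S : Set ℝ}
    (h : ∀ x ∈ S, ∀ᶠ y in nhdsWithin x {x}ᶜ, y ∉ S) : S.Countable := by
  refine (countable_setOfPred_isolated_right_within (s := S)).mono ?_
  intro x hx
  refine mem_ofPred_eq ▸ ⟨hx, ?_⟩
  rw [← Filter.empty_mem_iff_bot]
  have h1 : {y | y ∉ S} ∈ nhdsWithin x (S ∩ Ioi x) :=
    nhdsWithin_mono x (fun y hy => (ne_of_gt hy.2 : y ≠ x)) (h x hx)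
  filter_upwards [h1, self_mem_nhdsWithin] with y hy hy' using hy hy'.1

/-! ### Time and flux of a hump -/

/-- The quadratic factor of the energy polynomial of a hump of height `a`, in terms of the
normalized height `s`. -/
def humpQuad (a Q s : ℝ) : ℝ := Q + (6 + a) * s + a * s ^ 2

/-- The parameters for which a hump of height `a` exists. -/
def Adm (a Q : ℝ) : Prop := 0 ≤ Q ∧ 0 < 6 + 2 * a + Q

/-- The time spent by a hump, per angle `φ`, where the height is `a * cos φ ^ 2`. -/
noncomputable def humpWeight (a Q φ : ℝ) : ℝ :=
  Real.cos φ / √(humpQuad a Q (Real.cos φ ^ 2))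

/-- The moments of the normalized height of a hump. -/
noncomputable def humpMoment (n : ℕ) (a Q : ℝ) : ℝ :=
  2 * √6 * ∫ φ in (0 : ℝ)..(Real.pi / 2), (Real.cos φ ^ 2) ^ n * humpWeight a Q φ

/-- The duration of a hump. -/
noncomputable def humpTime (a Q : ℝ) : ℝ := humpMoment 0 a Q

/-- The integral of a hump. -/
noncomputable def humpFlux (a Q : ℝ) : ℝ := a * humpMoment 1 a Q

/-- A linear lower bound is what survives at `Q = 0`. Since `s = cos φ ^ 2`, it still bounds the
integrand `cos φ / √(humpQuad ..)` uniformly. -/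
theorem humpQuad_lower {a Q s : ℝ} (hQ : 0 ≤ Q) (h0 : 0 ≤ s) (h1 : s ≤ 1) :
    min 6 (6 + 2 * a + Q) * s ≤ humpQuad a Q s := by
  rw [humpQuad]
  have hs : 0 ≤ s * (1 - s) := mul_nonneg h0 (by linarith)
  have hQs : 0 ≤ Q * (1 - s) := mul_nonneg hQ (by linarith)
  rcases le_total 0 a with ha | ha
  · have := mul_le_mul_of_nonneg_right (min_le_left 6 (6 + 2 * a + Q)) h0
    nlinarith [mul_nonneg ha h0, mul_nonneg ha (sq_nonneg s)]
  · have := mul_le_mul_of_nonneg_right (min_le_right 6 (6 + 2 * a + Q)) h0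
    nlinarith [mul_nonneg (neg_nonneg.2 ha) hs]

theorem Adm.min_pos {a Q : ℝ} (h : Adm a Q) : 0 < min 6 (6 + 2 * a + Q) :=
  lt_min (by norm_num) h.2

theorem humpQuad_pos {a Q s : ℝ} (h : Adm a Q) (h0 : 0 < s) (h1 : s ≤ 1) : 0 < humpQuad a Q s :=
  (mul_pos h.min_pos h0).trans_le (humpQuad_lower h.1 h0.le h1)

theorem cos_pos_of_mem {φ : ℝ} (h : φ ∈ Ioo 0 (Real.pi / 2)) : 0 < Real.cos φ :=
  Real.cos_pos_of_mem_Ioo ⟨by linarith [h.1, Real.pi_pos], h.2⟩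

theorem cos_nonneg_of_mem {φ : ℝ} (h : φ ∈ Icc 0 (Real.pi / 2)) : 0 ≤ Real.cos φ :=
  Real.cos_nonneg_of_mem_Icc ⟨by linarith [h.1, Real.pi_pos], h.2⟩

theorem sin_pos_of_mem {φ : ℝ} (h : φ ∈ Ioo 0 (Real.pi / 2)) : 0 < Real.sin φ :=
  Real.sin_pos_of_pos_of_lt_pi h.1 (by linarith [h.2, Real.pi_pos])

theorem cos_sq_pos_of_mem {φ : ℝ} (h : φ ∈ Ioo 0 (Real.pi / 2)) : 0 < Real.cos φ ^ 2 :=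
  pow_pos (cos_pos_of_mem h) 2

theorem cos_sq_lt_one_of_mem {φ : ℝ} (h : φ ∈ Ioo 0 (Real.pi / 2)) : Real.cos φ ^ 2 < 1 := by
  have := sin_pos_of_mem h
  nlinarith [Real.sin_sq_add_cos_sq φ]

theorem humpWeight_nonneg {a Q φ : ℝ} (h : φ ∈ Icc 0 (Real.pi / 2)) : 0 ≤ humpWeight a Q φ :=
  div_nonneg (cos_nonneg_of_mem h) (Real.sqrt_nonneg _)

theorem humpWeight_pos {a Q φ : ℝ} (hA : Adm a Q) (h : φ ∈ Ioo 0 (Real.pi / 2)) :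
    0 < humpWeight a Q φ :=
  div_pos (cos_pos_of_mem h)
    (Real.sqrt_pos.2 (humpQuad_pos hA (cos_sq_pos_of_mem h) (cos_sq_lt_one_of_mem h).le))

theorem humpWeight_le_of_le {a Q K φ : ℝ} (hK : 0 < K) (h : φ ∈ Icc 0 (Real.pi / 2))
    (hle : K * Real.cos φ ^ 2 ≤ humpQuad a Q (Real.cos φ ^ 2)) :
    humpWeight a Q φ ≤ 1 / √K := by
  have hc := cos_nonneg_of_mem h
  rcases hc.eq_or_lt with h0 | h0
  · rw [humpWeight, ← h0, zero_div]
    positivity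
  have h1 : √K * Real.cos φ ≤ √(humpQuad a Q (Real.cos φ ^ 2)) := by
    rw [← Real.sqrt_sq hc, ← Real.sqrt_mul hK.le, Real.sqrt_sq hc]
    exact Real.sqrt_le_sqrt hle
  have h2 : 0 < √K := Real.sqrt_pos.2 hK
  rw [humpWeight, div_le_div_iff₀ ((mul_pos h2 h0).trans_le h1) h2]
  linarith

theorem humpWeight_ge_of_le {a Q K φ : ℝ} (hA : Adm a Q) (hK : 0 < K)
    (h : φ ∈ Ioo 0 (Real.pi / 2))
    (hle : humpQuad a Q (Real.cos φ ^ 2) ≤ K * Real.cos φ ^ 2) :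
    1 / √K ≤ humpWeight a Q φ := by
  have hc := cos_pos_of_mem h
  have h1 : √(humpQuad a Q (Real.cos φ ^ 2)) ≤ √K * Real.cos φ := by
    rw [← Real.sqrt_sq hc.le, ← Real.sqrt_mul hK.le, Real.sqrt_sq hc.le]
    exact Real.sqrt_le_sqrt hle
  have h2 : 0 < √K := Real.sqrt_pos.2 hK
  have h3 := Real.sqrt_pos.2 (humpQuad_pos hA (cos_sq_pos_of_mem h) (cos_sq_lt_one_of_mem h).le)
  rw [humpWeight, div_le_div_iff₀ h2 h3]
  linarith

theorem measurable_humpIntegrand (n : ℕ) (a Q : ℝ) :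
    Measurable fun φ => (Real.cos φ ^ 2) ^ n * humpWeight a Q φ := by
  unfold humpWeight humpQuad
  fun_prop

theorem humpIntegrand_bound (n : ℕ) {a Q K φ : ℝ} (hQ : 0 ≤ Q) (hK : 0 < K)
    (hle : K ≤ min 6 (6 + 2 * a + Q)) (h : φ ∈ Icc 0 (Real.pi / 2)) :
    ‖(Real.cos φ ^ 2) ^ n * humpWeight a Q φ‖ ≤ 1 / √K := by
  have hw := humpWeight_nonneg (a := a) (Q := Q) h
  have hc1 : Real.cos φ ^ 2 ≤ 1 := Real.cos_sq_le_one φ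
  have hp : (Real.cos φ ^ 2) ^ n ≤ 1 := pow_le_one₀ (sq_nonneg _) hc1
  have hp0 : 0 ≤ (Real.cos φ ^ 2) ^ n := pow_nonneg (sq_nonneg _) n
  rw [Real.norm_of_nonneg (mul_nonneg hp0 hw)]
  calc (Real.cos φ ^ 2) ^ n * humpWeight a Q φ ≤ humpWeight a Q φ := mul_le_of_le_one_left hw hp
    _ ≤ 1 / √K := humpWeight_le_of_le hK h
      ((mul_le_mul_of_nonneg_right hle (sq_nonneg _)).trans (humpQuad_lower hQ (sq_nonneg _) hc1))

theorem intervalIntegrable_humpIntegrand (n : ℕ) {a Q : ℝ} (h : Adm a Q) :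
    IntervalIntegrable (fun φ => (Real.cos φ ^ 2) ^ n * humpWeight a Q φ) MeasureTheory.volume
      0 (Real.pi / 2) := by
  refine (intervalIntegrable_const (c := 1 / √(min 6 (6 + 2 * a + Q)))).mono_fun'
    (measurable_humpIntegrand n a Q).aestronglyMeasurable ?_
  rw [uIoc_of_le (by positivity)]
  refine (MeasureTheory.ae_restrict_mem measurableSet_Ioc).mono fun φ hφ => ?_
  exact humpIntegrand_bound n h.1 h.min_pos le_rfl (Ioc_subset_Icc_self hφ)

theorem intervalIntegrable_humpWeight {a Q : ℝ} (h : Adm a Q) :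
    IntervalIntegrable (humpWeight a Q) MeasureTheory.volume 0 (Real.pi / 2) := by
  simpa using intervalIntegrable_humpIntegrand 0 h

theorem humpTime_eq (a Q : ℝ) :
    humpTime a Q = 2 * √6 * ∫ φ in (0 : ℝ)..(Real.pi / 2), humpWeight a Q φ := by
  simp [humpTime, humpMoment]

theorem humpMoment_pos (n : ℕ) {a Q : ℝ} (h : Adm a Q) : 0 < humpMoment n a Q := by
  refine mul_pos (by positivity) ?_
  refine intervalIntegral.intervalIntegral_pos_of_pos_on (intervalIntegrable_humpIntegrand n h)
    (fun φ hφ => ?_) (by positivity)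
  exact mul_pos (pow_pos (cos_sq_pos_of_mem hφ) n) (humpWeight_pos h hφ)

theorem humpTime_pos {a Q : ℝ} (h : Adm a Q) : 0 < humpTime a Q := humpMoment_pos 0 h

theorem humpMoment_one_le {a Q : ℝ} (h : Adm a Q) : humpMoment 1 a Q ≤ humpTime a Q := by
  refine mul_le_mul_of_nonneg_left ?_ (by positivity)
  refine intervalIntegral.integral_mono_on (by positivity) (intervalIntegrable_humpIntegrand 1 h)
    (intervalIntegrable_humpIntegrand 0 h) fun φ hφ => ?_
  rw [pow_one, pow_zero]
  exact mul_le_mul_of_nonneg_right (Real.cos_sq_le_one φ) (humpWeight_nonneg hφ)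

theorem continuousOn_humpMoment (n : ℕ) :
    ContinuousOn (fun p : ℝ × ℝ => humpMoment n p.1 p.2) {p | Adm p.1 p.2} := by
  intro p hp
  replace hp : Adm p.1 p.2 := hp
  have hmin : Continuous fun p : ℝ × ℝ => min 6 (6 + 2 * p.1 + p.2) := by fun_prop
  set K := min 6 (6 + 2 * p.1 + p.2) / 2 with hK
  have hK0 : 0 < K := half_pos hp.min_pos
  have hev : ∀ᶠ q in nhdsWithin p {p | Adm p.1 p.2}, K ≤ min 6 (6 + 2 * q.1 + q.2) := by
    refine Filter.Eventually.filter_mono nhdsWithin_le_nhds ?_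
    filter_upwards [(hmin.tendsto p).eventually_const_lt (half_lt_self hp.min_pos)]
      with q hq using hq.le
  refine ContinuousWithinAt.mul continuousWithinAt_const ?_
  refine intervalIntegral.continuousWithinAt_of_dominated_interval (bound := fun _ => 1 / √K)
    (Filter.Eventually.of_forall fun q =>
      (measurable_humpIntegrand n q.1 q.2).aestronglyMeasurable) ?_ intervalIntegrable_const ?_
  · filter_upwards [hev, self_mem_nhdsWithin] with q hq hqA
    replace hqA : Adm q.1 q.2 := hqA
    refine Filter.Eventually.of_forall fun φ hφ => ?_
    rw [uIoc_of_le (by positivity)] at hφ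
    exact humpIntegrand_bound n hqA.1 hK0 hq (Ioc_subset_Icc_self hφ)
  · refine Filter.Eventually.of_forall fun φ hφ => ?_
    rw [uIoc_of_le (by positivity)] at hφ
    refine ContinuousAt.continuousWithinAt (continuousAt_const.mul ?_)
    unfold humpWeight
    -- At `φ = π / 2` the denominator vanishes when `Q = 0`, but the numerator is zero for all
    -- parameters, so the integrand is constant in them.
    rcases hφ.2.eq_or_lt with h | h
    · simp only [h, Real.cos_pi_div_two, zero_div]
      exact continuousAt_const
    · have hφ' : φ ∈ Ioo 0 (Real.pi / 2) := ⟨hφ.1, h⟩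
      have hq := humpQuad_pos hp (cos_sq_pos_of_mem hφ') (cos_sq_lt_one_of_mem hφ').le
      refine continuousAt_const.div ?_ (Real.sqrt_pos.2 hq).ne'
      unfold humpQuad
      fun_prop

theorem humpTime_lt_of_quad_lt {a Q a' Q' : ℝ} (h : Adm a Q) (h' : Adm a' Q')
    (hlt : ∀ s ∈ Ioo (0 : ℝ) 1, humpQuad a Q s < humpQuad a' Q' s) :
    humpTime a' Q' < humpTime a Q := by
  rw [humpTime_eq, humpTime_eq]
  refine mul_lt_mul_of_pos_left ?_ (by positivity)
  rw [← sub_pos, ← intervalIntegral.integral_sub (intervalIntegrable_humpWeight h)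
    (intervalIntegrable_humpWeight h')]
  refine intervalIntegral.intervalIntegral_pos_of_pos_on
    ((intervalIntegrable_humpWeight h).sub (intervalIntegrable_humpWeight h'))
    (fun φ hφ => ?_) (by positivity)
  rw [sub_pos]
  have hq := humpQuad_pos h (cos_sq_pos_of_mem hφ) (cos_sq_lt_one_of_mem hφ).le
  exact div_lt_div_of_pos_left (cos_pos_of_mem hφ) (Real.sqrt_pos.2 hq)
    (Real.sqrt_lt_sqrt hq.le (hlt _ ⟨cos_sq_pos_of_mem hφ, cos_sq_lt_one_of_mem hφ⟩))

theorem humpTime_lt_of_lt_right {a Q Q' : ℝ} (h : Adm a Q) (hlt : Q < Q') :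
    humpTime a Q' < humpTime a Q :=
  humpTime_lt_of_quad_lt h ⟨h.1.trans hlt.le, by linarith [h.2]⟩ fun s _ => by
    rw [humpQuad, humpQuad]; linarith

theorem humpTime_lt_of_lt_left {a a' Q Q' : ℝ} (h : Adm a Q) (hlt : a < a') (hQ : Q ≤ Q') :
    humpTime a' Q' < humpTime a Q :=
  humpTime_lt_of_quad_lt h ⟨h.1.trans hQ, by linarith [h.2]⟩ fun s hs => by
    rw [humpQuad, humpQuad]
    nlinarith [mul_pos (sub_pos.2 hlt) hs.1, mul_pos (sub_pos.2 hlt) (pow_pos hs.1 2)]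

theorem humpTime_le_of_le {a Q K : ℝ} (hA : Adm a Q) (hK : 0 < K)
    (hle : ∀ s ∈ Icc (0 : ℝ) 1, K * s ≤ humpQuad a Q s) : humpTime a Q ≤ Real.pi * √6 / √K := by
  have h := intervalIntegral.integral_mono_on (μ := MeasureTheory.volume) (by positivity)
    (intervalIntegrable_humpWeight hA) (intervalIntegrable_const (c := 1 / √K)) fun φ hφ =>
      humpWeight_le_of_le hK hφ (hle _ ⟨sq_nonneg _, Real.cos_sq_le_one φ⟩)
  rw [intervalIntegral.integral_const, smul_eq_mul, sub_zero] at h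
  rw [humpTime_eq]
  calc _ ≤ 2 * √6 * (Real.pi / 2 * (1 / √K)) := mul_le_mul_of_nonneg_left h (by positivity)
    _ = _ := by ring

theorem le_humpTime_of_le {a Q K : ℝ} (hA : Adm a Q) (hK : 0 < K)
    (hle : ∀ s ∈ Icc (0 : ℝ) 1, humpQuad a Q s ≤ K * s) : Real.pi * √6 / √K ≤ humpTime a Q := by
  have h := intervalIntegral.integral_mono_on_of_le_Ioo (μ := MeasureTheory.volume) (by positivity)
    (intervalIntegrable_const (c := 1 / √K)) (intervalIntegrable_humpWeight hA) fun φ hφ =>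
      humpWeight_ge_of_le hA hK hφ (hle _ ⟨sq_nonneg _, Real.cos_sq_le_one φ⟩)
  rw [intervalIntegral.integral_const, smul_eq_mul, sub_zero] at h
  rw [humpTime_eq]
  calc _ = 2 * √6 * (Real.pi / 2 * (1 / √K)) := by ring
    _ ≤ _ := mul_le_mul_of_nonneg_left h (by positivity)

theorem integral_cos_half_pi : ∫ φ in (0 : ℝ)..(Real.pi / 2), Real.cos φ = 1 := by
  rw [integral_cos, Real.sin_pi_div_two, Real.sin_zero, sub_zero]

theorem humpTime_le_of_const_le {a Q K : ℝ} (hA : Adm a Q) (hK : 0 < K)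
    (hle : ∀ s ∈ Icc (0 : ℝ) 1, K ≤ humpQuad a Q s) : humpTime a Q ≤ 2 * √6 / √K := by
  have h := intervalIntegral.integral_mono_on (μ := MeasureTheory.volume) (by positivity)
    (intervalIntegrable_humpWeight hA)
    ((Real.continuous_cos.intervalIntegrable 0 (Real.pi / 2)).mul_const (1 / √K)) fun φ hφ => by
      rw [humpWeight, div_eq_mul_one_div]
      exact mul_le_mul_of_nonneg_left (one_div_le_one_div_of_le (Real.sqrt_pos.2 hK)
        (Real.sqrt_le_sqrt (hle _ ⟨sq_nonneg _, Real.cos_sq_le_one φ⟩))) (cos_nonneg_of_mem hφ)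
  rw [intervalIntegral.integral_mul_const, integral_cos_half_pi, one_mul] at h
  rw [humpTime_eq]
  calc _ ≤ 2 * √6 * (1 / √K) := mul_le_mul_of_nonneg_left h (by positivity)
    _ = _ := by ring

theorem le_humpTime_of_le_const {a Q K : ℝ} (hA : Adm a Q)
    (hle : ∀ s ∈ Icc (0 : ℝ) 1, humpQuad a Q s ≤ K) : 2 * √6 / √K ≤ humpTime a Q := by
  have h := intervalIntegral.integral_mono_on_of_le_Ioo (μ := MeasureTheory.volume) (by positivity)
    ((Real.continuous_cos.intervalIntegrable 0 (Real.pi / 2)).mul_const (1 / √K))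
    (intervalIntegrable_humpWeight hA) fun φ hφ => by
      rw [humpWeight, div_eq_mul_one_div (Real.cos φ)]
      have hq := humpQuad_pos hA (cos_sq_pos_of_mem hφ) (cos_sq_lt_one_of_mem hφ).le
      exact mul_le_mul_of_nonneg_left (one_div_le_one_div_of_le (Real.sqrt_pos.2 hq)
        (Real.sqrt_le_sqrt (hle _ ⟨sq_nonneg _, Real.cos_sq_le_one φ⟩))) (cos_pos_of_mem hφ).le
  rw [intervalIntegral.integral_mul_const, integral_cos_half_pi, one_mul] at h
  rw [humpTime_eq]
  calc _ = 2 * √6 * (1 / √K) := by ring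
    _ ≤ _ := mul_le_mul_of_nonneg_left h (by positivity)

/-- Chebyshev's inequality for the mean normalized height. -/
theorem humpMoment_one_ge {a Q : ℝ} (hA : Adm a Q) (h6 : 6 + a ≤ 0) :
    2 / 3 * humpTime a Q ≤ humpMoment 1 a Q := by
  -- The number `2 / 3` is the mean of `cos φ ^ 2` for the weight `cos φ`. As `6 + a ≤ 0`,
  -- `humpQuad` decreases in `s`, so `1 / √(humpQuad ..)` lies above its value `κ` for `s ≥ 2 / 3`
  -- and below it for `s ≤ 2 / 3`. Replacing it by `κ` can only lower the integral of its product
  -- with `s - 2 / 3`.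
  set κ := 1 / √(humpQuad a Q (2 / 3)) with hκ
  have hcont : Continuous fun φ => (Real.cos φ ^ 2 - 2 / 3) * (Real.cos φ * κ) := by fun_prop
  have hint : ∫ φ in (0 : ℝ)..(Real.pi / 2), (Real.cos φ ^ 2 - 2 / 3) * (Real.cos φ * κ) = 0 := by
    have hd : ∀ φ ∈ uIcc 0 (Real.pi / 2), HasDerivAt
        (fun φ => (Real.sin φ / 3 - Real.sin φ ^ 3 / 3) * κ)
        ((Real.cos φ ^ 2 - 2 / 3) * (Real.cos φ * κ)) φ := by
      intro φ _
      have h1 := (((Real.hasDerivAt_sin φ).div_const 3).sub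
        (((Real.hasDerivAt_sin φ).pow 3).div_const 3)).mul_const κ
      refine h1.congr_deriv ?_
      have := Real.sin_sq_add_cos_sq φ
      have h2 : Real.sin φ ^ 2 = 1 - Real.cos φ ^ 2 := by linarith
      simp only [Nat.cast_ofNat, Nat.add_one_sub_one, h2]
      norm_num
      ring
    rw [intervalIntegral.integral_eq_sub_of_hasDerivAt hd (hcont.intervalIntegrable _ _)]
    simp
  have hle : ∫ φ in (0 : ℝ)..(Real.pi / 2), (Real.cos φ ^ 2 - 2 / 3) * (Real.cos φ * κ) ≤
      ∫ φ in (0 : ℝ)..(Real.pi / 2),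
        ((Real.cos φ ^ 2) ^ 1 * humpWeight a Q φ - 2 / 3 * humpWeight a Q φ) := by
    refine intervalIntegral.integral_mono_on_of_le_Ioo (by positivity)
      (hcont.intervalIntegrable _ _) ((intervalIntegrable_humpIntegrand 1 hA).sub
        ((intervalIntegrable_humpWeight hA).const_mul _)) fun φ hφ => ?_
    have hc := cos_pos_of_mem hφ
    have hs0 := cos_sq_pos_of_mem hφ
    have hs1 := cos_sq_lt_one_of_mem hφ
    set s := Real.cos φ ^ 2 with hs
    have hq := humpQuad_pos hA hs0 hs1.le
    have hq' := humpQuad_pos (s := 2 / 3) hA (by norm_num) (by norm_num)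
    have hw : humpWeight a Q φ = Real.cos φ * (1 / √(humpQuad a Q s)) := by
      rw [humpWeight, ← hs]; ring
    rw [pow_one, ← sub_mul, hw]
    have hanti : ∀ x y : ℝ, 0 ≤ x → x ≤ y → humpQuad a Q y ≤ humpQuad a Q x := by
      intro x y hx hxy
      rw [humpQuad, humpQuad]
      nlinarith [mul_nonneg (neg_nonneg.2 h6) (sub_nonneg.2 hxy),
        mul_nonneg (mul_nonneg (by linarith : 0 ≤ -a) (sub_nonneg.2 hxy)) (by linarith : 0 ≤ x + y)]
    rcases le_total (2 / 3) s with h | h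
    · refine mul_le_mul_of_nonneg_left (mul_le_mul_of_nonneg_left ?_ hc.le) (by linarith)
      exact one_div_le_one_div_of_le (Real.sqrt_pos.2 hq)
        (Real.sqrt_le_sqrt (hanti _ _ (by norm_num) h))
    · refine mul_le_mul_of_nonpos_left (mul_le_mul_of_nonneg_left ?_ hc.le) (by linarith)
      exact one_div_le_one_div_of_le (Real.sqrt_pos.2 hq')
        (Real.sqrt_le_sqrt (hanti _ _ hs0.le h))
  rw [hint, intervalIntegral.integral_sub (intervalIntegrable_humpIntegrand 1 hA)
    ((intervalIntegrable_humpWeight hA).const_mul _), intervalIntegral.integral_const_mul] at hle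
  rw [humpTime_eq, humpMoment]
  nlinarith [Real.sqrt_nonneg 6]

/-- Logarithmic divergence of the period near a saddle. -/
theorem exists_lt_integral_cos_div_sqrt {L : ℝ} (hL : 0 < L) (M : ℝ) : ∃ δ₀ > 0, ∀ δ, 0 < δ → δ < δ₀ →
    M < ∫ φ in (0 : ℝ)..(Real.pi / 2), Real.cos φ / √(δ + L * Real.sin φ ^ 2) := by
  have hl : 0 < √L := Real.sqrt_pos.2 hL
  -- Bounding the root by `√δ + √L sin φ` leaves an integral computed by a logarithm, at least `(log
  -- √L - log √δ) / √L`. The choice of `ε` makes this equal to `M` at `√δ = ε`.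
  set ε := √L * Real.exp (-(M * √L)) with hε
  have hε0 : 0 < ε := by positivity
  refine ⟨ε ^ 2, by positivity, fun δ hδ hlt => ?_⟩
  have hd0 : 0 < √δ := Real.sqrt_pos.2 hδ
  have hdε : √δ < ε := by
    rw [← Real.sqrt_sq hε0.le]
    exact Real.sqrt_lt_sqrt hδ.le hlt
  have hsin : ∀ φ ∈ Icc 0 (Real.pi / 2), 0 ≤ Real.sin φ := fun φ hφ =>
    Real.sin_nonneg_of_nonneg_of_le_pi hφ.1 (by linarith [hφ.2, Real.pi_pos])
  have hpos : ∀ φ ∈ Icc 0 (Real.pi / 2), 0 < √δ + √L * Real.sin φ := fun φ hφ => by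
    have := hsin φ hφ
    positivity
  have hI : IntervalIntegrable (fun φ => Real.cos φ / (√δ + √L * Real.sin φ))
      MeasureTheory.volume 0 (Real.pi / 2) := by
    refine ContinuousOn.intervalIntegrable ?_
    rw [uIcc_of_le (by positivity)]
    exact Real.continuous_cos.continuousOn.div (by fun_prop) fun φ hφ => (hpos φ hφ).ne'
  have h1 : ∫ φ in (0 : ℝ)..(Real.pi / 2), Real.cos φ / (√δ + √L * Real.sin φ) =
      Real.log (√δ + √L) / √L - Real.log (√δ) / √L := by
    have hd : ∀ φ ∈ uIcc 0 (Real.pi / 2), HasDerivAt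
        (fun φ => Real.log (√δ + √L * Real.sin φ) / √L)
        (Real.cos φ / (√δ + √L * Real.sin φ)) φ := by
      intro φ hφ
      rw [uIcc_of_le (by positivity)] at hφ
      have h2 := ((((Real.hasDerivAt_sin φ).const_mul √L).const_add √δ).log
        (hpos φ hφ).ne').div_const √L
      refine h2.congr_deriv ?_
      have := (hpos φ hφ).ne'
      field_simp
    rw [intervalIntegral.integral_eq_sub_of_hasDerivAt hd hI]
    simp
  have h2 : ∫ φ in (0 : ℝ)..(Real.pi / 2), Real.cos φ / (√δ + √L * Real.sin φ) ≤
      ∫ φ in (0 : ℝ)..(Real.pi / 2), Real.cos φ / √(δ + L * Real.sin φ ^ 2) := by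
    refine intervalIntegral.integral_mono_on (by positivity) hI ?_ fun φ hφ => ?_
    · refine Continuous.intervalIntegrable (Real.continuous_cos.div (by fun_prop) fun φ => ?_) _ _
      exact (Real.sqrt_pos.2 (by positivity)).ne'
    · refine div_le_div_of_nonneg_left (cos_nonneg_of_mem hφ) (Real.sqrt_pos.2 (by positivity)) ?_
      rw [Real.sqrt_le_left (hpos φ hφ).le, add_sq, mul_pow, Real.sq_sqrt hδ.le, Real.sq_sqrt hL.le]
      have := hsin φ hφ
      have : 0 ≤ 2 * √δ * (√L * Real.sin φ) := by positivity
      linarith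
  refine lt_of_lt_of_le ?_ (h1 ▸ h2)
  rw [← sub_div, lt_div_iff₀ hl]
  have h3 : Real.log √L ≤ Real.log (√δ + √L) := Real.log_le_log hl (by linarith)
  have h4 : Real.log √δ < Real.log ε := Real.log_lt_log hd0 hdε
  rw [hε, Real.log_mul hl.ne' (Real.exp_pos _).ne', Real.log_exp] at h4
  linarith

/-! ### Period and flux of the pendulum -/

/-- The parameters of a profile oscillating between `-b` and `a`. -/
structure Osc (a b : ℝ) : Prop where
  pos_left : 0 < a
  pos_right : 0 < b
  saddle : 2 * b < 6 + a

/-- The energy parameter of the positive humps. -/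
noncomputable def plusQ (a b : ℝ) : ℝ := b / a * (6 + a - b)

/-- The energy parameter of the negative humps. -/
noncomputable def minusQ (a b : ℝ) : ℝ := a / b * (6 + a - b)

theorem Osc.pos_sub {a b : ℝ} (h : Osc a b) : 0 < 6 + a - b := by
  linarith [h.saddle, h.pos_left, h.pos_right]

theorem Osc.plusQ_pos {a b : ℝ} (h : Osc a b) : 0 < plusQ a b :=
  mul_pos (div_pos h.pos_right h.pos_left) h.pos_sub

theorem Osc.minusQ_pos {a b : ℝ} (h : Osc a b) : 0 < minusQ a b :=
  mul_pos (div_pos h.pos_left h.pos_right) h.pos_sub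

theorem Osc.adm_plus {a b : ℝ} (h : Osc a b) : Adm a (plusQ a b) :=
  ⟨h.plusQ_pos.le, by linarith [h.plusQ_pos, h.pos_left]⟩

theorem Osc.adm_minus {a b : ℝ} (h : Osc a b) : Adm (-b) (minusQ a b) := by
  refine ⟨h.minusQ_pos.le, ?_⟩
  have hb := h.pos_right
  have : 6 + 2 * -b + minusQ a b = (a + b) * (6 + a - 2 * b) / b := by
    rw [minusQ]; field_simp; ring
  rw [this]
  exact div_pos (mul_pos (add_pos h.pos_left hb) (by linarith [h.saddle])) hb

/-- After division by the root `a`, the energy cubic has the remaining roots `-b` and `-(6 + a -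
b)`, here written in the variable `s = f / a`. -/
theorem humpQuad_plusQ {a b : ℝ} (ha : a ≠ 0) (s : ℝ) :
    humpQuad a (plusQ a b) s = (6 + a - b + a * s) * (b + a * s) / a := by
  rw [humpQuad, plusQ]; field_simp; ring

theorem humpQuad_minusQ {a b : ℝ} (hb : b ≠ 0) (s : ℝ) :
    humpQuad (-b) (minusQ a b) s = (6 + a - b - b * s) * (a + b * s) / b := by
  rw [humpQuad, minusQ]; field_simp; ring

/-- The square of the angular velocity, up to the factor `6`, where the profile is
`a - (a + b) * S`. -/
def pendSq (a b S : ℝ) : ℝ := 6 + 2 * a - b - (a + b) * S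

theorem pendSq_pos {a b S : ℝ} (hD : 0 ≤ a + b) (hG : 2 * b < 6 + a) (hS : S ≤ 1) :
    0 < pendSq a b S := by
  rw [pendSq]
  nlinarith [mul_nonneg hD (sub_nonneg.2 hS)]

/-- The period of a profile oscillating between `-b` and `a`. -/
noncomputable def pendTime (a b : ℝ) : ℝ :=
  2 * √6 * ∫ ϕ in (0 : ℝ)..(Real.pi / 2), 1 / √(pendSq a b (Real.sin ϕ ^ 2))

theorem continuous_pendIntegrand {a b : ℝ} (hD : 0 ≤ a + b) (hG : 2 * b < 6 + a) {w : ℝ → ℝ}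
    (hw : Continuous w) :
    Continuous fun ϕ => w (a - (a + b) * Real.sin ϕ ^ 2) / √(pendSq a b (Real.sin ϕ ^ 2)) := by
  refine Continuous.div (by fun_prop) (by unfold pendSq; fun_prop) fun ϕ => ?_
  exact (Real.sqrt_pos.2 (pendSq_pos hD hG (Real.sin_sq_le_one ϕ))).ne'

theorem intervalIntegrable_pend {a b : ℝ} (hD : 0 ≤ a + b) (hG : 2 * b < 6 + a) (x y : ℝ) :
    IntervalIntegrable (fun ϕ => 1 / √(pendSq a b (Real.sin ϕ ^ 2))) MeasureTheory.volume x y :=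
  (continuous_pendIntegrand hD hG (w := fun _ => 1) continuous_const).intervalIntegrable x y

/-- The substitution is `sin ϕ = √σ sin φ`, which sends the quarter period in `φ` onto the part of
the pendulum swing up to the angle with `sin ϕ ^ 2 = σ`. -/
theorem integral_sin_sq_comp {σ : ℝ} (h0 : 0 < σ) (h1 : σ < 1) {H : ℝ → ℝ}
    (hH : Continuous fun ϕ => H (Real.sin ϕ ^ 2)) :
    ∫ ϕ in (0 : ℝ)..Real.arcsin √σ, H (Real.sin ϕ ^ 2) =
      ∫ φ in (0 : ℝ)..(Real.pi / 2), H (σ * Real.sin φ ^ 2) *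
        (√σ * Real.cos φ / √(1 - σ * Real.sin φ ^ 2)) := by
  have hs : √σ < 1 := by rw [Real.sqrt_lt' one_pos]; linarith
  have hs0 : 0 < √σ := Real.sqrt_pos.2 h0
  have hlt : ∀ φ, √σ * Real.sin φ < 1 := fun φ => by nlinarith [Real.sin_le_one φ]
  have hgt : ∀ φ, -1 < √σ * Real.sin φ := fun φ => by nlinarith [Real.neg_one_le_sin φ]
  have hsq : ∀ φ, (√σ * Real.sin φ) ^ 2 = σ * Real.sin φ ^ 2 := fun φ => by
    rw [mul_pow, Real.sq_sqrt h0.le]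
  have hpos : ∀ φ, 0 < 1 - σ * Real.sin φ ^ 2 := fun φ => by
    rw [← hsq]
    nlinarith [hlt φ, hgt φ]
  have hd : ∀ φ, HasDerivAt (fun φ => Real.arcsin (√σ * Real.sin φ))
      (√σ * Real.cos φ / √(1 - σ * Real.sin φ ^ 2)) φ := by
    intro φ
    have h := (Real.hasDerivAt_arcsin (hgt φ).ne' (hlt φ).ne).comp φ
      ((Real.hasDerivAt_sin φ).const_mul √σ)
    refine h.congr_deriv ?_
    rw [hsq]; ring
  have := intervalIntegral.integral_comp_mul_deriv (a := 0) (b := Real.pi / 2)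
    (g := fun ϕ => H (Real.sin ϕ ^ 2)) (fun φ _ => hd φ)
    (Continuous.continuousOn (Continuous.div (by fun_prop) (by fun_prop)
      fun φ => (Real.sqrt_pos.2 (hpos φ)).ne')) hH
  simp only [Real.sin_zero, mul_zero, Real.arcsin_zero, Real.sin_pi_div_two, mul_one] at this
  rw [← this]
  refine intervalIntegral.integral_congr fun φ _ => ?_
  simp only [Function.comp]
  rw [Real.sin_arcsin (hgt φ).le (hlt φ).le, hsq]

/-- The angle at which an oscillating profile vanishes. -/
noncomputable def zeroAngle (a b : ℝ) : ℝ := Real.arcsin √(a / (a + b))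

theorem Osc.sigma_mem {a b : ℝ} (h : Osc a b) : a / (a + b) ∈ Ioo (0 : ℝ) 1 := by
  have ha := h.pos_left
  have hb := h.pos_right
  exact ⟨by positivity, (div_lt_one (by positivity)).2 (by linarith)⟩

/-- With `σ = a / (a + b)` the profile `a - (a + b) sin ϕ ^ 2` becomes `a cos φ ^ 2`, so the
pendulum variable, uniform over the whole oscillation, is matched with the variable of a single
positive hump. -/
theorem Osc.integral_plus {a b : ℝ} (h : Osc a b) {w : ℝ → ℝ} (hw : Continuous w) :
    ∫ ϕ in (0 : ℝ)..zeroAngle a b,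
        w (a - (a + b) * Real.sin ϕ ^ 2) / √(pendSq a b (Real.sin ϕ ^ 2)) =
      ∫ φ in (0 : ℝ)..(Real.pi / 2), w (a * Real.cos φ ^ 2) * humpWeight a (plusQ a b) φ := by
  have ha := h.pos_left
  have hb := h.pos_right
  have hab : 0 < a + b := by positivity
  rw [zeroAngle, integral_sin_sq_comp (H := fun S => w (a - (a + b) * S) / √(pendSq a b S))
    h.sigma_mem.1 h.sigma_mem.2 (continuous_pendIntegrand hab.le h.saddle hw)]
  refine intervalIntegral.integral_congr fun φ _ => ?_
  have hS : Real.sin φ ^ 2 = 1 - Real.cos φ ^ 2 := by linarith [Real.sin_sq_add_cos_sq φ]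
  simp only [hS]
  set s := Real.cos φ ^ 2 with hs
  have hs0 : 0 ≤ s := sq_nonneg _
  have e1 : a - (a + b) * (a / (a + b) * (1 - s)) = a * s := by field_simp; ring
  have e2 : pendSq a b (a / (a + b) * (1 - s)) = 6 + a - b + a * s := by
    rw [pendSq]; field_simp; ring
  have e3 : 1 - a / (a + b) * (1 - s) = (b + a * s) / (a + b) := by field_simp; ring
  have hp1 : 0 < 6 + a - b + a * s := by nlinarith [h.pos_sub, mul_nonneg ha.le hs0]
  have hp2 : 0 < b + a * s := by positivity
  rw [e1, e2, e3, humpWeight, humpQuad_plusQ ha.ne', Real.sqrt_div ha.le, Real.sqrt_div hp2.le,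
    Real.sqrt_div (mul_pos hp1 hp2).le, Real.sqrt_mul hp1.le]
  have q1 := (Real.sqrt_pos.2 hp1).ne'
  have q2 := (Real.sqrt_pos.2 hp2).ne'
  have q3 := (Real.sqrt_pos.2 ha).ne'
  have q4 := (Real.sqrt_pos.2 hab).ne'
  field_simp

theorem Osc.half_pi_sub_zeroAngle {a b : ℝ} (h : Osc a b) :
    Real.pi / 2 - zeroAngle a b = Real.arcsin √(b / (a + b)) := by
  have ha := h.pos_left
  have hb := h.pos_right
  have h1 : √(b / (a + b)) = Real.cos (Real.arcsin √(a / (a + b))) := by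
    rw [Real.cos_arcsin, Real.sq_sqrt h.sigma_mem.1.le]
    congr 1
    field_simp
    ring
  have h0 : 0 ≤ Real.arcsin √(a / (a + b)) := Real.arcsin_nonneg.2 (Real.sqrt_nonneg _)
  rw [zeroAngle, h1, ← Real.sin_pi_div_two_sub, Real.arcsin_sin]
  · linarith [Real.arcsin_le_pi_div_two √(a / (a + b))]
  · linarith

/-- The reflection `ϕ ↦ π / 2 - ϕ` exchanges the two extreme values; the substitution for the
positive hump then applies with `σ = b / (a + b)`. -/
theorem Osc.integral_minus {a b : ℝ} (h : Osc a b) {w : ℝ → ℝ} (hw : Continuous w) :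
    ∫ ϕ in zeroAngle a b..(Real.pi / 2),
        w (a - (a + b) * Real.sin ϕ ^ 2) / √(pendSq a b (Real.sin ϕ ^ 2)) =
      ∫ φ in (0 : ℝ)..(Real.pi / 2), w (-b * Real.cos φ ^ 2) * humpWeight (-b) (minusQ a b) φ := by
  have ha := h.pos_left
  have hb := h.pos_right
  have hab : 0 < a + b := by positivity
  have hflip := intervalIntegral.integral_comp_sub_left (a := 0) (b := Real.pi / 2 - zeroAngle a b)
    (fun ϕ => w (a - (a + b) * Real.sin ϕ ^ 2) / √(pendSq a b (Real.sin ϕ ^ 2))) (Real.pi / 2)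
  rw [sub_zero, sub_sub_cancel] at hflip
  rw [← hflip, h.half_pi_sub_zeroAngle]
  have hσ : b / (a + b) ∈ Ioo (0 : ℝ) 1 :=
    ⟨by positivity, (div_lt_one (by positivity)).2 (by linarith)⟩
  have hcont : Continuous fun ϕ =>
      w (a - (a + b) * (1 - Real.sin ϕ ^ 2)) / √(pendSq a b (1 - Real.sin ϕ ^ 2)) := by
    refine Continuous.div (by fun_prop) (by unfold pendSq; fun_prop) fun ϕ => ?_
    exact (Real.sqrt_pos.2 (pendSq_pos hab.le h.saddle (by linarith [sq_nonneg (Real.sin ϕ)]))).ne'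
  have e0 : ∀ ϕ, w (a - (a + b) * Real.sin (Real.pi / 2 - ϕ) ^ 2) /
      √(pendSq a b (Real.sin (Real.pi / 2 - ϕ) ^ 2)) =
      w (a - (a + b) * (1 - Real.sin ϕ ^ 2)) / √(pendSq a b (1 - Real.sin ϕ ^ 2)) := fun ϕ => by
    rw [Real.sin_pi_div_two_sub, Real.cos_sq']
  simp only [e0]
  rw [integral_sin_sq_comp (H := fun S => w (a - (a + b) * (1 - S)) / √(pendSq a b (1 - S)))
    hσ.1 hσ.2 hcont]
  refine intervalIntegral.integral_congr fun φ _ => ?_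
  have hS : Real.sin φ ^ 2 = 1 - Real.cos φ ^ 2 := by linarith [Real.sin_sq_add_cos_sq φ]
  have hs1 : Real.cos φ ^ 2 ≤ 1 := Real.cos_sq_le_one φ
  simp only [hS]
  set s := Real.cos φ ^ 2 with hs
  have hs0 : 0 ≤ s := sq_nonneg _
  have e1 : a - (a + b) * (1 - b / (a + b) * (1 - s)) = -b * s := by field_simp; ring
  have e2 : pendSq a b (1 - b / (a + b) * (1 - s)) = 6 + a - b - b * s := by
    rw [pendSq]; field_simp; ring
  have e3 : 1 - b / (a + b) * (1 - s) = (a + b * s) / (a + b) := by field_simp; ring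
  have hp1 : 0 < 6 + a - b - b * s := by
    nlinarith [h.saddle, mul_nonneg hb.le (sub_nonneg.2 hs1)]
  have hp2 : 0 < a + b * s := by positivity
  rw [e1, e2, e3, humpWeight, humpQuad_minusQ hb.ne', Real.sqrt_div hb.le, Real.sqrt_div hp2.le,
    Real.sqrt_div (mul_pos hp1 hp2).le, Real.sqrt_mul hp1.le]
  have q1 := (Real.sqrt_pos.2 hp1).ne'
  have q2 := (Real.sqrt_pos.2 hp2).ne'
  have q3 := (Real.sqrt_pos.2 hb).ne'
  have q4 := (Real.sqrt_pos.2 hab).ne'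
  field_simp

theorem Osc.pendTime_eq {a b : ℝ} (h : Osc a b) :
    pendTime a b = humpTime a (plusQ a b) + humpTime (-b) (minusQ a b) := by
  have hab : 0 < a + b := add_pos h.pos_left h.pos_right
  have h1 := h.integral_plus (w := fun _ => 1) continuous_const
  have h2 := h.integral_minus (w := fun _ => 1) continuous_const
  simp only [one_mul] at h1 h2
  rw [pendTime, humpTime_eq, humpTime_eq, ← h1, ← h2, ← mul_add,
    intervalIntegral.integral_add_adjacent_intervals (intervalIntegrable_pend hab.le h.saddle _ _)
      (intervalIntegrable_pend hab.le h.saddle _ _)]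

theorem pendTime_lt {a b a' b' : ℝ} (hD : 0 ≤ a + b) (hG : 2 * b < 6 + a) (hD' : 0 ≤ a' + b')
    (hG' : 2 * b' < 6 + a')
    (hlt : ∀ S ∈ Ioo (0 : ℝ) 1, pendSq a b S < pendSq a' b' S) : pendTime a' b' < pendTime a b := by
  refine mul_lt_mul_of_pos_left ?_ (by positivity)
  rw [← sub_pos, ← intervalIntegral.integral_sub (intervalIntegrable_pend hD hG _ _)
    (intervalIntegrable_pend hD' hG' _ _)]
  refine intervalIntegral.intervalIntegral_pos_of_pos_on
    ((intervalIntegrable_pend hD hG _ _).sub (intervalIntegrable_pend hD' hG' _ _))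
    (fun φ hφ => ?_) (by positivity)
  rw [sub_pos]
  have hs : Real.sin φ ^ 2 ∈ Ioo (0 : ℝ) 1 := by
    have h1 := sin_pos_of_mem hφ
    have h2 := cos_sq_pos_of_mem hφ
    exact ⟨by positivity, by linarith [Real.sin_sq_add_cos_sq φ]⟩
  have hp := pendSq_pos hD hG hs.2.le
  exact one_div_lt_one_div_of_lt (Real.sqrt_pos.2 hp) (Real.sqrt_lt_sqrt hp.le (hlt _ hs))

theorem pendTime_le {a b : ℝ} (hD : 0 ≤ a + b) (hG : 2 * b < 6 + a) :
    pendTime a b ≤ Real.pi * √6 / √(6 + a - 2 * b) := by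
  have hpos : 0 < 6 + a - 2 * b := by linarith
  have h := intervalIntegral.integral_mono_on (μ := MeasureTheory.volume)
    (a := 0) (b := Real.pi / 2) (by positivity)
    (intervalIntegrable_pend hD hG _ _)
    (intervalIntegrable_const (c := 1 / √(6 + a - 2 * b))) fun φ _ => by
      refine one_div_le_one_div_of_le (Real.sqrt_pos.2 hpos) (Real.sqrt_le_sqrt ?_)
      rw [pendSq]
      nlinarith [mul_nonneg hD (sub_nonneg.2 (Real.sin_sq_le_one φ))]
  rw [intervalIntegral.integral_const, smul_eq_mul, sub_zero] at h
  calc _ ≤ 2 * √6 * (Real.pi / 2 * (1 / √(6 + a - 2 * b))) :=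
        mul_le_mul_of_nonneg_left h (by positivity)
    _ = _ := by ring

/-- The convex function `x ↦ x ^ (-1/2)` lies above its tangent at `y`. -/
theorem one_div_sqrt_ge_tangent {x y : ℝ} (hx : 0 < x) (hy : 0 < y) :
    1 / √y + (y - x) / (2 * y * √y) ≤ 1 / √x := by
  set p := √x with hp
  set q := √y with hq
  have hp0 : 0 < p := Real.sqrt_pos.2 hx
  have hq0 : 0 < q := Real.sqrt_pos.2 hy
  have hxp : x = p ^ 2 := (Real.sq_sqrt hx.le).symm
  have hyq : y = q ^ 2 := (Real.sq_sqrt hy.le).symm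
  rw [hxp, hyq, ← sub_nonneg]
  have : 1 / p - (1 / q + (q ^ 2 - p ^ 2) / (2 * q ^ 2 * q)) =
      (p - q) ^ 2 * (p + 2 * q) / (2 * p * q ^ 3) := by
    field_simp; ring
  rw [this]
  positivity

theorem integral_sin_sq_half_pi : ∫ φ in (0 : ℝ)..(Real.pi / 2), Real.sin φ ^ 2 = Real.pi / 4 := by
  rw [integral_sin_sq]
  simp
  ring

/-- Jensen's inequality for the period. -/
theorem le_pendTime {a b : ℝ} (hD : 0 ≤ a + b) (hG : 2 * b < 6 + a) :
    Real.pi * √6 / √(6 + 3 / 2 * (a - b)) ≤ pendTime a b := by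
  -- This is the mean of `pendSq`, because `sin ϕ ^ 2` has mean `1 / 2`. The tangent taken there has
  -- a linear part of mean zero.
  set y := 6 + 3 / 2 * (a - b) with hy
  have hy0 : 0 < y := by linarith
  have hi : IntervalIntegrable (fun φ => 1 / √y + (y - pendSq a b (Real.sin φ ^ 2)) / (2 * y * √y))
      MeasureTheory.volume 0 (Real.pi / 2) := by
    refine Continuous.intervalIntegrable ?_ _ _
    unfold pendSq
    fun_prop
  have h := intervalIntegral.integral_mono_on (μ := MeasureTheory.volume)
    (a := 0) (b := Real.pi / 2) (by positivity) hi (intervalIntegrable_pend hD hG _ _) fun φ _ =>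
      one_div_sqrt_ge_tangent (pendSq_pos hD hG (Real.sin_sq_le_one φ)) hy0
  have e : ∫ φ in (0 : ℝ)..(Real.pi / 2),
      (1 / √y + (y - pendSq a b (Real.sin φ ^ 2)) / (2 * y * √y)) = Real.pi / 2 * (1 / √y) := by
    have e1 : ∀ φ, 1 / √y + (y - pendSq a b (Real.sin φ ^ 2)) / (2 * y * √y) =
        (1 / √y - (a + b) / 2 / (2 * y * √y)) + (a + b) / (2 * y * √y) * Real.sin φ ^ 2 := fun φ => by
      rw [pendSq]; field_simp; rw [hy]; ring
    simp only [e1]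
    rw [intervalIntegral.integral_add (by simp)
      (Continuous.intervalIntegrable (by fun_prop) _ _), intervalIntegral.integral_const_mul,
      integral_sin_sq_half_pi, intervalIntegral.integral_const, smul_eq_mul]
    ring
  rw [e] at h
  calc _ = 2 * √6 * (Real.pi / 2 * (1 / √y)) := by ring
    _ ≤ _ := mul_le_mul_of_nonneg_left h (by positivity)

/-- Inserting a factor `cos φ ≤ 1` brings the period to the form whose logarithmic divergence at `6
+ a = 2 b` is computed explicitly. -/
theorem le_pendTime_cos {a b : ℝ} (hD : 0 ≤ a + b) (hG : 2 * b < 6 + a) :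
    2 * √6 * (∫ φ in (0 : ℝ)..(Real.pi / 2),
      Real.cos φ / √(6 + a - 2 * b + (a + b) * Real.sin φ ^ 2)) ≤ pendTime a b := by
  refine mul_le_mul_of_nonneg_left ?_ (by positivity)
  have hflip := intervalIntegral.integral_comp_sub_left (a := 0) (b := Real.pi / 2)
    (fun ϕ => 1 / √(pendSq a b (Real.sin ϕ ^ 2))) (Real.pi / 2)
  rw [sub_zero, sub_self] at hflip
  have e0 : ∀ ϕ, 1 / √(pendSq a b (Real.sin (Real.pi / 2 - ϕ) ^ 2)) =
      1 / √(6 + a - 2 * b + (a + b) * Real.sin ϕ ^ 2) := fun ϕ => by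
    rw [Real.sin_pi_div_two_sub, Real.cos_sq', pendSq]
    congr 2
    ring
  simp only [e0] at hflip
  rw [← hflip]
  have hne : ∀ φ, √(6 + a - 2 * b + (a + b) * Real.sin φ ^ 2) ≠ 0 := fun φ =>
    (Real.sqrt_pos.2 (by nlinarith [mul_nonneg hD (sq_nonneg (Real.sin φ))])).ne'
  refine intervalIntegral.integral_mono_on (by positivity)
    ((Real.continuous_cos.div (by fun_prop) hne).intervalIntegrable _ _)
    ((continuous_const.div (by fun_prop) hne).intervalIntegrable _ _) fun φ _ => ?_
  exact div_le_div_of_nonneg_right (Real.cos_le_one φ) (Real.sqrt_nonneg _)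

/-- The left side integrates `f + b`. Since `6 + a - b > b`, the factorized `humpQuad` is at least
`(b + a s) ^ 2 / a`, which cancels the factor `b + a s` and leaves `√a cos φ`. The bound persists up
to the saddle although the duration itself diverges there. -/
theorem Osc.flux_plus_le {a b : ℝ} (h : Osc a b) :
    humpFlux a (plusQ a b) + b * humpTime a (plusQ a b) ≤ 2 * √6 * √a := by
  have ha := h.pos_left
  have hb := h.pos_right
  have i0 := intervalIntegrable_humpWeight h.adm_plus
  have i1 := intervalIntegrable_humpIntegrand 1 h.adm_plus
  have hle := intervalIntegral.integral_mono_on (μ := MeasureTheory.volume)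
    (a := 0) (b := Real.pi / 2) (by positivity) ((i1.const_mul a).add (i0.const_mul b))
    (g := fun φ => √a * Real.cos φ) (Continuous.intervalIntegrable (by fun_prop) _ _) fun φ hφ => by
      have hc := cos_nonneg_of_mem hφ
      set s := Real.cos φ ^ 2 with hs
      have hs0 : 0 ≤ s := sq_nonneg _
      have hp2 : 0 < b + a * s := by positivity
      have hq : (b + a * s) / √a ≤ √(humpQuad a (plusQ a b) s) := by
        refine Real.le_sqrt_of_sq_le ?_
        rw [humpQuad_plusQ ha.ne', div_pow, Real.sq_sqrt ha.le]
        refine div_le_div_of_nonneg_right ?_ ha.le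
        nlinarith [h.saddle]
      have hp3 : 0 < (b + a * s) / √a := div_pos hp2 (Real.sqrt_pos.2 ha)
      have e : a * (s ^ 1 * humpWeight a (plusQ a b) φ) + b * humpWeight a (plusQ a b) φ =
          (b + a * s) * Real.cos φ / √(humpQuad a (plusQ a b) s) := by
        rw [humpWeight, ← hs]; ring
      rw [e, div_le_iff₀ (hp3.trans_le hq)]
      calc (b + a * s) * Real.cos φ = √a * Real.cos φ * ((b + a * s) / √a) := by
            have := (Real.sqrt_pos.2 ha).ne'
            field_simp
        _ ≤ _ := mul_le_mul_of_nonneg_left hq (by positivity)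
  rw [intervalIntegral.integral_add (i1.const_mul a) (i0.const_mul b),
    intervalIntegral.integral_const_mul, intervalIntegral.integral_const_mul,
    intervalIntegral.integral_const_mul, integral_cos_half_pi, mul_one] at hle
  rw [humpFlux, humpMoment, humpTime_eq]
  calc _ = 2 * √6 * (a * (∫ φ in (0 : ℝ)..(Real.pi / 2),
        (Real.cos φ ^ 2) ^ 1 * humpWeight a (plusQ a b) φ) +
        b * ∫ φ in (0 : ℝ)..(Real.pi / 2), humpWeight a (plusQ a b) φ) := by ring
    _ ≤ _ := mul_le_mul_of_nonneg_left hle (by positivity)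

/-- Here `f + b = b sin φ ^ 2`. The saddle condition gives `6 + a - b - b s ≥ b (1 - s)`, so the
square root is at least `√b cos φ sin φ`. One factor of sine survives to offset the divergence. -/
theorem Osc.flux_minus_le {a b : ℝ} (h : Osc a b) :
    humpFlux (-b) (minusQ a b) + b * humpTime (-b) (minusQ a b) ≤ 2 * √6 * √b := by
  have ha := h.pos_left
  have hb := h.pos_right
  have i0 := intervalIntegrable_humpWeight h.adm_minus
  have i1 := intervalIntegrable_humpIntegrand 1 h.adm_minus
  have hle := intervalIntegral.integral_mono_on_of_le_Ioo (μ := MeasureTheory.volume)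
    (a := 0) (b := Real.pi / 2) (by positivity) ((i1.const_mul (-b)).add (i0.const_mul b))
    (g := fun φ => √b * Real.sin φ) (Continuous.intervalIntegrable (by fun_prop) _ _) fun φ hφ => by
      have hc := cos_pos_of_mem hφ
      have hsn := sin_pos_of_mem hφ
      have hss : Real.sin φ ^ 2 = 1 - Real.cos φ ^ 2 := by linarith [Real.sin_sq_add_cos_sq φ]
      have hs1 := (cos_sq_lt_one_of_mem hφ).le
      have hq : √b * (Real.cos φ * Real.sin φ) ≤
          √(humpQuad (-b) (minusQ a b) (Real.cos φ ^ 2)) := by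
        refine Real.le_sqrt_of_sq_le ?_
        rw [humpQuad_minusQ hb.ne', mul_pow, Real.sq_sqrt hb.le, mul_pow, hss, le_div_iff₀ hb]
        set s := Real.cos φ ^ 2 with hs
        have hs0 : 0 ≤ s := sq_nonneg _
        calc b * (s * (1 - s)) * b = (b - b * s) * (b * s) := by ring
          _ ≤ (6 + a - b - b * s) * (a + b * s) := by
            refine mul_le_mul ?_ (by linarith) (by positivity) ?_
            · linarith [h.saddle]
            · nlinarith [h.saddle, mul_nonneg hb.le (sub_nonneg.2 hs1)]
      have hp3 : 0 < √b * (Real.cos φ * Real.sin φ) :=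
        mul_pos (Real.sqrt_pos.2 hb) (mul_pos hc hsn)
      have e : -b * ((Real.cos φ ^ 2) ^ 1 * humpWeight (-b) (minusQ a b) φ) +
          b * humpWeight (-b) (minusQ a b) φ =
          b * Real.sin φ ^ 2 * Real.cos φ / √(humpQuad (-b) (minusQ a b) (Real.cos φ ^ 2)) := by
        rw [humpWeight, hss]; ring
      rw [e, div_le_iff₀ (hp3.trans_le hq)]
      calc b * Real.sin φ ^ 2 * Real.cos φ =
            √b * Real.sin φ * (√b * (Real.cos φ * Real.sin φ)) := by
            nth_rewrite 1 [← Real.sq_sqrt hb.le]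
            ring
        _ ≤ _ := mul_le_mul_of_nonneg_left hq (by positivity)
  have hsin : ∫ φ in (0 : ℝ)..(Real.pi / 2), Real.sin φ = 1 := by simp
  rw [intervalIntegral.integral_add (i1.const_mul (-b)) (i0.const_mul b),
    intervalIntegral.integral_const_mul, intervalIntegral.integral_const_mul,
    intervalIntegral.integral_const_mul, hsin, mul_one] at hle
  rw [humpFlux, humpMoment, humpTime_eq]
  calc _ = 2 * √6 * (-b * (∫ φ in (0 : ℝ)..(Real.pi / 2),
        (Real.cos φ ^ 2) ^ 1 * humpWeight (-b) (minusQ a b) φ) +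
        b * ∫ φ in (0 : ℝ)..(Real.pi / 2), humpWeight (-b) (minusQ a b) φ) := by ring
    _ ≤ _ := mul_le_mul_of_nonneg_left hle (by positivity)

/-! ### From profiles to parameters -/

theorem IsProfile.exists_energy {α c : ℝ} {f g : ℝ → ℝ} (h : IsProfile α f g c) :
    ∃ E, ∀ t ∈ Ioo (-α) α, g t ^ 2 = 2 * E + 2 * c * f t - 4 * f t ^ 2 - 2 / 3 * f t ^ 3 := by
  have hd : ∀ t ∈ Ioo (-α) α, HasDerivAt
      (fun t => g t ^ 2 - 2 * c * f t + 4 * f t ^ 2 + 2 / 3 * f t ^ 3) 0 t := by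
    intro t ht
    have h1 := h.hasDerivAt t ht
    have h2 := h.hasDerivAt' t ht
    refine (((((h2.pow 2).sub (h1.const_mul (2 * c))).add ((h1.pow 2).const_mul 4)).add
      ((h1.pow 3).const_mul (2 / 3)))).congr_deriv ?_
    push_cast
    ring
  obtain ⟨k, hk⟩ := eq_const_of_hasDerivAt_zero hd
  exact ⟨k / 2, fun t ht => by linarith [hk t ht]⟩

/-- A monotone branch of a hump, in the normalized height. -/
theorem setIntegral_branch {p q a Q : ℝ} {s σ : ℝ → ℝ} (hA : Adm a Q)
    (hd : ∀ t ∈ Ioo p q, HasDerivAt s (σ t) t) (hinj : InjOn s (Ioo p q))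
    (himg : s '' Ioo p q = Ioo 0 1)
    (hE : ∀ t ∈ Ioo p q, σ t ^ 2 = 2 / 3 * (1 - s t) * humpQuad a Q (s t)) (n : ℕ) :
    ∫ t in Ioo p q, s t ^ n =
      √6 * ∫ φ in (0 : ℝ)..(Real.pi / 2), (Real.cos φ ^ 2) ^ n * humpWeight a Q φ := by
  have hs : ∀ t ∈ Ioo p q, s t ∈ Ioo (0 : ℝ) 1 := fun t ht => himg ▸ mem_image_of_mem s ht
  set φ : ℝ → ℝ := fun t => Real.arccos √(s t) with hφ
  have hroot : ∀ t ∈ Ioo p q, 0 < √(s t) ∧ √(s t) < 1 := fun t ht =>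
    ⟨Real.sqrt_pos.2 (hs t ht).1, by rw [Real.sqrt_lt' one_pos]; linarith [(hs t ht).2]⟩
  have hcos : ∀ t ∈ Ioo p q, Real.cos (φ t) = √(s t) := fun t ht =>
    Real.cos_arccos (by linarith [(hroot t ht).1]) (hroot t ht).2.le
  have hφd : ∀ t ∈ Ioo p q, HasDerivWithinAt φ
      (-(1 / √(1 - s t)) * (σ t / (2 * √(s t)))) (Ioo p q) t := by
    intro t ht
    have h1 := (hd t ht).sqrt (hs t ht).1.ne'
    have h2 := (Real.hasDerivAt_arccos (x := √(s t)) (by linarith [(hroot t ht).1])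
      (hroot t ht).2.ne).comp t h1
    rw [Real.sq_sqrt (hs t ht).1.le] at h2
    exact h2.hasDerivWithinAt
  have hφinj : InjOn φ (Ioo p q) := by
    intro t ht t' ht' h
    have h1 : √(s t) = √(s t') := by
      rw [← hcos t ht, ← hcos t' ht', h]
    exact hinj ht ht' ((Real.sqrt_inj (hs t ht).1.le (hs t' ht').1.le).1 h1)
  have hφimg : φ '' Ioo p q = Ioo 0 (Real.pi / 2) := by
    ext x
    constructor
    · rintro ⟨t, ht, rfl⟩
      exact ⟨Real.arccos_pos.2 (hroot t ht).2, Real.arccos_lt_pi_div_two.2 (hroot t ht).1⟩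
    · intro hx
      have h1 : Real.cos x ^ 2 ∈ Ioo (0 : ℝ) 1 := ⟨cos_sq_pos_of_mem hx, cos_sq_lt_one_of_mem hx⟩
      rw [← himg] at h1
      obtain ⟨t, ht, hst⟩ := h1
      refine ⟨t, ht, ?_⟩
      simp only [hφ]
      rw [hst, Real.sqrt_sq (cos_pos_of_mem hx).le, Real.arccos_cos hx.1.le
        (by linarith [hx.2, Real.pi_pos])]
  rw [intervalIntegral.integral_of_le (by positivity), MeasureTheory.integral_Ioc_eq_integral_Ioo,
    ← hφimg, MeasureTheory.integral_image_eq_integral_abs_deriv_smul measurableSet_Ioo hφd hφinj,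
    ← MeasureTheory.integral_const_mul]
  refine MeasureTheory.setIntegral_congr_fun measurableSet_Ioo fun t ht => ?_
  have h0 := hs t ht
  have hq := humpQuad_pos hA h0.1 h0.2.le
  have h1s : 0 < 1 - s t := by linarith [h0.2]
  have habs : |σ t| = √(2 / 3) * √(1 - s t) * √(humpQuad a Q (s t)) := by
    rw [← Real.sqrt_sq_eq_abs, hE t ht, Real.sqrt_mul (by positivity), Real.sqrt_mul (by norm_num)]
  have h6 : √6 * √(2 / 3) = 2 := by
    rw [← Real.sqrt_mul (by norm_num), show (6 : ℝ) * (2 / 3) = 2 ^ 2 by norm_num,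
      Real.sqrt_sq (by norm_num)]
  simp only [smul_eq_mul]
  rw [humpWeight, hcos t ht, Real.sq_sqrt h0.1.le, abs_mul, abs_neg, abs_div, abs_div, habs,
    abs_of_pos (Real.sqrt_pos.2 h1s), abs_of_pos (mul_pos two_pos (hroot t ht).1), abs_one]
  have q1 := (hroot t ht).1.ne'
  have q2 := (Real.sqrt_pos.2 h1s).ne'
  have q3 := (Real.sqrt_pos.2 hq).ne'
  field_simp
  linear_combination (-s t ^ n) * h6

/-- A full hump in the normalized height, with maximum `1` at `t₀`. -/
theorem integral_hump {p q t₀ a Q : ℝ} {s σ : ℝ → ℝ} (ht₀ : t₀ ∈ Ioo p q) (hA : Adm a Q)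
    (hcont : ContinuousOn s (Icc p q)) (hp : s p = 0) (hq : s q = 0)
    (hpos : ∀ t ∈ Ioo p q, 0 < s t) (hle : ∀ t ∈ Ioo p q, s t ≤ 1) (hmax : s t₀ = 1)
    (hd : ∀ t ∈ Ioo p q, HasDerivAt s (σ t) t)
    (hd' : ∀ t ∈ Ioo p q, s t = 1 → HasDerivAt σ (-(6 + 2 * a + Q) / 3) t)
    (hE : ∀ t ∈ Ioo p q, σ t ^ 2 = 2 / 3 * (1 - s t) * humpQuad a Q (s t)) (n : ℕ) :
    ∫ t in p..q, s t ^ n = humpMoment n a Q := by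
  have hne : ∀ t ∈ Ioo p q, s t ≠ 1 → σ t ≠ 0 := by
    intro t ht h1 h0
    have h2 := hE t ht
    have h3 := humpQuad_pos hA (hpos t ht) (hle t ht)
    have h4 : 0 < 1 - s t := sub_pos.2 (lt_of_le_of_ne (hle t ht) h1)
    rw [h0] at h2
    have : 0 < 2 / 3 * (1 - s t) * humpQuad a Q (s t) := by positivity
    nlinarith
  -- Between two maxima the minimum of `s` would either be an interior critical point with `s ≠ 1`,
  -- excluded by the energy identity, or equal `1`, making `s` constant there, against the nonzero
  -- derivative of `σ`.
  have huniq : ∀ u ∈ Ioo p q, ∀ v ∈ Ioo p q, u < v → s u = 1 → s v = 1 → False := by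
    intro u hu v hv huv hsu hsv
    have hsub : Icc u v ⊆ Ioo p q := fun t ht => ⟨hu.1.trans_le ht.1, ht.2.trans_lt hv.2⟩
    obtain ⟨w, hw, hwmin⟩ := isCompact_Icc.exists_isMinOn (nonempty_Icc.2 huv.le)
      (hcont.mono (hsub.trans Ioo_subset_Icc_self))
    rcases eq_or_ne (s w) 1 with h1 | h1
    · have hall : ∀ t ∈ Ioo u v, s t = 1 := fun t ht => le_antisymm
        (hle t (hsub (Ioo_subset_Icc_self ht))) (h1 ▸ hwmin (Ioo_subset_Icc_self ht))
      have hm : (u + v) / 2 ∈ Ioo u v := ⟨by linarith, by linarith⟩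
      have hσ : ∀ t ∈ Ioo u v, σ t = 0 := by
        intro t ht
        have h2 := (hasDerivAt_const t (1 : ℝ)).congr_of_eventuallyEq (f₁ := s)
          (by filter_upwards [isOpen_Ioo.mem_nhds ht] with x hx using hall x hx)
        exact (hd t (hsub (Ioo_subset_Icc_self ht))).unique h2
      have h2 := (hasDerivAt_const ((u + v) / 2) (0 : ℝ)).congr_of_eventuallyEq (f₁ := σ)
          (by filter_upwards [isOpen_Ioo.mem_nhds hm] with x hx using hσ x hx)
      have h3 := (hd' _ (hsub (Ioo_subset_Icc_self hm)) (hall _ hm)).unique h2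
      linarith [hA.2]
    · have hwu : w ≠ u := fun h => h1 (h ▸ hsu)
      have hwv : w ≠ v := fun h => h1 (h ▸ hsv)
      have hw' : w ∈ Ioo u v := ⟨lt_of_le_of_ne hw.1 hwu.symm, lt_of_le_of_ne hw.2 hwv⟩
      exact hne w (hsub hw) h1 ((hwmin.isLocalMin (Icc_mem_nhds hw'.1 hw'.2)).hasDerivAt_eq_zero
        (hd w (hsub hw)))
  have hlt : ∀ t ∈ Ioo p q, t ≠ t₀ → s t < 1 := by
    intro t ht htt
    refine lt_of_le_of_ne (hle t ht) fun h1 => ?_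
    rcases lt_or_gt_of_ne htt with h | h
    · exact huniq t ht t₀ ht₀ h h1 hmax
    · exact huniq t₀ ht₀ t ht h hmax h1
  have hinj : ∀ u v, Ioo u v ⊆ Ioo p q → t₀ ∉ Ioo u v → InjOn s (Ioo u v) := by
    intro u v hsub hnot
    have key : ∀ x ∈ Ioo u v, ∀ y ∈ Ioo u v, x < y → s x ≠ s y := by
      intro x hx y hy hxy hs
      obtain ⟨z, hz, hz0⟩ := exists_hasDerivAt_eq_zero hxy
        (hcont.mono fun t ht => Ioo_subset_Icc_self
          (hsub ⟨hx.1.trans_le ht.1, ht.2.trans_lt hy.2⟩)) hs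
        (fun t ht => hd t (hsub ⟨hx.1.trans ht.1, ht.2.trans hy.2⟩))
      have hzu : z ∈ Ioo u v := ⟨hx.1.trans hz.1, hz.2.trans hy.2⟩
      exact hne z (hsub hzu) (hlt z (hsub hzu) fun h => hnot (h ▸ hzu)).ne hz0
    intro x hx y hy hxy
    by_contra hne'
    rcases lt_or_gt_of_ne hne' with h' | h'
    · exact key x hx y hy h' hxy
    · exact key y hy x hx h' hxy.symm
  have hs2 : Ioo t₀ q ⊆ Ioo p q := Ioo_subset_Ioo_left ht₀.1.le
  have hs1 : Ioo p t₀ ⊆ Ioo p q := Ioo_subset_Ioo_right ht₀.2.le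
  have himg1 : s '' Ioo p t₀ = Ioo 0 1 := by
    refine Subset.antisymm ?_ ?_
    · rintro _ ⟨t, ht, rfl⟩
      exact ⟨hpos t (hs1 ht), hlt t (hs1 ht) ht.2.ne⟩
    · have := intermediate_value_Ioo ht₀.1.le (hcont.mono (Icc_subset_Icc_right ht₀.2.le))
      rwa [hp, hmax] at this
  have himg2 : s '' Ioo t₀ q = Ioo 0 1 := by
    refine Subset.antisymm ?_ ?_
    · rintro _ ⟨t, ht, rfl⟩
      exact ⟨hpos t (hs2 ht), hlt t (hs2 ht) ht.1.ne'⟩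
    · have := intermediate_value_Ioo' ht₀.2.le (hcont.mono (Icc_subset_Icc_left ht₀.1.le))
      rwa [hq, hmax] at this
  have b1 := setIntegral_branch hA (fun t ht => hd t (hs1 ht)) (hinj p t₀ hs1 fun h => h.2.false)
    himg1 (fun t ht => hE t (hs1 ht)) n
  have b2 := setIntegral_branch hA (fun t ht => hd t (hs2 ht)) (hinj t₀ q hs2 fun h => h.1.false)
    himg2 (fun t ht => hE t (hs2 ht)) n
  have hi1 : IntervalIntegrable (fun t => s t ^ n) MeasureTheory.volume p t₀ := by
    refine ContinuousOn.intervalIntegrable ?_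
    rw [uIcc_of_le ht₀.1.le]
    exact (hcont.mono (Icc_subset_Icc_right ht₀.2.le)).pow n
  have hi2 : IntervalIntegrable (fun t => s t ^ n) MeasureTheory.volume t₀ q := by
    refine ContinuousOn.intervalIntegrable ?_
    rw [uIcc_of_le ht₀.2.le]
    exact (hcont.mono (Icc_subset_Icc_left ht₀.1.le)).pow n
  rw [← intervalIntegral.integral_add_adjacent_intervals hi1 hi2,
    intervalIntegral.integral_of_le ht₀.1.le, intervalIntegral.integral_of_le ht₀.2.le,
    MeasureTheory.integral_Ioc_eq_integral_Ioo, MeasureTheory.integral_Ioc_eq_integral_Ioo, b1, b2,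
    humpMoment]
  ring

/-- The constants of a profile having a hump of height `a`. -/
structure HumpData (E c a Q : ℝ) : Prop where
  adm : Adm a Q
  ne_zero : a ≠ 0
  energy : 3 * E = a ^ 2 * Q
  const : 3 * c = 6 * a + a ^ 2 - a * Q

/-- The extreme value `a` is a root of the energy cubic, because the derivative vanishes there.
Dividing out `a - f` defines `Q` and yields the normalized equation to which `integral_hump`
applies. -/
theorem IsProfile.exists_hump {α c E : ℝ} {f g : ℝ → ℝ} (h : IsProfile α f g c)
    (hE : ∀ t ∈ Ioo (-α) α, g t ^ 2 = 2 * E + 2 * c * f t - 4 * f t ^ 2 - 2 / 3 * f t ^ 3)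
    {ε p q : ℝ} (hε : ε = 1 ∨ ε = -1) (hpq : p < q) (hp : -α ≤ p) (hq : q ≤ α) (hfp : f p = 0)
    (hfq : f q = 0) (hpos : ∀ t ∈ Ioo p q, 0 < ε * f t) :
    ∃ a Q, 0 < ε * a ∧ HumpData E c a Q ∧ q - p = humpTime a Q ∧
      ∫ t in p..q, f t = humpFlux a Q := by
  have hεε : ε * ε = 1 := by rcases hε with rfl | rfl <;> norm_num
  have hsub : Ioo p q ⊆ Ioo (-α) α := Ioo_subset_Ioo hp hq
  have hfc : ContinuousOn f (Icc p q) := h.continuousOn.mono (Icc_subset_Icc hp hq)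
  obtain ⟨t₀, ht₀', hmax⟩ := isCompact_Icc.exists_isMaxOn (nonempty_Icc.2 hpq.le)
    (continuousOn_const.mul hfc : ContinuousOn (fun t => ε * f t) (Icc p q))
  have hmid : (p + q) / 2 ∈ Ioo p q := ⟨by linarith, by linarith⟩
  have hM : 0 < ε * f t₀ := (hpos _ hmid).trans_le (hmax (Ioo_subset_Icc_self hmid))
  have ht₀ : t₀ ∈ Ioo p q := by
    refine ⟨lt_of_le_of_ne ht₀'.1 fun h => ?_, lt_of_le_of_ne ht₀'.2 fun h => ?_⟩
    · rw [← h, hfp, mul_zero] at hM; exact lt_irrefl _ hM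
    · rw [h, hfq, mul_zero] at hM; exact lt_irrefl _ hM
  set a := f t₀ with ha
  have ha0 : a ≠ 0 := fun h => by rw [h, mul_zero] at hM; exact lt_irrefl _ hM
  set Q := (6 * a + a ^ 2 - 3 * c) / a with hQ
  have hconst : 3 * c = 6 * a + a ^ 2 - a * Q := by rw [hQ]; field_simp; ring
  set s : ℝ → ℝ := fun t => f t / a with hs
  set σ : ℝ → ℝ := fun t => g t / a with hσ
  have hsd : ∀ t ∈ Ioo p q, HasDerivAt s (σ t) t := fun t ht =>
    (h.hasDerivAt t (hsub ht)).div_const a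
  have hg0 : g t₀ = 0 := by
    have h1 := (hmax.isLocalMax (Icc_mem_nhds ht₀.1 ht₀.2)).hasDerivAt_eq_zero
      ((h.hasDerivAt t₀ (hsub ht₀)).const_mul ε)
    calc g t₀ = ε * (ε * g t₀) := by rw [← mul_assoc, hεε, one_mul]
      _ = 0 := by rw [h1, mul_zero]
  have hen : 3 * E = a ^ 2 * Q := by
    have h1 := hE t₀ (hsub ht₀)
    rw [hg0, ← ha] at h1
    linear_combination (-3 / 2) * h1 - a * hconst
  have hsE : ∀ t ∈ Ioo p q, σ t ^ 2 = 2 / 3 * (1 - s t) * humpQuad a Q (s t) := by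
    intro t ht
    have h1 := hE t (hsub ht)
    have h2 : 2 / 3 * (1 - s t) * humpQuad a Q (s t) =
        2 / 3 * (a - f t) * (f t ^ 2 + (6 + a) * f t + a * Q) / a ^ 2 := by
      simp only [hs, humpQuad]; field_simp; ring
    rw [h2]
    simp only [hσ]
    rw [div_pow, h1]
    congr 1
    linear_combination (2 / 3) * hen + (2 / 3 * f t) * hconst
  have hscont : ContinuousOn s (Icc p q) := hfc.div_const a
  have hseq : ∀ t, s t = ε * f t / (ε * a) := fun t => by
    have : ε ≠ 0 := fun h => by rw [h, zero_mul] at hεε; exact zero_ne_one hεε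
    simp only [hs]; field_simp
  have hspos : ∀ t ∈ Ioo p q, 0 < s t := fun t ht => by
    rw [hseq]; exact div_pos (hpos t ht) hM
  have hsle : ∀ t ∈ Ioo p q, s t ≤ 1 := fun t ht => by
    rw [hseq, div_le_one hM]; exact hmax (Ioo_subset_Icc_self ht)
  have hst₀ : s t₀ = 1 := div_self ha0
  have hsp : s p = 0 := by simp [hs, hfp]
  have hsq : s q = 0 := by simp [hs, hfq]
  -- Every height in `(0, 1)` is attained on the hump, and there `σ ^ 2 ≥ 0` forces the quadratic
  -- factor to be nonnegative.
  have hquad : ∀ x ∈ Icc (0 : ℝ) 1, 0 ≤ humpQuad a Q x := by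
    have h1 : ∀ x ∈ Ioo (0 : ℝ) 1, 0 ≤ humpQuad a Q x := by
      intro x hx
      have h2 := intermediate_value_Ioo ht₀.1.le (hscont.mono (Icc_subset_Icc_right ht₀.2.le))
      rw [hsp, hst₀] at h2
      obtain ⟨t, ht, rfl⟩ := h2 hx
      have h3 := hsE t (Ioo_subset_Ioo_right ht₀.2.le ht)
      by_contra! hneg
      have h4 : 0 < 1 - s t := sub_pos.2 hx.2
      nlinarith [sq_nonneg (σ t), mul_neg_of_pos_of_neg h4 hneg]
    have h2 := le_on_closure (s := Ioo (0 : ℝ) 1) (f := fun _ => 0) (g := humpQuad a Q) h1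
      continuousOn_const (Continuous.continuousOn (by unfold humpQuad; fun_prop))
    rw [closure_Ioo (zero_ne_one' ℝ)] at h2
    exact fun x hx => h2 hx
  have hQ0 : 0 ≤ Q := by simpa [humpQuad] using hquad 0 ⟨le_rfl, zero_le_one⟩
  have hQ1 : 0 ≤ 6 + 2 * a + Q := by
    have := hquad 1 ⟨zero_le_one, le_rfl⟩
    rw [humpQuad] at this
    linarith
  -- Equality would make `s = 1` a double root, that is, an equilibrium. Then `|σ| ≤ K |s - 1|`, and
  -- Gronwall's inequality keeps `s` at `1` from `t₀` on, against `s q = 0`.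
  have hA : Adm a Q := by
    refine ⟨hQ0, lt_of_le_of_ne hQ1 fun h0 => ?_⟩
    set K := √(2 / 3 * (|a| + |6 + 2 * a|)) with hK
    have hbound : ∀ t ∈ Ioo p q, ‖σ t‖ ≤ K * ‖s t - 1‖ := by
      intro t ht
      rw [Real.norm_eq_abs, Real.norm_eq_abs]
      refine abs_le_of_sq_le_sq ?_ (by positivity)
      · rw [hsE t ht, mul_pow, hK, Real.sq_sqrt (by positivity), sq_abs]
        have e : humpQuad a Q (s t) = (1 - s t) * -(a * s t + (6 + 2 * a)) := by
          rw [humpQuad, show Q = -(6 + 2 * a) by linarith]; ring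
        rw [e]
        have h1 : -(a * s t + (6 + 2 * a)) ≤ |a| + |6 + 2 * a| := by
          have h2 : |a * s t| ≤ |a| := by
            rw [abs_mul, abs_of_pos (hspos t ht)]
            exact mul_le_of_le_one_right (abs_nonneg a) (hsle t ht)
          linarith [neg_abs_le (a * s t), neg_abs_le (6 + 2 * a)]
        nlinarith [mul_le_mul_of_nonneg_left h1 (sq_nonneg (s t - 1))]
    have hone : ∀ t ∈ Ioo t₀ q, s t = 1 := by
      intro t ht
      have h1 := norm_le_gronwallBound_of_norm_deriv_right_le (f := fun t => s t - 1) (f' := σ)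
        (δ := 0) (K := K) (ε := 0) (a := t₀) (b := t)
        ((hscont.mono fun x hx => ⟨ht₀.1.le.trans hx.1, hx.2.trans ht.2.le⟩).sub continuousOn_const)
        (fun x hx => ((hsd x ⟨ht₀.1.trans_le hx.1, hx.2.trans ht.2⟩).sub_const 1).hasDerivWithinAt)
        (by simp [hst₀])
        (fun x hx => by
          rw [add_zero]; exact hbound x ⟨ht₀.1.trans_le hx.1, hx.2.trans ht.2⟩)
        t ⟨ht.1.le, le_rfl⟩
      rw [gronwallBound_ε0_δ0] at h1
      exact sub_eq_zero.1 (norm_le_zero_iff.1 h1)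
    have hcl : closure (Ioo t₀ q) = Icc t₀ q := closure_Ioo ht₀.2.ne
    have h1 : EqOn s (fun _ => 1) (Icc t₀ q) :=
      EqOn.of_subset_closure (s := Ioo t₀ q) (f := s) (g := fun _ => 1) hone
        (hscont.mono (Icc_subset_Icc_left ht₀.1.le))
        continuousOn_const Ioo_subset_Icc_self hcl.ge
    have h2 := h1 ⟨ht₀.2.le, le_rfl⟩
    rw [hsq] at h2
    exact zero_ne_one h2
  have hsd' : ∀ t ∈ Ioo p q, s t = 1 → HasDerivAt σ (-(6 + 2 * a + Q) / 3) t := by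
    intro t ht h1
    refine ((h.hasDerivAt' t (hsub ht)).div_const a).congr_deriv ?_
    have hfa : f t = a := by
      simp only [hs] at h1
      rwa [div_eq_one_iff_eq ha0] at h1
    rw [hfa, div_eq_div_iff ha0 (by norm_num)]
    linear_combination hconst
  have key := integral_hump ht₀ hA hscont hsp hsq hspos hsle hst₀ hsd hsd' hsE
  refine ⟨a, Q, hM, ⟨hA, ha0, hen, hconst⟩, ?_, ?_⟩
  · have := key 0
    simpa [humpTime] using this
  · rw [humpFlux, ← key 1, ← intervalIntegral.integral_const_mul]
    refine intervalIntegral.integral_congr fun t _ => ?_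
    simp only [hs, pow_one]
    field_simp

/-- Both heights are roots of the same energy cubic. If one were a proper fraction of the other, it
would be an intermediate height of the larger hump, where that cubic is positive by admissibility.
-/
theorem HumpData.unique {E c a a' Q Q' : ℝ} (h : HumpData E c a Q) (h' : HumpData E c a' Q')
    (hs : 0 < a / a') : a = a' ∧ Q = Q' := by
  have key : ∀ {a a' Q Q' : ℝ}, HumpData E c a Q → HumpData E c a' Q' → 0 < a / a' →
      ¬ a / a' < 1 := by
    intro a a' Q Q' h h' h0 h1
    have hq := humpQuad_pos h'.adm h0 h1.le
    have h2 : a ^ 2 * Q + a * (6 * a + a ^ 2 - a * Q) - 6 * a ^ 2 - a ^ 3 =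
        a' ^ 2 * ((1 - a / a') * humpQuad a' Q' (a / a')) := by
      rw [← h.energy, ← h.const, h'.energy, h'.const, humpQuad]
      have := h'.ne_zero
      field_simp
      ring
    have h3 : 0 < a' ^ 2 * ((1 - a / a') * humpQuad a' Q' (a / a')) :=
      mul_pos (by have := h'.ne_zero; positivity) (mul_pos (by linarith) hq)
    rw [← h2] at h3
    ring_nf at h3
    exact lt_irrefl _ h3
  have hs' : 0 < a' / a := by rw [← inv_div]; exact inv_pos.2 hs
  have h1 : a / a' = 1 := by
    refine le_antisymm ?_ (not_lt.1 (key h h' hs))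
    have := not_lt.1 (key h' h hs')
    rw [← inv_div] at this
    rwa [one_le_inv₀ hs] at this
  have haa : a = a' := by rwa [div_eq_one_iff_eq h'.ne_zero] at h1
  refine ⟨haa, ?_⟩
  have h2 := h.energy
  rw [h'.energy, haa] at h2
  exact (mul_left_cancel₀ (pow_ne_zero 2 h'.ne_zero) h2).symm

theorem IsProfile.isOpen_sign {α c : ℝ} {f g : ℝ → ℝ} (h : IsProfile α f g c) (ε : ℝ) :
    IsOpen {θ | θ ∈ Ioo (-α) α ∧ 0 < ε * f θ} :=
  ((continuousOn_const.mul (h.continuousOn.mono Ioo_subset_Icc_self)).isOpen_inter_preimage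
    isOpen_Ioo isOpen_Ioi : IsOpen (Ioo (-α) α ∩ (fun θ => ε * f θ) ⁻¹' Ioi 0))

theorem IsProfile.integrableOn {α c : ℝ} {f g : ℝ → ℝ} (h : IsProfile α f g c) {S : Set ℝ}
    (hS : S ⊆ Icc (-α) α) : MeasureTheory.IntegrableOn f S :=
  (h.continuousOn.integrableOn_Icc).mono_set hS

/-- All the humps of the same sign together. -/
theorem IsProfile.sign_humps {α c E : ℝ} {f g : ℝ → ℝ} (h : IsProfile α f g c)
    (hE : ∀ t ∈ Ioo (-α) α, g t ^ 2 = 2 * E + 2 * c * f t - 4 * f t ^ 2 - 2 / 3 * f t ^ 3)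
    {ε : ℝ} (hε : ε = 1 ∨ ε = -1) {m : ℕ} (hm : m ≠ 0)
    (hN : numIntervals {θ | θ ∈ Ioo (-α) α ∧ 0 < ε * f θ} = (m : ℕ∞)) :
    ∃ a Q, 0 < ε * a ∧ HumpData E c a Q ∧
      (∫ _ in {θ | θ ∈ Ioo (-α) α ∧ 0 < ε * f θ}, (1 : ℝ)) = m * humpTime a Q ∧
      ∫ t in {θ | θ ∈ Ioo (-α) α ∧ 0 < ε * f θ}, f t = m * humpFlux a Q := by
  set S := {θ | θ ∈ Ioo (-α) α ∧ 0 < ε * f θ} with hS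
  have hSsub : S ⊆ Ioo (-α) α := fun x hx => hx.1
  have hSo : IsOpen S := h.isOpen_sign ε
  have hcomp : ∀ x ∈ S, ∃ l r, connectedComponentIn S x = Ioo l r ∧ l < r ∧ ∃ a Q, 0 < ε * a ∧
      HumpData E c a Q ∧ r - l = humpTime a Q ∧ ∫ t in l..r, f t = humpFlux a Q := by
    intro x hx
    obtain ⟨l, r, hlr, hxlr, hl, hr, hal, hra⟩ := connectedComponentIn_eq_Ioo hSo hSsub hx
    have hlr' : l < r := hxlr.1.trans hxlr.2
    have hpos : ∀ t ∈ Ioo l r, 0 < ε * f t := fun t ht =>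
      (connectedComponentIn_subset S x (hlr.ge ht)).2
    have hε0 : ε ≠ 0 := by rcases hε with rfl | rfl <;> norm_num
    have hnn : ∀ t ∈ Icc l r, 0 ≤ ε * f t := by
      have h1 := le_on_closure (s := Ioo l r) (f := fun _ => (0 : ℝ)) (g := fun t => ε * f t)
        (fun t ht => (hpos t ht).le) continuousOn_const
      rw [closure_Ioo hlr'.ne] at h1
      exact fun t ht => h1 (continuousOn_const.mul
        (h.continuousOn.mono (Icc_subset_Icc hal hra))) ht
    have hzero : ∀ y ∈ Icc l r, y ∈ Icc (-α) α → y ∉ S → f y = 0 := by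
      intro y hy hyα hyS
      by_cases h1 : y = -α
      · rw [h1, h.left]
      by_cases h2 : y = α
      · rw [h2, h.right]
      have h3 : ε * f y ≤ 0 := by
        by_contra! h4
        exact hyS ⟨⟨lt_of_le_of_ne hyα.1 (Ne.symm h1), lt_of_le_of_ne hyα.2 h2⟩, h4⟩
      exact (mul_eq_zero.1 (le_antisymm h3 (hnn y hy))).resolve_left hε0
    obtain ⟨a, Q, ha, hD, hT, hF⟩ := h.exists_hump hE hε hlr' hal hra
      (hzero l ⟨le_rfl, hlr'.le⟩ ⟨hal, hlr'.le.trans hra⟩ hl)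
      (hzero r ⟨hlr'.le, le_rfl⟩ ⟨hal.trans hlr'.le, hra⟩ hr) hpos
    exact ⟨l, r, hlr, hlr', a, Q, ha, hD, hT, hF⟩
  have hne : S.Nonempty := by
    rw [nonempty_iff_ne_empty]
    intro h0
    rw [← numIntervals_eq_zero_iff, hN] at h0
    exact hm (by exact_mod_cast h0)
  obtain ⟨x₀, hx₀⟩ := hne
  obtain ⟨_, _, _, _, a, Q, ha, hD, _, _⟩ := hcomp x₀ hx₀
  have hall : ∀ x ∈ S, ∃ l r, connectedComponentIn S x = Ioo l r ∧ l < r ∧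
      r - l = humpTime a Q ∧ ∫ t in l..r, f t = humpFlux a Q := by
    intro x hx
    obtain ⟨l, r, h1, h2, a', Q', ha', hD', h3, h4⟩ := hcomp x hx
    have hs : 0 < a / a' := by
      have : a / a' = (ε * a) / (ε * a') := by
        have hε0 : ε ≠ 0 := by rcases hε with rfl | rfl <;> norm_num
        field_simp
      rw [this]
      exact div_pos ha ha'
    obtain ⟨rfl, rfl⟩ := hD.unique hD' hs
    exact ⟨l, r, h1, h2, h3, h4⟩
  refine ⟨a, Q, ha, hD, setIntegral_eq_card_mul hSo hN ?_ fun x hx => ?_,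
    setIntegral_eq_card_mul hSo hN ?_ fun x hx => ?_⟩
  · exact (continuousOn_const.integrableOn_Icc (a := -α) (b := α)).mono_set
      (hSsub.trans Ioo_subset_Icc_self)
  · obtain ⟨l, r, h1, h2, h3, h4⟩ := hall x hx
    rw [h1, ← MeasureTheory.integral_Ioc_eq_integral_Ioo, ← intervalIntegral.integral_of_le h2.le,
      intervalIntegral.integral_const, smul_eq_mul, mul_one, h3]
  · exact h.integrableOn (hSsub.trans Ioo_subset_Icc_self)
  · obtain ⟨l, r, h1, h2, h3, h4⟩ := hall x hx
    rw [h1, ← MeasureTheory.integral_Ioc_eq_integral_Ioo, ← intervalIntegral.integral_of_le h2.le,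
      h4]

theorem HumpData.not_both_zero {E c a Q : ℝ} (h : HumpData E c a Q) : E ≠ 0 ∨ c ≠ 0 := by
  by_contra! h0
  have h1 := h.energy
  have h2 := h.const
  rw [h0.1, mul_zero] at h1
  rw [h0.2, mul_zero] at h2
  have hQ : Q = 0 := (mul_eq_zero.1 h1.symm).resolve_left (pow_ne_zero 2 h.ne_zero)
  rw [hQ] at h2
  have h3 : a * (6 + a) = 0 := by linarith
  have h4 := (mul_eq_zero.1 h3).resolve_left h.ne_zero
  have h5 := h.adm.2
  rw [hQ] at h5
  linarith

/-- Zeros are isolated: if `E ≠ 0` the slope is nonzero at each of them, while if `E = 0` every zero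
of `f` is a zero of `g`, whose derivative there is `c ≠ 0`. Hence the zeros do not contribute to the
integrals. -/
theorem IsProfile.countable_zeros {α c E a Q : ℝ} {f g : ℝ → ℝ} (h : IsProfile α f g c)
    (hE : ∀ t ∈ Ioo (-α) α, g t ^ 2 = 2 * E + 2 * c * f t - 4 * f t ^ 2 - 2 / 3 * f t ^ 3)
    (hD : HumpData E c a Q) : {θ | θ ∈ Ioo (-α) α ∧ f θ = 0}.Countable := by
  rcases hD.not_both_zero with h0 | h0
  · refine countable_of_eventually_notMem fun x hx => ?_
    have hg : g x ≠ 0 := fun hg => by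
      have h1 := hE x hx.1
      rw [hx.2, hg] at h1
      exact h0 (by linarith)
    filter_upwards [(h.hasDerivAt x hx.1).eventually_ne (c := 0) hg] with y hy hyS using hy hyS.2
  · by_cases hE0 : E = 0
    · refine countable_of_eventually_notMem fun x hx => ?_
      have hz : ∀ y ∈ Ioo (-α) α, f y = 0 → g y = 0 := fun y hy hfy => by
        have h1 := hE y hy
        rw [hfy, hE0] at h1
        exact pow_eq_zero_iff two_ne_zero |>.1 (by linarith)
      have hc : c - 4 * f x - f x ^ 2 ≠ 0 := by
        rw [hx.2]
        simpa using h0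
      filter_upwards [(h.hasDerivAt' x hx.1).eventually_ne (c := 0) hc] with y hy hyS
        using hy (hz y hyS.1 hyS.2)
    · refine countable_of_eventually_notMem fun x hx => ?_
      have hg : g x ≠ 0 := fun hg => by
        have h1 := hE x hx.1
        rw [hx.2, hg] at h1
        exact hE0 (by linarith)
      filter_upwards [(h.hasDerivAt x hx.1).eventually_ne (c := 0) hg] with y hy hyS using hy hyS.2

theorem IsProfile.integral_split {α c E a Q : ℝ} (hα₀ : 0 < α) {f g : ℝ → ℝ}
    (h : IsProfile α f g c)
    (hE : ∀ t ∈ Ioo (-α) α, g t ^ 2 = 2 * E + 2 * c * f t - 4 * f t ^ 2 - 2 / 3 * f t ^ 3)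
    (hD : HumpData E c a Q) {F : ℝ → ℝ} (hF : ContinuousOn F (Icc (-α) α)) :
    ∫ t in (-α)..α, F t = (∫ t in {θ | θ ∈ Ioo (-α) α ∧ 0 < 1 * f θ}, F t) +
      ∫ t in {θ | θ ∈ Ioo (-α) α ∧ 0 < -1 * f θ}, F t := by
  have hZ := h.countable_zeros hE hD
  have hi : ∀ S : Set ℝ, S ⊆ Ioo (-α) α → MeasureTheory.IntegrableOn F S := fun S hS =>
    hF.integrableOn_Icc.mono_set (hS.trans Ioo_subset_Icc_self)
  have hU : Ioo (-α) α = ({θ | θ ∈ Ioo (-α) α ∧ 0 < 1 * f θ} ∪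
      {θ | θ ∈ Ioo (-α) α ∧ 0 < -1 * f θ}) ∪ {θ | θ ∈ Ioo (-α) α ∧ f θ = 0} := by
    ext θ
    simp only [mem_union, mem_ofPred_eq]
    rw [← and_or_left, ← and_or_left]
    refine (and_iff_left ?_).symm
    rcases lt_trichotomy (f θ) 0 with h1 | h1 | h1
    · exact Or.inl (Or.inr (by linarith))
    · exact Or.inr h1
    · exact Or.inl (Or.inl (by linarith))
  rw [intervalIntegral.integral_of_le (by linarith), MeasureTheory.integral_Ioc_eq_integral_Ioo]
  have hZm : MeasureTheory.volume {θ | θ ∈ Ioo (-α) α ∧ f θ = 0} = 0 := hZ.measure_zero _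
  conv_lhs => rw [hU]
  rw [MeasureTheory.setIntegral_congr_set
    (MeasureTheory.union_ae_eq_left_of_ae_eq_empty (MeasureTheory.ae_eq_empty.mpr hZm)),
    MeasureTheory.setIntegral_union _ (h.isOpen_sign (-1)).measurableSet
      (hi _ fun x hx => hx.1) (hi _ fun x hx => hx.1)]
  exact Set.disjoint_left.2 fun x hx hx' => by linarith [hx.2, hx'.2]

/-- Equating the two expressions for `E` and for `c` gives two linear equations for `a Q` and `b R`.
The strict part of admissibility of the negative hump becomes the saddle condition. -/
theorem HumpData.oscillating {E c a b Q R : ℝ} (ha : 0 < a) (hb : 0 < b) (h : HumpData E c a Q)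
    (h' : HumpData E c (-b) R) : Osc a b ∧ Q = plusQ a b ∧ R = minusQ a b := by
  have hab : 0 < a + b := add_pos ha hb
  have e1 : a * (a * Q) = b * (b * R) := by linarith [h.energy, h'.energy]
  have e2 : a * Q + b * R = (a + b) * (6 + a - b) := by linarith [h.const, h'.const]
  have hX : a * Q = b * (6 + a - b) := by
    refine mul_right_cancel₀ hab.ne' ?_
    linear_combination b * e2 + e1
  have hY : b * R = a * (6 + a - b) := by linarith
  have hQ : Q = plusQ a b := by
    rw [plusQ]; field_simp; linarith
  have hR : R = minusQ a b := by
    rw [minusQ]; field_simp; linarith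
  refine ⟨⟨ha, hb, ?_⟩, hQ, hR⟩
  have h2 := mul_pos hb h'.adm.2
  have h3 : b * (6 + 2 * -b + R) = (a + b) * (6 + a - 2 * b) := by linear_combination hY
  rw [h3] at h2
  linarith [pos_of_mul_pos_right h2 hab.le]

/-! ### Duration and flux equations for each type -/

theorem sign_set_one (α : ℝ) (f : ℝ → ℝ) :
    {θ | θ ∈ Ioo (-α) α ∧ 0 < 1 * f θ} = {θ | θ ∈ Ioo (-α) α ∧ 0 < f θ} := by
  simp only [one_mul]

theorem sign_set_neg_one (α : ℝ) (f : ℝ → ℝ) :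
    {θ | θ ∈ Ioo (-α) α ∧ 0 < -1 * f θ} = {θ | θ ∈ Ioo (-α) α ∧ f θ < 0} := by
  simp only [neg_one_mul, neg_pos]

theorem integral_one_symm {α : ℝ} : ∫ _ in (-α)..α, (1 : ℝ) = 2 * α := by
  simp
  ring

theorem ExistsProfile.params_one_zero {α Φ : ℝ} (hα₀ : 0 < α) (h : ExistsProfile α 1 0 Φ) :
    ∃ a Q, 0 < a ∧ Adm a Q ∧ humpTime a Q = 2 * α ∧ humpFlux a Q = Φ := by
  obtain ⟨f, g, c, hf, hΦ, hp, hm⟩ := h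
  obtain ⟨E, hE⟩ := hf.exists_energy
  rw [← sign_set_one] at hp
  rw [← sign_set_neg_one, Nat.cast_zero, numIntervals_eq_zero_iff] at hm
  obtain ⟨a, Q, ha, hD, hT, hF⟩ := hf.sign_humps hE (Or.inl rfl) one_ne_zero hp
  have i1 := hf.integral_split hα₀ hE hD (F := fun _ => 1) continuousOn_const
  have i2 := hf.integral_split hα₀ hE hD hf.continuousOn
  rw [hm, hT, integral_one_symm] at i1
  rw [hm, hF, hΦ] at i2
  refine ⟨a, Q, by linarith, hD.adm, ?_, ?_⟩
  · simp at i1; linarith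
  · simp at i2; linarith

theorem ExistsProfile.params_zero_one {α Φ : ℝ} (hα₀ : 0 < α) (h : ExistsProfile α 0 1 Φ) :
    ∃ b Q, 0 < b ∧ Adm (-b) Q ∧ humpTime (-b) Q = 2 * α ∧ humpFlux (-b) Q = Φ := by
  obtain ⟨f, g, c, hf, hΦ, hp, hm⟩ := h
  obtain ⟨E, hE⟩ := hf.exists_energy
  rw [← sign_set_one, Nat.cast_zero, numIntervals_eq_zero_iff] at hp
  rw [← sign_set_neg_one] at hm
  obtain ⟨a, Q, ha, hD, hT, hF⟩ := hf.sign_humps hE (Or.inr rfl) one_ne_zero hm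
  have i1 := hf.integral_split hα₀ hE hD (F := fun _ => 1) continuousOn_const
  have i2 := hf.integral_split hα₀ hE hD hf.continuousOn
  rw [hp, hT, integral_one_symm] at i1
  rw [hp, hF, hΦ] at i2
  refine ⟨-a, Q, by linarith, ?_, ?_, ?_⟩
  · rw [neg_neg]; exact hD.adm
  · rw [neg_neg]; simp at i1; linarith
  · rw [neg_neg]; simp at i2; linarith

theorem ExistsProfile.params_osc {α Φ : ℝ} (hα₀ : 0 < α) {mPlus mMinus : ℕ} (h1 : mPlus ≠ 0)
    (h2 : mMinus ≠ 0) (h : ExistsProfile α mPlus mMinus Φ) :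
    ∃ a b, Osc a b ∧
      mPlus * humpTime a (plusQ a b) + mMinus * humpTime (-b) (minusQ a b) = 2 * α ∧
      mPlus * humpFlux a (plusQ a b) + mMinus * humpFlux (-b) (minusQ a b) = Φ := by
  obtain ⟨f, g, c, hf, hΦ, hp, hm⟩ := h
  obtain ⟨E, hE⟩ := hf.exists_energy
  rw [← sign_set_one] at hp
  rw [← sign_set_neg_one] at hm
  obtain ⟨a, Q, ha, hD, hT, hF⟩ := hf.sign_humps hE (Or.inl rfl) h1 hp
  obtain ⟨b, R, hb, hD', hT', hF'⟩ := hf.sign_humps hE (Or.inr rfl) h2 hm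
  have i1 := hf.integral_split hα₀ hE hD (F := fun _ => 1) continuousOn_const
  have i2 := hf.integral_split hα₀ hE hD hf.continuousOn
  rw [hT, hT', integral_one_symm] at i1
  rw [hF, hF', hΦ] at i2
  have hD'' : HumpData E c (- -b) R := by rwa [neg_neg]
  obtain ⟨hO, hQ, hR⟩ := HumpData.oscillating (b := -b) (by linarith) (by linarith) hD hD''
  refine ⟨a, -b, hO, ?_, ?_⟩
  · rw [← hQ, ← hR, neg_neg, i1]
  · rw [← hQ, ← hR, neg_neg, i2]

/-! ### Existence of single humps -/

theorem integral_even {G : ℝ → ℝ} (hG : Continuous G) (he : ∀ y, G (-y) = G y) (x : ℝ) :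
    ∫ y in (-x)..x, G y = 2 * ∫ y in (0 : ℝ)..x, G y := by
  have h1 := intervalIntegral.integral_comp_neg (a := 0) (b := x) G
  simp only [he, neg_zero] at h1
  rw [← intervalIntegral.integral_add_adjacent_intervals (hG.intervalIntegrable (-x) 0)
    (hG.intervalIntegrable 0 x), ← h1]
  ring

/-- Writing `s = 1 - y ^ 2` removes the turning point at the maximum: the energy identity becomes
`y' = √(humpQuad a Q s / 6)` with a positive right side, and the hump is the passage of `y` from
`-1` to `1`. -/
theorem exists_hump_profile {α a Q : ℝ} (ha : a ≠ 0) (hQ : 0 < Q) (hA : Adm a Q)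
    (hT : humpTime a Q = 2 * α) : ∃ f g c, IsProfile α f g c ∧
      ∫ θ in (-α)..α, f θ = humpFlux a Q ∧ ∀ θ ∈ Ioo (-α) α, 0 < f θ / a := by
  -- Truncation keeps the height in `[0, 1]` for every `y`, so the speed is bounded and positive on
  -- the whole line. Where `S = 0` this uses `Q > 0`.
  set S : ℝ → ℝ := fun y => 1 - min 1 (y ^ 2) with hS
  have hS0 : ∀ y, 0 ≤ S y := fun y => sub_nonneg.2 (min_le_left _ _)
  have hS1 : ∀ y, S y ≤ 1 := fun y => sub_le_self _ (le_min zero_le_one (sq_nonneg y))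
  have hSin : ∀ y, y ^ 2 ≤ 1 → S y = 1 - y ^ 2 := fun y hy => by simp [hS, min_eq_right hy]
  have hqpos : ∀ y, 0 < humpQuad a Q (S y) := fun y => by
    rcases (hS0 y).eq_or_lt with h | h
    · rw [← h]; simpa [humpQuad] using hQ
    · exact humpQuad_pos hA h (hS1 y)
  set G : ℝ → ℝ := fun y => √(humpQuad a Q (S y) / 6) with hG
  have hGc : Continuous G := by
    simp only [hG, hS]; unfold humpQuad; fun_prop
  have hGpos : ∀ y, 0 < G y := fun y => Real.sqrt_pos.2 (div_pos (hqpos y) (by norm_num))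
  have hGle : ∀ y, G y ≤ √((Q + |6 + a| + |a|) / 6) := fun y => by
    refine Real.sqrt_le_sqrt (div_le_div_of_nonneg_right ?_ (by norm_num))
    rw [humpQuad]
    have h1 : (6 + a) * S y ≤ |6 + a| := (mul_le_mul_of_nonneg_right (le_abs_self _) (hS0 y)).trans
      (mul_le_of_le_one_right (abs_nonneg _) (hS1 y))
    have h2 : a * S y ^ 2 ≤ |a| :=
      (mul_le_mul_of_nonneg_right (le_abs_self _) (sq_nonneg (S y))).trans
      (mul_le_of_le_one_right (abs_nonneg _) (pow_le_one₀ (hS0 y) (hS1 y)))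
    linarith
  obtain ⟨y, hmono, hsurj, -, hy⟩ := exists_autonomous_solution hGc hGpos hGle
  obtain ⟨t₁, ht₁⟩ := hsurj (-1)
  obtain ⟨t₂, ht₂⟩ := hsurj 1
  have hmom : ∀ n : ℕ, ∫ t in t₁..t₂, S (y t) ^ n = humpMoment n a Q := by
    intro n
    have hSc : Continuous S := by fun_prop
    rw [integral_autonomous hGc hGpos hy (F := fun y => S y ^ n) (by fun_prop), ht₁, ht₂,
      integral_even (G := fun y => S y ^ n / G y) ((hSc.pow n).div hGc fun y => (hGpos y).ne')
        (by simp [hS, hG]), humpMoment]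
    have hsub := intervalIntegral.integral_comp_mul_deriv (a := 0) (b := Real.pi / 2)
      (g := fun y => S y ^ n / G y) (fun φ _ => Real.hasDerivAt_sin φ)
      Real.continuous_cos.continuousOn ((hSc.pow n).div hGc fun y => (hGpos y).ne')
    rw [Real.sin_zero, Real.sin_pi_div_two] at hsub
    rw [← hsub, mul_assoc 2, ← intervalIntegral.integral_const_mul √6]
    refine congrArg ((2 : ℝ) * ·) (intervalIntegral.integral_congr fun φ _ => ?_)
    have hs : S (Real.sin φ) = Real.cos φ ^ 2 := by
      rw [hSin _ (Real.sin_sq_le_one φ), Real.cos_sq']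
    have hq := hqpos (Real.sin φ)
    simp only [Function.comp, hG, humpWeight]
    rw [hs] at hq ⊢
    rw [Real.sqrt_div hq.le]
    have q1 := (Real.sqrt_pos.2 hq).ne'
    have q2 : √6 ≠ 0 := by positivity
    field_simp
  have htime : t₂ - t₁ = 2 * α := by
    have := hmom 0
    simp only [pow_zero, intervalIntegral.integral_const, smul_eq_mul, mul_one] at this
    rw [this, ← hT, humpTime]
  set Y : ℝ → ℝ := fun t => y (t + (t₁ + α)) with hY
  have hYd : ∀ t, HasDerivAt Y (G (Y t)) t := fun t => (hy _).comp_add_const t (t₁ + α)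
  have hYl : Y (-α) = -1 := by simp only [hY]; rw [← ht₁]; congr 1; ring
  have hYr : Y α = 1 := by simp only [hY]; rw [← ht₂]; congr 1; linarith
  have hYm : StrictMono Y := fun u v huv => hmono (by linarith)
  have hYin : ∀ t ∈ Ioo (-α) α, Y t ^ 2 < 1 := fun t ht => by
    have h1 := hYm ht.1
    have h2 := hYm ht.2
    rw [hYl] at h1
    rw [hYr] at h2
    nlinarith
  have hYcont : Continuous Y := continuous_iff_continuousAt.2 fun t => (hYd t).continuousAt
  have hpos : ∀ θ ∈ Ioo (-α) α, 0 < a * (1 - Y θ ^ 2) / a := fun θ hθ => by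
    rw [mul_div_cancel_left₀ _ ha]
    linarith [hYin θ hθ]
  refine ⟨fun t => a * (1 - Y t ^ 2), fun t => -2 * a * (Y t * √(humpQuad a Q (1 - Y t ^ 2) / 6)),
    -(a / 3) * (Q - 6 - a), ⟨?_, ?_, ?_, ?_, ?_⟩, ?_, hpos⟩
  · exact Continuous.continuousOn (by fun_prop)
  · simp [hYl]
  · simp [hYr]
  · intro t ht
    have h1 := hYd t
    simp only [hG, hSin _ (hYin t ht).le] at h1
    refine (((h1.pow 2).const_sub 1).const_mul a).congr_deriv ?_
    push_cast
    ring
  · intro t ht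
    have h1 := hYd t
    simp only [hG, hSin _ (hYin t ht).le] at h1
    have hq : 0 < humpQuad a Q (1 - Y t ^ 2) := by
      have := hqpos (Y t)
      rwa [hSin _ (hYin t ht).le] at this
    have hsd := (h1.pow 2).const_sub 1
    have hqd : HasDerivAt (fun s => humpQuad a Q s / 6) (((6 + a) + a * (2 * (1 - Y t ^ 2))) / 6)
        (1 - Y t ^ 2) := by
      unfold humpQuad
      have h2 := ((((hasDerivAt_id (1 - Y t ^ 2)).const_mul (6 + a)).const_add Q).add
        (((hasDerivAt_id (1 - Y t ^ 2)).pow 2).const_mul a)).div_const 6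
      refine h2.congr_deriv ?_
      simp
    have hr := (hqd.comp t hsd).sqrt (by simp only [Function.comp]; positivity)
    refine ((h1.mul hr).const_mul (-2 * a)).congr_deriv ?_
    simp only [Function.comp, Pi.pow_apply]
    set R := √(humpQuad a Q (1 - Y t ^ 2) / 6) with hR
    have hR2 : R * R = humpQuad a Q (1 - Y t ^ 2) / 6 := Real.mul_self_sqrt (by positivity)
    have hR0 : R ≠ 0 := (Real.sqrt_pos.2 (by positivity)).ne'
    push_cast
    have e : Y t * ((6 + a + a * (2 * (1 - Y t ^ 2))) / 6 * -(2 * Y t ^ (2 - 1) * R) / (2 * R)) =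
        -(Y t ^ 2 * (6 + a + a * (2 * (1 - Y t ^ 2))) / 6) := by
      rw [show (2 : ℕ) - 1 = 1 from rfl, pow_one]
      field_simp
    rw [e, hR2, humpQuad]
    ring
  · have h1 := hmom 1
    have h2 := intervalIntegral.integral_comp_add_right (a := -α) (b := α)
      (fun t => S (y t) ^ 1) (t₁ + α)
    rw [show -α + (t₁ + α) = t₁ by ring, show α + (t₁ + α) = t₂ by linarith, h1] at h2
    rw [humpFlux, ← h2, ← intervalIntegral.integral_const_mul]
    refine intervalIntegral.integral_congr fun t ht => ?_
    rw [uIcc_of_le (by linarith [humpTime_pos hA])] at ht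
    have h3 : Y t ^ 2 ≤ 1 := by
      have h4 := hYm.monotone ht.1
      have h5 := hYm.monotone ht.2
      rw [hYl] at h4
      rw [hYr] at h5
      nlinarith
    simp only [pow_one]
    rw [← hSin _ h3]

theorem existsProfile_one_zero {α a Q : ℝ} (hα₀ : 0 < α) (ha : 0 < a) (hQ : 0 < Q)
    (hT : humpTime a Q = 2 * α) : ExistsProfile α 1 0 (humpFlux a Q) := by
  obtain ⟨f, g, c, hp, hF, hpos⟩ := exists_hump_profile ha.ne' hQ ⟨hQ.le, by linarith⟩ hT
  have hpos' : ∀ θ ∈ Ioo (-α) α, 0 < f θ := fun θ hθ => by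
    have := mul_pos (hpos θ hθ) ha
    rwa [div_mul_cancel₀ _ ha.ne'] at this
  refine ⟨f, g, c, hp, hF, ?_, ?_⟩
  · have : {θ | θ ∈ Ioo (-α) α ∧ 0 < f θ} = Ioo (-α) α := by
      ext θ; exact ⟨fun h => h.1, fun h => ⟨h, hpos' θ h⟩⟩
    rw [this, numIntervals_of_isPreconnected isPreconnected_Ioo ⟨0, by linarith, hα₀⟩, Nat.cast_one]
  · rw [Nat.cast_zero, numIntervals_eq_zero_iff, eq_empty_iff_forall_notMem]
    exact fun θ hθ => (hpos' θ hθ.1).not_gt hθ.2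

theorem existsProfile_zero_one {α b Q : ℝ} (hα₀ : 0 < α) (hb : 0 < b) (hQ : 0 < Q)
    (hA : Adm (-b) Q) (hT : humpTime (-b) Q = 2 * α) :
    ExistsProfile α 0 1 (humpFlux (-b) Q) := by
  obtain ⟨f, g, c, hp, hF, hpos⟩ := exists_hump_profile (neg_ne_zero.2 hb.ne') hQ hA hT
  have hpos' : ∀ θ ∈ Ioo (-α) α, f θ < 0 := fun θ hθ => by
    have := mul_neg_of_pos_of_neg (hpos θ hθ) (neg_neg_of_pos hb)
    rwa [div_mul_cancel₀ _ (neg_ne_zero.2 hb.ne')] at this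
  refine ⟨f, g, c, hp, hF, ?_, ?_⟩
  · rw [Nat.cast_zero, numIntervals_eq_zero_iff, eq_empty_iff_forall_notMem]
    exact fun θ hθ => (hpos' θ hθ.1).not_gt hθ.2
  · have : {θ | θ ∈ Ioo (-α) α ∧ f θ < 0} = Ioo (-α) α := by
      ext θ; exact ⟨fun h => h.1, fun h => ⟨h, hpos' θ h⟩⟩
    rw [this, numIntervals_of_isPreconnected isPreconnected_Ioo ⟨0, by linarith, hα₀⟩, Nat.cast_one]

/-! ### Existence of oscillating profiles -/

/-- The nodes of an oscillating profile, in terms of the angle of the pendulum. -/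
noncomputable def nodeAngle (ζ : ℝ) (j : ℕ) : ℝ :=
  Real.pi * ((j / 2 : ℕ) : ℝ) + if Even j then -ζ else ζ

theorem nodeAngle_even (ζ : ℝ) (i : ℕ) : nodeAngle ζ (2 * i) = -ζ + i * Real.pi := by
  rw [nodeAngle, if_pos (even_two_mul i), Nat.mul_div_cancel_left i two_pos]
  ring

theorem nodeAngle_odd (ζ : ℝ) (i : ℕ) : nodeAngle ζ (2 * i + 1) = ζ + i * Real.pi := by
  rw [nodeAngle, if_neg (by simp), show (2 * i + 1) / 2 = i by omega]
  ring

theorem nodeAngle_even_succ (ζ : ℝ) (i : ℕ) :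
    nodeAngle ζ (2 * i + 1 + 1) = (Real.pi - ζ) + i * Real.pi := by
  rw [show 2 * i + 1 + 1 = 2 * (i + 1) by ring, nodeAngle_even]
  push_cast
  ring

theorem strictMono_nodeAngle {ζ : ℝ} (h₀ : 0 < ζ) (h₁ : ζ < Real.pi / 2) :
    StrictMono (nodeAngle ζ) := by
  refine strictMono_nat_of_lt_succ fun j => ?_
  obtain ⟨i, rfl | rfl⟩ := j.even_or_odd'
  · rw [nodeAngle_even, nodeAngle_odd]
    linarith
  · rw [nodeAngle_odd, nodeAngle_even_succ]
    linarith

theorem sin_sq_sub_sin_sq (x y : ℝ) :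
    Real.sin x ^ 2 - Real.sin y ^ 2 = Real.sin (x - y) * Real.sin (x + y) := by
  rw [Real.sin_sub, Real.sin_add]
  linear_combination (Real.sin x ^ 2) * (Real.sin_sq_add_cos_sq y).symm +
    (Real.sin y ^ 2) * (Real.sin_sq_add_cos_sq x)

theorem sin_sq_add_nat_mul_pi (x : ℝ) (i : ℕ) : Real.sin (x + i * Real.pi) ^ 2 = Real.sin x ^ 2 := by
  rw [Real.sin_add_nat_mul_pi, mul_pow, ← pow_mul, mul_comm i 2, pow_mul]
  simp

theorem sin_sq_nodeAngle (ζ : ℝ) (j : ℕ) : Real.sin (nodeAngle ζ j) ^ 2 = Real.sin ζ ^ 2 := by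
  obtain ⟨i, rfl | rfl⟩ := j.even_or_odd'
  · rw [nodeAngle_even, sin_sq_add_nat_mul_pi, Real.sin_neg, neg_sq]
  · rw [nodeAngle_odd, sin_sq_add_nat_mul_pi]

theorem sin_sq_lt_of_even {ζ x : ℝ} (h₁ : ζ < Real.pi / 2) {j : ℕ}
    (hj : Even j) (hx : x ∈ Ioo (nodeAngle ζ j) (nodeAngle ζ (j + 1))) :
    Real.sin x ^ 2 < Real.sin ζ ^ 2 := by
  obtain ⟨i, rfl⟩ := even_iff_exists_two_mul.1 hj
  rw [nodeAngle_even, nodeAngle_odd] at hx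
  obtain ⟨ψ, rfl⟩ : ∃ ψ, x = ψ + i * Real.pi := ⟨x - i * Real.pi, by ring⟩
  rw [sin_sq_add_nat_mul_pi, ← sub_neg, sin_sq_sub_sin_sq]
  have h2 : -ζ < ψ := by linarith [hx.1]
  have h3 : ψ < ζ := by linarith [hx.2]
  exact mul_neg_of_neg_of_pos (Real.sin_neg_of_neg_of_neg_pi_lt (by linarith) (by linarith))
    (Real.sin_pos_of_pos_of_lt_pi (by linarith) (by linarith))

theorem lt_sin_sq_of_not_even {ζ x : ℝ} (h₀ : 0 < ζ) {j : ℕ}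
    (hj : ¬Even j) (hx : x ∈ Ioo (nodeAngle ζ j) (nodeAngle ζ (j + 1))) :
    Real.sin ζ ^ 2 < Real.sin x ^ 2 := by
  obtain ⟨i, rfl⟩ := Nat.not_even_iff_odd.1 hj
  rw [nodeAngle_odd, nodeAngle_even_succ] at hx
  obtain ⟨ψ, rfl⟩ : ∃ ψ, x = ψ + i * Real.pi := ⟨x - i * Real.pi, by ring⟩
  rw [sin_sq_add_nat_mul_pi, ← sub_pos, sin_sq_sub_sin_sq]
  have h2 : ζ < ψ := by linarith [hx.1]
  have h3 : ψ < Real.pi - ζ := by linarith [hx.2]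
  exact mul_pos (Real.sin_pos_of_pos_of_lt_pi (by linarith) (by linarith))
    (Real.sin_pos_of_pos_of_lt_pi (by linarith) (by linarith))

theorem integral_nodeAngle_even {H : ℝ → ℝ} (hH : Continuous H)
    (he : ∀ x, H (-x) = H x) (hp : Function.Periodic H Real.pi) (ζ : ℝ) {j : ℕ} (hj : Even j) :
    ∫ x in (nodeAngle ζ j)..(nodeAngle ζ (j + 1)), H x = 2 * ∫ x in (0 : ℝ)..ζ, H x := by
  obtain ⟨i, rfl⟩ := even_iff_exists_two_mul.1 hj
  rw [nodeAngle_even, nodeAngle_odd, ← intervalIntegral.integral_comp_add_right,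
    ← integral_even hH he]
  exact intervalIntegral.integral_congr fun x _ => hp.nat_mul i x

theorem integral_nodeAngle_odd {H : ℝ → ℝ} (hH : Continuous H)
    (he : ∀ x, H (-x) = H x) (hp : Function.Periodic H Real.pi) (ζ : ℝ) {j : ℕ} (hj : ¬Even j) :
    ∫ x in (nodeAngle ζ j)..(nodeAngle ζ (j + 1)), H x =
      2 * ∫ x in ζ..(Real.pi / 2), H x := by
  obtain ⟨i, rfl⟩ := Nat.not_even_iff_odd.1 hj
  rw [nodeAngle_odd, nodeAngle_even_succ, ← intervalIntegral.integral_comp_add_right]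
  have h1 : ∫ x in ζ..(Real.pi - ζ), H (x + i * Real.pi) = ∫ x in ζ..(Real.pi - ζ), H x :=
    intervalIntegral.integral_congr fun x _ => hp.nat_mul i x
  have h2 := intervalIntegral.integral_comp_sub_left (a := ζ) (b := Real.pi / 2) H Real.pi
  have h3 : ∫ x in ζ..(Real.pi / 2), H (Real.pi - x) = ∫ x in ζ..(Real.pi / 2), H x :=
    intervalIntegral.integral_congr fun x _ => by
      show H (Real.pi - x) = H x
      rw [← he, neg_sub, hp.sub_eq]
  rw [h1, ← intervalIntegral.integral_add_adjacent_intervals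
    (hH.intervalIntegrable ζ (Real.pi / 2)) (hH.intervalIntegrable (Real.pi / 2) (Real.pi - ζ)),
    two_mul]
  rw [h3, show Real.pi - Real.pi / 2 = Real.pi / 2 by ring] at h2
  rw [h2]

theorem card_filter_even_Ico {p q : ℕ} (hpq : p ≤ q) :
    ((Finset.Ico p q).filter Even).card + (p + 1) / 2 = (q + 1) / 2 ∧
      ((Finset.Ico p q).filter fun j => ¬Even j).card + p / 2 = q / 2 := by
  induction q, hpq using Nat.le_induction with
  | base => simp
  | succ q hq ih =>
    rw [← Finset.insert_Ico_right_eq_Ico_add_one hq, Finset.filter_insert, Finset.filter_insert]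
    by_cases h : Even q
    · rw [if_pos h, if_neg (not_not.2 h), Finset.card_insert_of_notMem (by simp)]
      obtain ⟨i, rfl⟩ := h
      omega
    · rw [if_neg h, if_pos h, Finset.card_insert_of_notMem (by simp)]
      obtain ⟨i, rfl⟩ := Nat.not_even_iff_odd.1 h
      omega

/-- Even gaps between nodes carry positive humps and odd gaps negative ones. A window starting at
`0` begins with a positive hump, one starting at `1` with a negative hump, and alternation produces
every pair of counts differing by at most one. -/
theorem exists_parity_window {mPlus mMinus : ℕ} (hm : |(mPlus : ℤ) - mMinus| ≤ 1) :
    ∃ p, ((Finset.Ico p (p + (mPlus + mMinus))).filter Even).card = mPlus ∧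
      ((Finset.Ico p (p + (mPlus + mMinus))).filter fun j => ¬Even j).card = mMinus := by
  rw [abs_le] at hm
  by_cases h : mMinus ≤ mPlus
  · have := card_filter_even_Ico (Nat.le_add_right 0 (mPlus + mMinus))
    exact ⟨0, by omega, by omega⟩
  · have := card_filter_even_Ico (Nat.le_add_right 1 (mPlus + mMinus))
    exact ⟨1, by omega, by omega⟩

/-- A function changing its sign exactly at the nodes of a grid. -/
theorem numIntervals_alternating {x : ℕ → ℝ} (hx : StrictMono x) {p q : ℕ}
    {P : ℝ → Prop} {E : ℕ → Prop} [DecidablePred E] (hnode : ∀ j, ¬P (x j))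
    (hE : ∀ j, E j → ∀ θ ∈ Ioo (x j) (x (j + 1)), P θ)
    (hE' : ∀ j, ¬E j → ∀ θ ∈ Ioo (x j) (x (j + 1)), ¬P θ) :
    numIntervals {θ | θ ∈ Ioo (x p) (x q) ∧ P θ} = (((Finset.Ico p q).filter E).card : ℕ∞) := by
  rw [← numIntervals_biUnion_Ioo hx]
  congr 1
  ext θ
  simp only [mem_iUnion, Finset.mem_filter, Finset.mem_Ico, exists_prop]
  constructor
  · rintro ⟨hθ, hP⟩
    have h1 : θ ∈ Ioc (x p) (x q) := ⟨hθ.1, hθ.2.le⟩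
    rw [← hx.monotone.biUnion_Ico_Ioc_map_succ] at h1
    simp only [mem_iUnion, mem_Ico, exists_prop] at h1
    obtain ⟨j, hj, h2⟩ := h1
    have h3 : θ ∈ Ioo (x j) (x (j + 1)) := ⟨h2.1, lt_of_le_of_ne h2.2 fun h => hnode (j + 1) (h ▸ hP)⟩
    exact ⟨j, ⟨hj, by_contra fun h => hE' j h θ h3 hP⟩, h3⟩
  · rintro ⟨j, ⟨hj, hEj⟩, hθ⟩
    exact ⟨⟨(hx.monotone hj.1).trans_lt hθ.1, hθ.2.trans_le (hx.monotone hj.2)⟩, hE j hEj θ hθ⟩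

theorem integral_nodeAngle_window {H : ℝ → ℝ} (hH : Continuous H)
    (he : ∀ x, H (-x) = H x) (hp : Function.Periodic H Real.pi) (ζ : ℝ) {p q : ℕ} (hpq : p ≤ q) :
    ∫ x in (nodeAngle ζ p)..(nodeAngle ζ q), H x =
      ((Finset.Ico p q).filter Even).card * (2 * ∫ x in (0 : ℝ)..ζ, H x) +
      ((Finset.Ico p q).filter fun j => ¬Even j).card * (2 * ∫ x in ζ..(Real.pi / 2), H x) := by
  rw [← intervalIntegral.sum_integral_adjacent_intervals_Ico hpq
    fun _ _ => hH.intervalIntegrable _ _, ← Finset.sum_filter_add_sum_filter_not _ Even]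
  rw [Finset.sum_congr rfl fun j hj =>
    integral_nodeAngle_even hH he hp ζ (Finset.mem_filter.1 hj).2,
    Finset.sum_congr rfl fun j hj => integral_nodeAngle_odd hH he hp ζ (Finset.mem_filter.1 hj).2]
  simp

/-- The profile is `a - (a + b) sin Y ^ 2` with `Y' = √(pendSq .. / 6)`, a pendulum rotating without
turning points. Its zeros are the node angles, and `Y` is run from one node to another; the duration
equation says that this takes time `2 α`. -/
theorem existsProfile_of_osc {α a b : ℝ} (h : Osc a b) {mPlus mMinus : ℕ}
    (hm : |(mPlus : ℤ) - mMinus| ≤ 1)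
    (hT : mPlus * humpTime a (plusQ a b) + mMinus * humpTime (-b) (minusQ a b) = 2 * α) :
    ExistsProfile α mPlus mMinus
      (mPlus * humpFlux a (plusQ a b) + mMinus * humpFlux (-b) (minusQ a b)) := by
  have ha := h.pos_left
  have hb := h.pos_right
  have hd : 0 < a + b := by positivity
  have hpend : ∀ ϕ, 0 < pendSq a b (Real.sin ϕ ^ 2) := fun ϕ =>
    pendSq_pos hd.le h.saddle (Real.sin_sq_le_one ϕ)
  set G : ℝ → ℝ := fun ϕ => √(pendSq a b (Real.sin ϕ ^ 2) / 6) with hG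
  have hGc : Continuous G := by simp only [hG]; unfold pendSq; fun_prop
  have hGpos : ∀ ϕ, 0 < G ϕ := fun ϕ => Real.sqrt_pos.2 (div_pos (hpend ϕ) (by norm_num))
  have hGle : ∀ ϕ, G ϕ ≤ √((6 + 2 * a - b) / 6) := fun ϕ => by
    refine Real.sqrt_le_sqrt (div_le_div_of_nonneg_right ?_ (by norm_num))
    rw [pendSq]
    linarith [mul_nonneg hd.le (sq_nonneg (Real.sin ϕ))]
  obtain ⟨y, hmono, hsurj, -, hy⟩ := exists_autonomous_solution hGc hGpos hGle
  set ζ := zeroAngle a b with hζ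
  have hσ := h.sigma_mem
  have hsqrt1 : √(a / (a + b)) < 1 := (Real.sqrt_lt' one_pos).2 (by simpa using hσ.2)
  have hζ₀ : 0 < ζ := Real.arcsin_pos.2 (Real.sqrt_pos.2 hσ.1)
  have hζ₁ : ζ < Real.pi / 2 := Real.arcsin_lt_pi_div_two.2 hsqrt1
  have hsinζ : (a + b) * Real.sin ζ ^ 2 = a := by
    rw [hζ, zeroAngle, Real.sin_arcsin (by linarith [Real.sqrt_nonneg (a / (a + b))]) hsqrt1.le,
      Real.sq_sqrt hσ.1.le]
    field_simp
  choose t ht using fun j => hsurj (nodeAngle ζ j)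
  have htm : StrictMono t := fun i j hij =>
    hmono.lt_iff_lt.1 (by rw [ht, ht]; exact strictMono_nodeAngle hζ₀ hζ₁ hij)
  obtain ⟨p, hpP, hpM⟩ := exists_parity_window hm
  set q := p + (mPlus + mMinus) with hq
  have hpq : p ≤ q := Nat.le_add_right _ _
  have hint : ∀ w : ℝ → ℝ, Continuous w →
      ∫ s in (t p)..(t q), w (a - (a + b) * Real.sin (y s) ^ 2) =
        mPlus * (2 * √6 * ∫ φ in (0 : ℝ)..(Real.pi / 2),
          w (a * Real.cos φ ^ 2) * humpWeight a (plusQ a b) φ) +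
        mMinus * (2 * √6 * ∫ φ in (0 : ℝ)..(Real.pi / 2),
          w (-b * Real.cos φ ^ 2) * humpWeight (-b) (minusQ a b) φ) := by
    intro w hw
    set H : ℝ → ℝ := fun ϕ =>
      √6 * (w (a - (a + b) * Real.sin ϕ ^ 2) / √(pendSq a b (Real.sin ϕ ^ 2))) with hH
    have hHc : Continuous H := continuous_const.mul (continuous_pendIntegrand hd.le h.saddle hw)
    rw [integral_autonomous hGc hGpos hy (F := fun ϕ => w (a - (a + b) * Real.sin ϕ ^ 2))
      (by fun_prop), ht, ht]
    have h1 : ∀ ϕ, w (a - (a + b) * Real.sin ϕ ^ 2) / G ϕ = H ϕ := fun ϕ => by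
      simp only [hG, hH]
      rw [Real.sqrt_div (hpend ϕ).le]
      have q1 := (Real.sqrt_pos.2 (hpend ϕ)).ne'
      have q2 : √6 ≠ 0 := by positivity
      field_simp
    simp only [h1]
    rw [integral_nodeAngle_window hHc (fun x => by simp [hH]) (fun x => by simp [hH]) ζ hpq,
      hpP, hpM]
    simp only [hH]
    rw [intervalIntegral.integral_const_mul, intervalIntegral.integral_const_mul,
      h.integral_plus hw, h.integral_minus hw]
    ring
  have htime : t q - t p = 2 * α := by
    have := hint (fun _ => 1) continuous_const
    simp only [intervalIntegral.integral_const, smul_eq_mul, mul_one, one_mul] at this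
    rw [this, ← hT]
    simp [humpTime, humpMoment]
  have hflux : ∫ s in (t p)..(t q), (a - (a + b) * Real.sin (y s) ^ 2) =
      mPlus * humpFlux a (plusQ a b) + mMinus * humpFlux (-b) (minusQ a b) := by
    have := hint (fun s => s) continuous_id
    rw [this]
    simp only [humpFlux, humpMoment, pow_one, mul_assoc, intervalIntegral.integral_const_mul]
    ring
  set Y : ℝ → ℝ := fun s => y (s + (t p + α)) with hY
  have hYd : ∀ s, HasDerivAt Y (G (Y s)) s := fun s => (hy _).comp_add_const s (t p + α)
  have hYm : StrictMono Y := fun u v huv => hmono (by linarith)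
  have hYcont : Continuous Y := continuous_iff_continuousAt.2 fun s => (hYd s).continuousAt
  -- Times are shifted so that the window of nodes from `p` to `q` occupies exactly `[-α, α]`.
  set x : ℕ → ℝ := fun j => t j - (t p + α) with hx
  have hxm : StrictMono x := fun i j hij => sub_lt_sub_right (htm hij) _
  have hYx : ∀ j, Y (x j) = nodeAngle ζ j := fun j => by simp only [hY, hx, sub_add_cancel, ht]
  have hxp : x p = -α := by simp only [hx]; ring
  have hxq : x q = α := by simp only [hx]; linarith
  set f : ℝ → ℝ := fun s => a - (a + b) * Real.sin (Y s) ^ 2 with hf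
  have hfnode : ∀ j, f (x j) = 0 := fun j => by
    simp only [hf]
    rw [hYx, sin_sq_nodeAngle, hsinζ, sub_self]
  have hmem : ∀ j, ∀ θ ∈ Ioo (x j) (x (j + 1)),
      Y θ ∈ Ioo (nodeAngle ζ j) (nodeAngle ζ (j + 1)) := fun j θ hθ =>
    ⟨hYx j ▸ hYm hθ.1, hYx (j + 1) ▸ hYm hθ.2⟩
  have hfpos : ∀ j, Even j → ∀ θ ∈ Ioo (x j) (x (j + 1)), 0 < f θ := fun j hj θ hθ => by
    have := mul_lt_mul_of_pos_left (sin_sq_lt_of_even hζ₁ hj (hmem j θ hθ)) hd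
    simp only [hf]
    linarith
  have hfneg : ∀ j, ¬Even j → ∀ θ ∈ Ioo (x j) (x (j + 1)), f θ < 0 := fun j hj θ hθ => by
    have := mul_lt_mul_of_pos_left (lt_sin_sq_of_not_even hζ₀ hj (hmem j θ hθ)) hd
    simp only [hf]
    linarith
  refine ⟨f, fun s => -2 * (a + b) * (Real.sin (Y s) * Real.cos (Y s) * G (Y s)),
    4 * a + a ^ 2 - (a + b) * (6 + 2 * a - b) / 3, ⟨?_, ?_, ?_, ?_, ?_⟩, ?_, ?_, ?_⟩
  · exact Continuous.continuousOn (by fun_prop)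
  · rw [← hxp, hfnode]
  · rw [← hxq, hfnode]
  · intro s hs
    refine ((((hYd s).sin.pow 2).const_mul (a + b)).const_sub a).congr_deriv ?_
    push_cast
    ring
  · intro s hs
    have hsd := (hYd s).sin
    have hcd := (hYd s).cos
    have hpd : HasDerivAt (fun s => pendSq a b (Real.sin (Y s) ^ 2) / 6)
        (-(a + b) * (2 * Real.sin (Y s) * (Real.cos (Y s) * G (Y s))) / 6) s := by
      unfold pendSq
      refine ((((hsd.pow 2).const_mul (a + b)).const_sub (6 + 2 * a - b)).div_const 6).congr_deriv ?_
      push_cast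
      ring
    have hGd := hpd.sqrt (by have := hpend (Y s); positivity)
    have hG2 : G (Y s) * G (Y s) = pendSq a b (Real.sin (Y s) ^ 2) / 6 :=
      Real.mul_self_sqrt (by have := hpend (Y s); positivity)
    have hG0 := (hGpos (Y s)).ne'
    have e : -(a + b) * (2 * Real.sin (Y s) * (Real.cos (Y s) * G (Y s))) / 6 / (2 * G (Y s)) =
        -(a + b) * (Real.sin (Y s) * Real.cos (Y s)) / 6 := by
      field_simp
    refine ((((hsd.mul hcd).mul hGd).const_mul (-2 * (a + b)))).congr_deriv ?_
    change -2 * (a + b) * ((_ * _ + _ * _) * G (Y s) +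
      Real.sin (Y s) * Real.cos (Y s) * (_ / (2 * G (Y s)))) = _
    rw [e]
    rw [pendSq] at hG2
    have hc : Real.cos (Y s) ^ 2 = 1 - Real.sin (Y s) ^ 2 := Real.cos_sq' _
    simp only [hf]
    generalize Real.sin (Y s) = S at *
    generalize Real.cos (Y s) = C at *
    generalize G (Y s) = g at *
    linear_combination (-2 * (a + b) * (C ^ 2 - S ^ 2)) * hG2 +
      (-2 * (a + b) * ((6 + 2 * a - b - (a + b) * S ^ 2) / 6) + (a + b) ^ 2 * S ^ 2 / 3) * hc
  · have h2 := intervalIntegral.integral_comp_add_right (a := -α) (b := α)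
      (fun s => a - (a + b) * Real.sin (y s) ^ 2) (t p + α)
    rw [show -α + (t p + α) = t p by ring, show α + (t p + α) = t q by linarith, hflux] at h2
    exact h2
  · rw [← hpP, ← hxp, ← hxq]
    exact numIntervals_alternating hxm (fun j => by rw [hfnode]; exact lt_irrefl 0) hfpos
      fun j hj θ hθ => (hfneg j hj θ hθ).not_gt
  · rw [← hpM, ← hxp, ← hxq]
    exact numIntervals_alternating hxm (fun j => by rw [hfnode]; exact lt_irrefl 0) hfneg
      fun j hj θ hθ => (hfpos j (not_not.1 hj) θ hθ).not_gt

/-! ### Level curves -/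

/-- A family of strictly decreasing continuous functions `τ x` on intervals, depending continuously
on the parameter `x`. -/
structure IsDecreasingFamily (D : Set (ℝ × ℝ)) (τ : ℝ → ℝ → ℝ) : Prop where
  continuousOn : ContinuousOn (fun p : ℝ × ℝ => τ p.1 p.2) D
  anti : ∀ x y y', (x, y) ∈ D → (x, y') ∈ D → y < y' → τ x y' < τ x y
  ordConnected : ∀ x, OrdConnected {y | (x, y) ∈ D}
  eventually_mem : ∀ x y, (x, y) ∈ D → ∀ᶠ x' in nhds x, (x', y) ∈ D
  exists_gt : ∀ x y, (x, y) ∈ D → ∃ y' > y, (x, y') ∈ D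
  exists_lt_or : ∀ x y, (x, y) ∈ D → (∃ y' < y, (x, y') ∈ D) ∨ ∀ p ∈ D, y ≤ p.2

/-- The parameters for which the value `κ` is attained. -/
def levelParams (D : Set (ℝ × ℝ)) (τ : ℝ → ℝ → ℝ) (κ : ℝ) : Set ℝ :=
  {x | ∃ y, (x, y) ∈ D ∧ τ x y = κ}

namespace IsDecreasingFamily

variable {D : Set (ℝ × ℝ)} {τ : ℝ → ℝ → ℝ}

theorem continuousAt_left (h : IsDecreasingFamily D τ) {x y : ℝ} (hxy : (x, y) ∈ D) :
    ContinuousAt (fun x' => τ x' y) x := by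
  have h1 : ContinuousWithinAt (fun x' => τ x' y) {x' | (x', y) ∈ D} x :=
    ContinuousWithinAt.comp (f := fun x' : ℝ => (x', y)) (h.continuousOn (x, y) hxy)
      (by fun_prop) fun x' hx' => hx'
  exact h1.continuousAt (h.eventually_mem x y hxy)

theorem continuousOn_right (h : IsDecreasingFamily D τ) (x : ℝ) :
    ContinuousOn (τ x) {y | (x, y) ∈ D} :=
  ContinuousOn.comp (f := fun y : ℝ => (x, y)) h.continuousOn (by fun_prop) fun _ hy => hy

theorem mem_levelParams (h : IsDecreasingFamily D τ) {κ x y₁ y₂ : ℝ} (h₁ : (x, y₁) ∈ D)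
    (h₂ : (x, y₂) ∈ D) (hτ₁ : κ ≤ τ x y₁) (hτ₂ : τ x y₂ ≤ κ) : x ∈ levelParams D τ κ := by
  have := (h.ordConnected x).isPreconnected.intermediate_value h₂ h₁ (h.continuousOn_right x)
  obtain ⟨y, hy, hyκ⟩ := this ⟨hτ₂, hτ₁⟩
  exact ⟨y, hy, hyκ⟩

theorem eq_of_eq (h : IsDecreasingFamily D τ) {x y y' : ℝ} (hy : (x, y) ∈ D) (hy' : (x, y') ∈ D)
    (he : τ x y = τ x y') : y = y' := by
  rcases lt_trichotomy y y' with hlt | heq | hlt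
  · exact absurd he (h.anti x y y' hy hy' hlt).ne'
  · exact heq
  · exact absurd he (h.anti x y' y hy' hy hlt).ne

/-- Strict monotonicity in `y` makes the level point unique. For continuity the level point is
compared with a fixed `z` slightly above or below it, where only continuity of `τ` in the parameter
is needed; below a point on the lower edge of `D` there is nothing to check. -/
theorem exists_level_function (h : IsDecreasingFamily D τ) (κ : ℝ) :
    ∃ Y : ℝ → ℝ, ContinuousOn Y (levelParams D τ κ) ∧
      ∀ x ∈ levelParams D τ κ, (x, Y x) ∈ D ∧ τ x (Y x) = κ := by
  classical
  have hchoice : ∀ x, ∃ y, x ∈ levelParams D τ κ → (x, y) ∈ D ∧ τ x y = κ := fun x => by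
    by_cases hx : x ∈ levelParams D τ κ
    · obtain ⟨y, hy⟩ := hx
      exact ⟨y, fun _ => hy⟩
    · exact ⟨0, fun hx' => absurd hx' hx⟩
  choose Y hY using hchoice
  refine ⟨Y, fun x hx => ?_, hY⟩
  obtain ⟨hD, hκ⟩ := hY x hx
  refine tendsto_order.2 ⟨fun y hy => ?_, fun y hy => ?_⟩
  · rcases h.exists_lt_or x _ hD with ⟨y₁, hy₁, hD₁⟩ | hmin
    · set z := max y y₁ with hz
      have hzY : z < Y x := max_lt hy hy₁
      have hzD : (x, z) ∈ D := (h.ordConnected x).out hD₁ hD ⟨le_max_right _ _, hzY.le⟩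
      have hlt : κ < τ x z := hκ ▸ h.anti x z (Y x) hzD hD hzY
      filter_upwards [((h.continuousAt_left hzD).eventually (lt_mem_nhds hlt)).filter_mono
        nhdsWithin_le_nhds, (h.eventually_mem x z hzD).filter_mono nhdsWithin_le_nhds,
        self_mem_nhdsWithin] with x' hx' hmem hI
      obtain ⟨hD', hκ'⟩ := hY x' hI
      refine (le_max_left y y₁).trans_lt (lt_of_not_ge fun hle => ?_)
      rcases hle.eq_or_lt with heq | hlt'
      · rw [heq, ← hz] at hκ'
        exact hx'.ne' hκ'
      · exact (hx'.trans (h.anti x' _ _ hD' hmem hlt')).ne' hκ'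
    · filter_upwards [self_mem_nhdsWithin] with x' hI
      exact hy.trans_le (hmin _ (hY x' hI).1)
  · obtain ⟨y₁, hy₁, hD₁⟩ := h.exists_gt x _ hD
    set z := min y y₁ with hz
    have hzY : Y x < z := lt_min hy hy₁
    have hzD : (x, z) ∈ D := (h.ordConnected x).out hD hD₁ ⟨hzY.le, min_le_right _ _⟩
    have hlt : τ x z < κ := hκ ▸ h.anti x (Y x) z hD hzD hzY
    filter_upwards [((h.continuousAt_left hzD).eventually (gt_mem_nhds hlt)).filter_mono
      nhdsWithin_le_nhds, (h.eventually_mem x z hzD).filter_mono nhdsWithin_le_nhds,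
      self_mem_nhdsWithin] with x' hx' hmem hI
    obtain ⟨hD', hκ'⟩ := hY x' hI
    refine (lt_of_not_ge fun hle => ?_ : Y x' < z).trans_le (min_le_left y y₁)
    rcases hle.eq_or_lt with heq | hlt'
    · rw [← heq] at hκ'
      exact hx'.ne hκ'
    · exact ((h.anti x' _ _ hmem hD' hlt').trans hx').ne hκ'

/-- The values of a continuous function on a connected level curve form an interval, up to its end
points. -/
theorem exists_threshold (h : IsDecreasingFamily D τ) {κ : ℝ} {F : ℝ → ℝ → ℝ}
    (hF : ContinuousOn (fun p : ℝ × ℝ => F p.1 p.2) D) (hI : OrdConnected (levelParams D τ κ))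
    {E : ℝ → Prop} (hE : ∀ Φ, E Φ → ∃ x y, (x, y) ∈ D ∧ τ x y = κ ∧ F x y = Φ)
    (hE' : ∀ x y, (x, y) ∈ D → τ x y = κ → (∃ x₁ ∈ levelParams D τ κ, x₁ < x) →
      (∃ x₂ ∈ levelParams D τ κ, x < x₂) → E (F x y))
    {C : ℝ} (hC : ∀ x y, (x, y) ∈ D → τ x y = κ → F x y ≤ C) :
    ∃ Φmax, (∀ x y, (x, y) ∈ D → τ x y = κ → F x y ≤ Φmax) ∧
      (∀ Φ, Φ < Φmax → (∃ x y, (x, y) ∈ D ∧ τ x y = κ ∧ F x y < Φ) → E Φ) ∧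
      ∀ Φ, Φmax < Φ → ¬E Φ := by
  obtain ⟨Y, hYc, hY⟩ := h.exists_level_function κ
  set S : Set ℝ := (fun x => F x (Y x)) '' levelParams D τ κ with hS
  have hYeq : ∀ x y, (x, y) ∈ D → τ x y = κ → y = Y x := fun x y hD hκ =>
    h.eq_of_eq hD (hY x ⟨y, hD, hκ⟩).1 (hκ.trans (hY x ⟨y, hD, hκ⟩).2.symm)
  have hcont : ContinuousOn (fun x => F x (Y x)) (levelParams D τ κ) :=
    ContinuousOn.comp (f := fun x : ℝ => (x, Y x)) hF (continuousOn_id.prodMk hYc)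
      fun x hx => (hY x hx).1
  have hbdd : BddAbove S := ⟨C, by
    rintro _ ⟨x, hx, rfl⟩
    exact hC x (Y x) (hY x hx).1 (hY x hx).2⟩
  have hle : ∀ x y, (x, y) ∈ D → τ x y = κ → F x y ≤ sSup S := fun x y hD hκ => by
    rw [hYeq x y hD hκ]
    exact le_csSup hbdd ⟨x, ⟨y, hD, hκ⟩, rfl⟩
  refine ⟨sSup S, hle, fun Φ hΦ hlow => ?_, fun Φ hΦ hEΦ => ?_⟩
  · obtain ⟨x₁, y₁, hD₁, hκ₁, hF₁⟩ := hlow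
    have hx₁ : x₁ ∈ levelParams D τ κ := ⟨y₁, hD₁, hκ₁⟩
    rw [hYeq x₁ y₁ hD₁ hκ₁] at hF₁
    obtain ⟨_, ⟨x₂, hx₂, rfl⟩, hF₂⟩ := exists_lt_of_lt_csSup (s := S) ⟨_, x₁, hx₁, rfl⟩ hΦ
    have hsub : uIcc x₁ x₂ ⊆ levelParams D τ κ := hI.uIcc_subset hx₁ hx₂
    obtain ⟨x, hx, hxΦ⟩ := intermediate_value_uIcc (hcont.mono hsub)
      (mem_uIcc_of_le hF₁.le hF₂.le)
    -- The flux at `x` differs from the fluxes at `x₁` and `x₂`, so `x` is interior to the projected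
    -- level curve. Existence is required there only, as a single-hump curve may end at the
    -- degenerate value `Q = 0`.
    have hne₁ : x ≠ x₁ := by
      rintro rfl
      exact hF₁.ne hxΦ
    have hne₂ : x ≠ x₂ := by
      rintro rfl
      exact hF₂.ne' hxΦ
    rw [← hxΦ]
    have hxD := hY x (hsub hx)
    rcases le_total x₁ x₂ with hle' | hle'
    · rw [uIcc_of_le hle'] at hx
      exact hE' _ _ hxD.1 hxD.2 ⟨x₁, hx₁, lt_of_le_of_ne hx.1 hne₁.symm⟩
        ⟨x₂, hx₂, lt_of_le_of_ne hx.2 hne₂⟩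
    · rw [uIcc_of_ge hle'] at hx
      exact hE' _ _ hxD.1 hxD.2 ⟨x₂, hx₂, lt_of_le_of_ne hx.1 hne₂.symm⟩
        ⟨x₁, hx₁, lt_of_le_of_ne hx.2 hne₁⟩
  · obtain ⟨x, y, hD, hκ, rfl⟩ := hE Φ hEΦ
    exact (hle x y hD hκ).not_gt hΦ

end IsDecreasingFamily

/-! ### Single humps -/

theorem humpTime_le_pi_of_pos {a Q : ℝ} (ha : 0 < a) (hQ : 0 ≤ Q) :
    humpTime a Q ≤ Real.pi * √6 / √(6 + a) := by
  refine humpTime_le_of_le ⟨hQ, by linarith⟩ (by linarith) fun s hs => ?_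
  rw [humpQuad]
  linarith [mul_nonneg ha.le (sq_nonneg s)]

theorem humpTime_lt_pi {a Q : ℝ} (ha : 0 < a) (hQ : 0 ≤ Q) : humpTime a Q < Real.pi := by
  refine (humpTime_le_pi_of_pos ha hQ).trans_lt ?_
  rw [div_lt_iff₀ (Real.sqrt_pos.2 (by linarith))]
  exact mul_lt_mul_of_pos_left (Real.sqrt_lt_sqrt (by norm_num) (by linarith)) Real.pi_pos

theorem isDecreasingFamily_one_zero :
    IsDecreasingFamily {p | 0 < p.1 ∧ 0 ≤ p.2} humpTime where
  continuousOn := (continuousOn_humpMoment 0).mono fun p hp => ⟨hp.2, by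
    linarith [show 0 < p.1 from hp.1, show 0 ≤ p.2 from hp.2]⟩
  anti x y y' h _ hlt := humpTime_lt_of_lt_right
    ⟨h.2, by linarith [show 0 < x from h.1, show 0 ≤ y from h.2]⟩ hlt
  ordConnected x := ⟨fun y hy _ _ _ hz => ⟨hy.1, le_trans hy.2 hz.1⟩⟩
  eventually_mem x y h := (lt_mem_nhds h.1).mono fun x' hx' => ⟨hx', h.2⟩
  exists_gt x y h := ⟨y + 1, by simp, h.1, by linarith [show 0 ≤ y from h.2]⟩
  exists_lt_or x y h := by
    rcases (show 0 ≤ y from h.2).eq_or_lt with h0 | h0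
    · exact Or.inr fun p hp => h0 ▸ hp.2
    · exact Or.inl ⟨0, h0, h.1, le_rfl⟩

theorem continuousOn_humpFlux : ContinuousOn (fun p : ℝ × ℝ => humpFlux p.1 p.2)
    {p | Adm p.1 p.2} :=
  continuousOn_fst.mul (continuousOn_humpMoment 1)

theorem exists_humpTime_le {a κ : ℝ} (hκ : 0 < κ) :
    ∃ Q₀, ∀ Q, Q₀ ≤ Q → Adm a Q ∧ humpTime a Q ≤ κ := by
  -- Chosen so that `2 √6 / √K = κ`.
  set K := 24 / κ ^ 2 with hK
  have hK0 : 0 < K := by positivity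
  refine ⟨K + 6 + 3 * |a|, fun Q hQ => ?_⟩
  have h1 := neg_abs_le a
  have h2 := abs_nonneg a
  have hA : Adm a Q := ⟨by linarith, by linarith⟩
  refine ⟨hA, (humpTime_le_of_const_le hA hK0 fun s hs => ?_).trans ?_⟩
  · rw [humpQuad]
    have h3 : -|a| ≤ a * s := by nlinarith [hs.1, hs.2]
    have h4 : -|a| ≤ a * s ^ 2 := by
      nlinarith [hs.1, hs.2, pow_le_one₀ hs.1 hs.2 (n := 2), sq_nonneg s]
    nlinarith [hs.1]
  · rw [div_le_iff₀ (Real.sqrt_pos.2 hK0), hK, Real.sqrt_div (by norm_num), Real.sqrt_sq hκ.le,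
      mul_div_cancel₀ _ hκ.ne', show (24 : ℝ) = 2 ^ 2 * 6 by norm_num,
      Real.sqrt_mul (by norm_num), Real.sqrt_sq (by norm_num)]

/-- The duration decreases in `a` and in `Q`, so the admissible heights form an interval starting at
`0`. The flux is at most `2 α a`, which supplies arbitrarily small positive fluxes. -/
theorem exists_threshold_one_zero {α : ℝ} (hα₀ : 0 < α) (hα : α < Real.pi / 2) :
    ∃ Φmax : ℝ, 0 < Φmax ∧ (∀ Φ, 0 < Φ → Φ < Φmax → ExistsProfile α 1 0 Φ) ∧
      ∀ Φ, Φmax < Φ → ¬ExistsProfile α 1 0 Φ := by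
  set D : Set (ℝ × ℝ) := {p | 0 < p.1 ∧ 0 ≤ p.2} with hD
  have hfam : IsDecreasingFamily D humpTime := isDecreasingFamily_one_zero
  have hadm : ∀ {a Q : ℝ}, (a, Q) ∈ D → Adm a Q := fun {a Q} h =>
    ⟨h.2, by linarith [show 0 < a from h.1, show 0 ≤ Q from h.2]⟩
  have hlow : ∀ a, 0 < a → ∃ Q, (a, Q) ∈ D ∧ humpTime a Q ≤ 2 * α := fun a ha => by
    obtain ⟨Q, hQ⟩ := exists_humpTime_le (a := a) (show 0 < 2 * α by positivity)
    exact ⟨Q, ⟨ha, (hQ Q le_rfl).1.1⟩, (hQ Q le_rfl).2⟩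
  have hdown : ∀ a ∈ levelParams D humpTime (2 * α), ∀ a', 0 < a' → a' < a →
      a' ∈ levelParams D humpTime (2 * α) := by
    rintro a ⟨Q, hQ, hT⟩ a' ha' hlt
    obtain ⟨Q', hQ', hT'⟩ := hlow a' ha'
    exact hfam.mem_levelParams (y₁ := Q) ⟨ha', hQ.2⟩ hQ'
      (hT ▸ (humpTime_lt_of_lt_left (hadm ⟨ha', hQ.2⟩) hlt le_rfl).le) hT'
  have hflux : ∀ a Q, (a, Q) ∈ D → humpTime a Q = 2 * α → humpFlux a Q ≤ a * (2 * α) :=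
    fun a Q h hT => by
      rw [← hT, humpFlux]
      exact mul_le_mul_of_nonneg_left (humpMoment_one_le (hadm h)) h.1.le
  obtain ⟨Φmax, hmax, hex, hnex⟩ := hfam.exists_threshold (κ := 2 * α) (F := humpFlux)
    (continuousOn_humpFlux.mono fun p hp => hadm hp)
    ⟨fun x hx y hy z hz => by
      rcases hz.2.eq_or_lt with h | h
      · exact h ▸ hy
      · obtain ⟨Q, hQ, -⟩ := hx
        exact hdown y hy z (lt_of_lt_of_le hQ.1 hz.1) h⟩
    (E := ExistsProfile α 1 0)
    (fun Φ h => by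
      obtain ⟨a, Q, ha, hA, hT, hF⟩ := ExistsProfile.params_one_zero hα₀ h
      exact ⟨a, Q, ⟨ha, hA.1⟩, hT, hF⟩)
    -- The value `Q = 0` can occur only at the greatest height: a higher hump with `Q₂ ≥ 0` would be
    -- strictly shorter.
    (fun a Q hQ hT _ ⟨a₂, ⟨Q₂, hQ₂, hT₂⟩, hlt⟩ => by
      refine existsProfile_one_zero hα₀ hQ.1 (lt_of_le_of_ne hQ.2 fun h0 => ?_) hT
      have h0' : (0 : ℝ) = Q := h0
      have := humpTime_lt_of_lt_left (Q' := Q₂) (hadm hQ) hlt (h0' ▸ hQ₂.2)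
      linarith)
    (C := (Real.pi * √6 / (2 * α)) ^ 2 * (2 * α))
    (fun a Q hQ hT => (hflux a Q hQ hT).trans (mul_le_mul_of_nonneg_right (by
      have ha : 0 < a := hQ.1
      have h1 := humpTime_le_pi_of_pos hQ.1 hQ.2
      simp only at h1
      rw [hT, le_div_iff₀ (Real.sqrt_pos.2 (by linarith)), mul_comm,
        ← le_div_iff₀ (by positivity)] at h1
      have h2 := Real.sq_sqrt (show 0 ≤ 6 + a by linarith)
      have h3 := pow_le_pow_left₀ (Real.sqrt_nonneg _) h1 2
      linarith) (by positivity)))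
  obtain ⟨a₀, ha₀, hmem⟩ : ∃ a₀, 0 < a₀ ∧ a₀ ∈ levelParams D humpTime (2 * α) := by
    -- For the height `3 (K - 1)` and `Q = 0` the quadratic is at most `(6 + 2 a) s = 6 K s`, so the
    -- duration is at least `π / √K = 2 α`. Positivity of this height uses `α < π / 2`.
    set K := (Real.pi / (2 * α)) ^ 2 with hK
    have hK1 : 1 < K := one_lt_pow₀ (by rw [lt_div_iff₀ (by positivity)]; linarith) two_ne_zero
    have ha : 0 < 3 * (K - 1) := by linarith
    obtain ⟨Q', hQ', hT'⟩ := hlow _ ha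
    refine ⟨3 * (K - 1), ha, hfam.mem_levelParams (y₁ := 0) ⟨ha, le_rfl⟩ hQ' ?_ hT'⟩
    have hle := le_humpTime_of_le (a := 3 * (K - 1)) (Q := 0) (K := 6 * K)
      (hadm ⟨ha, le_rfl⟩) (by linarith) fun s hs => by
        rw [humpQuad]
        nlinarith [mul_nonneg ha.le (mul_nonneg hs.1 (sub_nonneg.2 hs.2))]
    refine le_trans (le_of_eq ?_) hle
    rw [Real.sqrt_mul (by norm_num), hK, Real.sqrt_sq (by positivity)]
    have := Real.pi_pos
    field_simp
  have hpos : ∀ a Q, (a, Q) ∈ D → 0 < humpFlux a Q := fun a Q h =>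
    mul_pos h.1 (humpMoment_pos 1 (hadm h))
  refine ⟨Φmax, ?_, fun Φ h0 hΦ => hex Φ hΦ ?_, hnex⟩
  · obtain ⟨Q, hQ, hT⟩ := hmem
    exact (hpos _ _ hQ).trans_le (hmax _ _ hQ hT)
  · have hx : 0 < min (a₀ / 2) (Φ / (4 * α)) := lt_min (by linarith) (by positivity)
    obtain ⟨Q, hQ, hT⟩ := hdown a₀ hmem _ hx ((min_le_left _ _).trans_lt (by linarith))
    refine ⟨_, Q, hQ, hT, (hflux _ _ hQ hT).trans_lt ?_⟩
    have h1 : min (a₀ / 2) (Φ / (4 * α)) * (2 * α) ≤ Φ / (4 * α) * (2 * α) :=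
      mul_le_mul_of_nonneg_right (min_le_right _ _) (by positivity)
    have h2 : Φ / (4 * α) * (2 * α) = Φ / 2 := by field_simp; norm_num
    linarith

/-- As `Q` decreases to `2 b - 6`, the minimum of the hump approaches an equilibrium and the
duration diverges. In terms of `sin φ ^ 2` the quadratic with `Q = 2 b - 6 + δ` is at most `δ + 3 b
sin φ ^ 2`. The hypothesis `3 ≤ b` makes the limiting `Q` nonnegative. -/
theorem exists_lt_humpTime_neg {b : ℝ} (hb : 3 ≤ b) (κ : ℝ) :
    ∃ Q, 0 ≤ Q ∧ 2 * b - 6 < Q ∧ κ < humpTime (-b) Q := by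
  obtain ⟨δ₀, hδ₀, hδ⟩ := exists_lt_integral_cos_div_sqrt (L := 3 * b) (by linarith) (κ / (2 * √6))
  have h6 : 0 < 2 * √6 := by positivity
  have hδ' := hδ (δ₀ / 2) (by linarith) (by linarith)
  have hA : Adm (-b) (2 * b - 6 + δ₀ / 2) := ⟨by linarith, by linarith⟩
  refine ⟨2 * b - 6 + δ₀ / 2, hA.1, by linarith, ?_⟩
  rw [div_lt_iff₀' h6] at hδ'
  have hδL : 0 < 3 * b := by linarith
  have hcont : Continuous fun φ => Real.cos φ / √(δ₀ / 2 + 3 * b * Real.sin φ ^ 2) :=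
    Real.continuous_cos.div (by fun_prop) fun φ => (Real.sqrt_pos.2 (by positivity)).ne'
  have h := intervalIntegral.integral_mono_on_of_le_Ioo (μ := MeasureTheory.volume)
    (by positivity : (0 : ℝ) ≤ Real.pi / 2) (hcont.intervalIntegrable 0 (Real.pi / 2))
    (intervalIntegrable_humpWeight hA) fun φ hφ => by
      have hq := humpQuad_pos hA (cos_sq_pos_of_mem hφ) (cos_sq_lt_one_of_mem hφ).le
      rw [humpWeight]
      refine div_le_div_of_nonneg_left (cos_pos_of_mem hφ).le (Real.sqrt_pos.2 hq)
        (Real.sqrt_le_sqrt ?_)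
      rw [humpQuad, Real.cos_sq']
      nlinarith [sq_nonneg (Real.sin φ), sq_nonneg (Real.sin φ ^ 2)]
  rw [humpTime_eq]
  exact hδ'.trans_le (mul_le_mul_of_nonneg_left h h6.le)

theorem isDecreasingFamily_zero_one :
    IsDecreasingFamily {p | 0 < p.1 ∧ 0 ≤ p.2 ∧ 2 * p.1 - 6 < p.2}
      fun b Q => humpTime (-b) Q where
  continuousOn := ContinuousOn.comp (f := fun p : ℝ × ℝ => (-p.1, p.2))
    (continuousOn_humpMoment 0) (by fun_prop) fun p hp => ⟨hp.2.1, by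
      have : 2 * p.1 - 6 < p.2 := hp.2.2
      show 0 < 6 + 2 * -p.1 + p.2
      linarith⟩
  anti x y y' h _ hlt := humpTime_lt_of_lt_right
    ⟨h.2.1, by linarith [show 2 * x - 6 < y from h.2.2]⟩ hlt
  ordConnected x := ⟨fun y hy _ _ _ hz =>
    ⟨hy.1, le_trans hy.2.1 hz.1, lt_of_lt_of_le hy.2.2 hz.1⟩⟩
  eventually_mem x y h := by
    have h2 : 2 * x - 6 < y := h.2.2
    filter_upwards [lt_mem_nhds (show 0 < x from h.1),
      gt_mem_nhds (show x < (y + 6) / 2 by linarith)] with x' hx' hx''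
    exact ⟨hx', h.2.1, show 2 * x' - 6 < y by linarith⟩
  exists_gt x y h := ⟨y + 1, by simp, h.1, by linarith [show 0 ≤ y from h.2.1],
    by linarith [show 2 * x - 6 < y from h.2.2]⟩
  exists_lt_or x y h := by
    rcases (show 0 ≤ y from h.2.1).eq_or_lt with h0 | h0
    · exact Or.inr fun p hp => h0 ▸ hp.2.1
    · obtain ⟨z, hz, hzy⟩ := exists_between (max_lt h0 (show 2 * x - 6 < y from h.2.2))
      exact Or.inl ⟨z, hzy, h.1, (le_max_left _ _).trans hz.le, (le_max_right _ _).trans_lt hz⟩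

/-- The admissible depths `b` form an interval unbounded above: for `b ≥ 3` the duration diverges at
the lower edge, and for smaller depths it increases with `b` at fixed `Q`. The flux is negative, so
it is bounded above by `0`. -/
theorem exists_threshold_zero_one {α : ℝ} (hα₀ : 0 < α) :
    ∃ Φmax : ℝ, (∀ Φ, Φ < Φmax → ExistsProfile α 0 1 Φ) ∧
      ∀ Φ, Φmax < Φ → ¬ExistsProfile α 0 1 Φ := by
  set D : Set (ℝ × ℝ) := {p | 0 < p.1 ∧ 0 ≤ p.2 ∧ 2 * p.1 - 6 < p.2} with hD
  set τ : ℝ → ℝ → ℝ := fun b Q => humpTime (-b) Q with hτ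
  have hfam : IsDecreasingFamily D τ := isDecreasingFamily_zero_one
  have hadm : ∀ {b Q : ℝ}, (b, Q) ∈ D → Adm (-b) Q := fun {b Q} h =>
    ⟨h.2.1, by linarith [show 2 * b - 6 < Q from h.2.2]⟩
  have hlow : ∀ b, 0 < b → ∃ Q, (b, Q) ∈ D ∧ τ b Q ≤ 2 * α := fun b hb => by
    obtain ⟨Q, hQ⟩ := exists_humpTime_le (a := -b) (show 0 < 2 * α by positivity)
    obtain ⟨hA, hT⟩ := hQ Q le_rfl
    exact ⟨Q, ⟨hb, hA.1, show 2 * b - 6 < Q by linarith [hA.2]⟩, hT⟩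
  have hmem3 : ∀ b, 3 ≤ b → b ∈ levelParams D τ (2 * α) := fun b hb => by
    obtain ⟨Q', hQ', hT'⟩ := hlow b (by linarith)
    obtain ⟨Q, h0, h1, hT⟩ := exists_lt_humpTime_neg hb (2 * α)
    exact hfam.mem_levelParams (y₁ := Q) ⟨by show 0 < b; linarith, h0, h1⟩ hQ' hT.le hT'
  have hup : ∀ b ∈ levelParams D τ (2 * α), ∀ b', b < b' → b' ∈ levelParams D τ (2 * α) := by
    rintro b ⟨Q, hQ, hT⟩ b' hlt
    rcases le_or_gt 3 b' with h3 | h3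
    · exact hmem3 b' h3
    · have hb' : 0 < b' := lt_trans hQ.1 hlt
      have hQ' : (b', Q) ∈ D := ⟨hb', hQ.2.1, by
        show 2 * b' - 6 < Q
        linarith [show 0 ≤ Q from hQ.2.1]⟩
      obtain ⟨Q', hQ'', hT'⟩ := hlow b' hb'
      exact hfam.mem_levelParams hQ' hQ''
        (hT ▸ (humpTime_lt_of_lt_left (hadm hQ') (neg_lt_neg hlt) le_rfl).le) hT'
  obtain ⟨Φmax, -, hex, hnex⟩ := hfam.exists_threshold (κ := 2 * α)
    (F := fun b Q => humpFlux (-b) Q)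
    (ContinuousOn.comp (f := fun p : ℝ × ℝ => (-p.1, p.2)) continuousOn_humpFlux
      (by fun_prop) fun p hp => hadm hp)
    ⟨fun x hx y hy z hz => by
      rcases hz.1.eq_or_lt with h | h
      · exact h ▸ hx
      · exact hup x hx z h⟩
    (E := ExistsProfile α 0 1)
    (fun Φ h => by
      obtain ⟨b, Q, hb, hA, hT, hF⟩ := ExistsProfile.params_zero_one hα₀ h
      exact ⟨b, Q, ⟨hb, hA.1, show 2 * b - 6 < Q by linarith [hA.2]⟩, hT, hF⟩)
    -- The value `Q = 0` can occur only at the least depth: a shallower hump with `Q₁ ≥ 0` would be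
    -- strictly shorter.
    (fun b Q hQ hT ⟨b₁, ⟨Q₁, hQ₁, hT₁⟩, hlt⟩ _ => by
      refine existsProfile_zero_one hα₀ hQ.1 (lt_of_le_of_ne hQ.2.1 fun h0 => ?_) (hadm hQ) hT
      have h0' : (0 : ℝ) = Q := h0
      have h1 := humpTime_lt_of_lt_left (Q' := Q₁) (hadm hQ) (neg_lt_neg hlt) (h0' ▸ hQ₁.2.1)
      simp only [hτ] at hT hT₁
      linarith)
    (C := 0)
    (fun b Q hQ hT => mul_nonpos_of_nonpos_of_nonneg (neg_nonpos.2 (le_of_lt hQ.1))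
      (humpMoment_pos 1 (hadm hQ)).le)
  refine ⟨Φmax, fun Φ hΦ => hex Φ hΦ ?_, hnex⟩
  -- The summand `6` makes Chebyshev's inequality available; the flux is then at most `-(4 / 3) α
  -- b`, which is less than `-|Φ|`.
  set b := 6 + |Φ| / α with hb
  have hb6 : 6 ≤ b := by rw [hb]; linarith [show 0 ≤ |Φ| / α by positivity]
  obtain ⟨Q, hQ, hT⟩ := hmem3 b (by linarith)
  refine ⟨b, Q, hQ, hT, ?_⟩
  have h1 := humpMoment_one_ge (hadm hQ) (by linarith)
  simp only [hτ] at hT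
  rw [hT] at h1
  have h2 : b * (2 / 3 * (2 * α)) ≤ b * humpMoment 1 (-b) Q :=
    mul_le_mul_of_nonneg_left h1 (by linarith)
  have h3 : b * α = 6 * α + |Φ| := by rw [hb]; field_simp
  rw [humpFlux]
  nlinarith [neg_abs_le Φ, abs_nonneg Φ]

/-! ### Oscillating profiles -/

/-- The duration of `m` positive and `n` negative humps. -/
noncomputable def oscTime (m n : ℕ) (a b : ℝ) : ℝ :=
  m * humpTime a (plusQ a b) + n * humpTime (-b) (minusQ a b)

/-- The integral of `m` positive and `n` negative humps. -/
noncomputable def oscFlux (m n : ℕ) (a b : ℝ) : ℝ :=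
  m * humpFlux a (plusQ a b) + n * humpFlux (-b) (minusQ a b)

theorem continuousOn_plus_of_osc {H : ℝ × ℝ → ℝ} (hH : ContinuousOn H {p | Adm p.1 p.2}) :
    ContinuousOn (fun p : ℝ × ℝ => H (p.1, plusQ p.1 p.2)) {p | Osc p.1 p.2} := by
  refine hH.comp (f := fun p : ℝ × ℝ => (p.1, plusQ p.1 p.2)) ?_ fun p hp => Osc.adm_plus hp
  refine continuousOn_fst.prodMk ?_
  unfold plusQ
  exact (continuousOn_snd.div continuousOn_fst fun p hp => (Osc.pos_left hp).ne').mul (by fun_prop)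

theorem continuousOn_minus_of_osc {H : ℝ × ℝ → ℝ} (hH : ContinuousOn H {p | Adm p.1 p.2}) :
    ContinuousOn (fun p : ℝ × ℝ => H (-p.2, minusQ p.1 p.2)) {p | Osc p.1 p.2} := by
  refine hH.comp (f := fun p : ℝ × ℝ => (-p.2, minusQ p.1 p.2)) ?_ fun p hp => Osc.adm_minus hp
  refine continuousOn_snd.neg.prodMk ?_
  unfold minusQ
  exact (continuousOn_fst.div continuousOn_snd fun p hp => (Osc.pos_right hp).ne').mul (by fun_prop)

theorem continuousOn_oscTime (m n : ℕ) :
    ContinuousOn (fun p : ℝ × ℝ => oscTime m n p.1 p.2) {p | Osc p.1 p.2} :=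
  (continuousOn_const.mul (continuousOn_plus_of_osc (continuousOn_humpMoment 0))).add
    (continuousOn_const.mul (continuousOn_minus_of_osc (continuousOn_humpMoment 0)))

theorem continuousOn_oscFlux (m n : ℕ) :
    ContinuousOn (fun p : ℝ × ℝ => oscFlux m n p.1 p.2) {p | Osc p.1 p.2} :=
  (continuousOn_const.mul (continuousOn_plus_of_osc continuousOn_humpFlux)).add
    (continuousOn_const.mul (continuousOn_minus_of_osc continuousOn_humpFlux))

theorem Osc.humpTime_plus_pos {a b : ℝ} (h : Osc a b) : 0 < humpTime a (plusQ a b) :=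
  humpTime_pos h.adm_plus

theorem Osc.humpTime_minus_pos {a b : ℝ} (h : Osc a b) : 0 < humpTime (-b) (minusQ a b) :=
  humpTime_pos h.adm_minus

theorem Osc.add_nonneg {a b : ℝ} (h : Osc a b) : 0 ≤ a + b := by
  linarith [h.pos_left, h.pos_right]

theorem Osc.oscTime_le {a b M : ℝ} (h : Osc a b) {m n : ℕ} (hm : m ≤ M) (hn : n ≤ M) :
    oscTime m n a b ≤ M * pendTime a b := by
  rw [oscTime, h.pendTime_eq, mul_add]
  exact add_le_add (mul_le_mul_of_nonneg_right hm h.humpTime_plus_pos.le)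
    (mul_le_mul_of_nonneg_right hn h.humpTime_minus_pos.le)

theorem Osc.pendTime_le_oscTime {a b : ℝ} (h : Osc a b) {m n : ℕ} (hm : m ≠ 0) (hn : n ≠ 0) :
    pendTime a b ≤ oscTime m n a b := by
  have hm' : (1 : ℝ) ≤ m := by exact_mod_cast Nat.one_le_iff_ne_zero.2 hm
  have hn' : (1 : ℝ) ≤ n := by exact_mod_cast Nat.one_le_iff_ne_zero.2 hn
  rw [oscTime, h.pendTime_eq]
  exact add_le_add (le_mul_of_one_le_left h.humpTime_plus_pos.le hm')
    (le_mul_of_one_le_left h.humpTime_minus_pos.le hn')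

theorem sqrt_le_mul_add {x ε : ℝ} (hx : 0 ≤ x) (hε : 0 < ε) : √x ≤ ε * x + 1 / (4 * ε) := by
  have h1 := mul_nonneg hε.le (sq_nonneg (√x - 1 / (2 * ε)))
  have h2 := Real.sq_sqrt hx
  have h3 : ε * (√x - 1 / (2 * ε)) ^ 2 = ε * √x ^ 2 - √x + 1 / (4 * ε) := by
    field_simp
    ring
  rw [h3, h2] at h1
  linarith

/-- On a level curve of the duration, the flux is bounded above and tends to `-∞` with the
height. -/
theorem exists_oscFlux_le {α : ℝ} (hα : 0 < α) (m n : ℕ) : ∃ C, ∀ a b, Osc a b →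
    oscTime m n a b = 2 * α → oscFlux m n a b ≤ C - α / 2 * a := by
  set M : ℝ := m + n + 1 with hM
  have hM0 : 0 < M := by positivity
  have hmM : (m : ℝ) ≤ M := by rw [hM]; linarith [(Nat.cast_nonneg n : (0 : ℝ) ≤ n)]
  have hnM : (n : ℝ) ≤ M := by rw [hM]; linarith [(Nat.cast_nonneg m : (0 : ℝ) ≤ m)]
  -- The duration `2 α` is at most `M` periods, which bounds `6 + a - 2 b` by `κ`. Adding the two
  -- flux estimates subtracts `2 α b ≥ α (6 + a - κ)` from terms of order `√a + √b`, and `ε` is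
  -- chosen so that these absorb only half of `α a`.
  set κ := (M * (Real.pi * √6) / (2 * α)) ^ 2 with hκ
  set ε := α / (6 * √6 * M) with hε
  have h6 : 0 < √6 := by positivity
  have hε0 : 0 < ε := by positivity
  have hεM : 2 * √6 * M * (3 / 2 * ε) = α / 2 := by rw [hε]; field_simp; norm_num
  refine ⟨α * κ + 2 * √6 * M * (3 * ε + 1 / (2 * ε)), fun a b h hT => ?_⟩
  have ha := h.pos_left
  have hb := h.pos_right
  have hg : 0 < 6 + a - 2 * b := by linarith [h.saddle]
  have hle : 6 + a - 2 * b ≤ κ := by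
    have h1 := (h.oscTime_le hmM hnM).trans
      (mul_le_mul_of_nonneg_left (pendTime_le h.add_nonneg h.saddle) hM0.le)
    rw [hT, ← mul_div_assoc, le_div_iff₀ (Real.sqrt_pos.2 hg), mul_comm,
      ← le_div_iff₀ (by positivity)] at h1
    have h2 := pow_le_pow_left₀ (Real.sqrt_nonneg _) h1 2
    rwa [Real.sq_sqrt hg.le] at h2
  have hp := mul_le_mul_of_nonneg_left h.flux_plus_le (Nat.cast_nonneg m : (0 : ℝ) ≤ m)
  have hm := mul_le_mul_of_nonneg_left h.flux_minus_le (Nat.cast_nonneg n : (0 : ℝ) ≤ n)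
  have hp' : (m : ℝ) * (2 * √6 * √a) ≤ M * (2 * √6 * √a) :=
    mul_le_mul_of_nonneg_right hmM (by positivity)
  have hm' : (n : ℝ) * (2 * √6 * √b) ≤ M * (2 * √6 * √b) :=
    mul_le_mul_of_nonneg_right hnM (by positivity)
  have hsa := sqrt_le_mul_add ha.le hε0
  have hsb := sqrt_le_mul_add hb.le hε0
  have hsum : √a + √b ≤ 3 / 2 * ε * a + (3 * ε + 1 / (2 * ε)) := by
    have h1 : ε * b ≤ ε * (3 + a / 2) := mul_le_mul_of_nonneg_left (by linarith) hε0.le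
    have h2 : 1 / (4 * ε) + 1 / (4 * ε) = 1 / (2 * ε) := by field_simp; norm_num
    linarith
  have hsum' := mul_le_mul_of_nonneg_left hsum (show 0 ≤ 2 * √6 * M by positivity)
  have e1 : 2 * √6 * M * (3 / 2 * ε * a + (3 * ε + 1 / (2 * ε))) =
      α / 2 * a + 2 * √6 * M * (3 * ε + 1 / (2 * ε)) := by
    rw [mul_add, ← mul_assoc _ _ a, hεM]
  rw [e1] at hsum'
  have hbT : b * oscTime m n a b = b * (2 * α) := by rw [hT]
  have hακ : α * (6 + a - 2 * b) ≤ α * κ := mul_le_mul_of_nonneg_left hle hα.le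
  rw [oscTime] at hbT
  rw [oscFlux]
  linarith

/-- The divergence at the saddle is uniform as long as `a + b`, the coefficient of `sin φ ^ 2`,
stays bounded. -/
theorem exists_lt_pendTime (N κ : ℝ) (hN : 0 < N) : ∃ δ₀ > 0, ∀ a b, 0 ≤ a + b → a + b ≤ N →
    2 * b < 6 + a → 6 + a < 2 * b + δ₀ → κ < pendTime a b := by
  have h6 : 0 < 2 * √6 := by positivity
  obtain ⟨δ₀, hδ₀, hδ⟩ := exists_lt_integral_cos_div_sqrt hN (κ / (2 * √6))
  refine ⟨δ₀, hδ₀, fun a b hab habN hs hlt => ?_⟩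
  have h1 := hδ (6 + a - 2 * b) (by linarith) (by linarith)
  rw [div_lt_iff₀' h6] at h1
  refine h1.trans_le ((mul_le_mul_of_nonneg_left ?_ h6.le).trans (le_pendTime_cos hab hs))
  have hpos : ∀ L, 0 ≤ L → ∀ φ, 0 < 6 + a - 2 * b + L * Real.sin φ ^ 2 := fun L hL φ => by
    have := mul_nonneg hL (sq_nonneg (Real.sin φ))
    linarith
  have hcont : ∀ L, 0 ≤ L → Continuous fun φ =>
      Real.cos φ / √(6 + a - 2 * b + L * Real.sin φ ^ 2) := fun L hL =>
    Real.continuous_cos.div (by fun_prop) fun φ => (Real.sqrt_pos.2 (hpos L hL φ)).ne'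
  refine intervalIntegral.integral_mono_on_of_le_Ioo (μ := MeasureTheory.volume)
    (by positivity : (0 : ℝ) ≤ Real.pi / 2) ((hcont N hN.le).intervalIntegrable 0 _)
    ((hcont _ hab).intervalIntegrable 0 _) fun φ hφ => ?_
  refine div_le_div_of_nonneg_left (cos_pos_of_mem hφ).le (Real.sqrt_pos.2 (hpos _ hab φ))
    (Real.sqrt_le_sqrt ?_)
  linarith [mul_le_mul_of_nonneg_right habN (sq_nonneg (Real.sin φ))]

/-! ### Types with at least as many negative as positive humps -/

theorem plusQ_lt_of_lt {a b b' : ℝ} (h : Osc a b) (h' : Osc a b') (hlt : b < b') :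
    plusQ a b < plusQ a b' := by
  have ha := h.pos_left
  have hs := h.saddle
  have hs' := h'.saddle
  rw [plusQ, plusQ, div_mul_eq_mul_div, div_mul_eq_mul_div]
  refine div_lt_div_of_pos_right ?_ ha
  nlinarith [mul_pos (sub_pos.2 hlt) (show 0 < 6 + a - b - b' by linarith)]

theorem pendTime_lt_of_lt_right {a b b' : ℝ} (h : Osc a b) (h' : Osc a b') (hlt : b < b') :
    pendTime a b < pendTime a b' := by
  refine pendTime_lt h'.add_nonneg h'.saddle h.add_nonneg h.saddle fun S hS => ?_
  rw [pendSq, pendSq]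
  nlinarith [mul_pos (sub_pos.2 hlt) hS.1]

theorem pendTime_lt_of_lt_left {a a' b : ℝ} (h : Osc a b) (h' : Osc a' b) (hlt : a < a') :
    pendTime a' b < pendTime a b := by
  refine pendTime_lt h.add_nonneg h.saddle h'.add_nonneg h'.saddle fun S hS => ?_
  rw [pendSq, pendSq]
  nlinarith [mul_pos (sub_pos.2 hlt) (sub_pos.2 hS.2)]

theorem humpTime_minus_lt_of_lt_left {a a' b : ℝ} (h : Osc a b) (h' : Osc a' b) (hlt : a < a') :
    humpTime (-b) (minusQ a' b) < humpTime (-b) (minusQ a b) := by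
  refine humpTime_lt_of_quad_lt h.adm_minus h'.adm_minus fun s hs => ?_
  have hb := h.pos_right
  have ha := h.pos_left
  rw [humpQuad_minusQ hb.ne', humpQuad_minusQ hb.ne']
  have hbs : b * s < b := mul_lt_of_lt_one_right hb hs.2
  have hbs' : 0 < b * s := mul_pos hb hs.1
  refine div_lt_div_of_pos_right (mul_lt_mul'' (by linarith) (by linarith) ?_ (by linarith)) hb
  linarith [h.saddle]

theorem oscTime_eq {a b : ℝ} (h : Osc a b) {m n : ℕ} (hmn : m ≤ n) :
    oscTime m n a b = m * pendTime a b + (n - m : ℕ) * humpTime (-b) (minusQ a b) := by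
  rw [oscTime, h.pendTime_eq, Nat.cast_sub hmn]
  ring

/-- The period grows with `b`, while the positive hump shortens because `plusQ` grows. Hence the
negative hump lengthens, and with `m ≤ n` only periods and additional negative humps are counted. -/
theorem oscTime_lt_of_lt_right {a b b' : ℝ} (h : Osc a b) (h' : Osc a b') (hlt : b < b')
    {m n : ℕ} (hm : m ≠ 0) (hmn : m ≤ n) : oscTime m n a b < oscTime m n a b' := by
  have hm' : (0 : ℝ) < m := by exact_mod_cast Nat.pos_of_ne_zero hm
  have h1 := pendTime_lt_of_lt_right h h' hlt
  have h2 := humpTime_lt_of_lt_right h.adm_plus (plusQ_lt_of_lt h h' hlt)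
  rw [oscTime_eq h hmn, oscTime_eq h' hmn]
  refine add_lt_add_of_lt_of_le (mul_lt_mul_of_pos_left h1 hm')
    (mul_le_mul_of_nonneg_left ?_ (Nat.cast_nonneg _))
  rw [h.pendTime_eq, h'.pendTime_eq] at h1
  linarith

theorem oscTime_le_of_lt_left {a a' b : ℝ} (h : Osc a b) (h' : Osc a' b) (hlt : a < a')
    {m n : ℕ} (hmn : m ≤ n) : oscTime m n a' b ≤ oscTime m n a b := by
  rw [oscTime_eq h hmn, oscTime_eq h' hmn]
  exact add_le_add (mul_le_mul_of_nonneg_left (pendTime_lt_of_lt_left h h' hlt).le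
    (Nat.cast_nonneg _)) (mul_le_mul_of_nonneg_left (humpTime_minus_lt_of_lt_left h h' hlt).le
    (Nat.cast_nonneg _))

theorem isDecreasingFamily_osc {m n : ℕ} (hm : m ≠ 0) (hmn : m ≤ n) :
    IsDecreasingFamily {p | Osc p.1 (-p.2)} fun a z => oscTime m n a (-z) where
  continuousOn := ContinuousOn.comp (f := fun p : ℝ × ℝ => (p.1, -p.2))
    (continuousOn_oscTime m n) (by fun_prop) fun p hp => hp
  anti x y y' h h' hlt := oscTime_lt_of_lt_right h' h (neg_lt_neg hlt) hm hmn
  ordConnected x := ⟨fun y (hy : Osc x (-y)) y' (hy' : Osc x (-y')) z hz =>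
    show Osc x (-z) from ⟨hy.pos_left, by linarith [hy'.pos_right, hz.2],
      by linarith [hy.saddle, hz.1]⟩⟩
  eventually_mem x y (h : Osc x (-y)) := by
    filter_upwards [lt_mem_nhds h.pos_left,
      lt_mem_nhds (show 2 * (-y) - 6 < x by linarith [h.saddle])] with x' h1 h2
    exact show Osc x' (-y) from ⟨h1, h.pos_right, by linarith⟩
  exists_gt x y (h : Osc x (-y)) := ⟨y / 2, by linarith [h.pos_right],
    show Osc x (-(y / 2)) from ⟨h.pos_left, by linarith [h.pos_right],
      by linarith [h.pos_right, h.saddle]⟩⟩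
  exists_lt_or x y (h : Osc x (-y)) := by
    obtain ⟨z, hz, hzy⟩ := exists_between (show -(6 + x) / 2 < y by linarith [h.saddle])
    exact Or.inl ⟨z, hzy, show Osc x (-z) from ⟨h.pos_left, by linarith [h.pos_right],
      by linarith⟩⟩

/-- At fixed `a` the duration increases with `b` and diverges at the saddle, and at fixed `b` it
does not increase with `a`. The admissible `a` therefore form an interval unbounded above, along
which the flux tends to `-∞`. -/
theorem exists_threshold_of_le {α : ℝ} (hα₀ : 0 < α) {m n : ℕ} (hm : m ≠ 0) (hmn : m ≤ n)
    (habs : |(m : ℤ) - n| ≤ 1) :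
    ∃ Φmax : ℝ, (∀ Φ, Φ < Φmax → ExistsProfile α m n Φ) ∧
      ∀ Φ, Φmax < Φ → ¬ExistsProfile α m n Φ := by
  have hn : n ≠ 0 := fun h => hm (Nat.le_zero.1 (h ▸ hmn))
  set D : Set (ℝ × ℝ) := {p | Osc p.1 (-p.2)} with hD
  set τ : ℝ → ℝ → ℝ := fun a z => oscTime m n a (-z) with hτ
  have hfam : IsDecreasingFamily D τ := isDecreasingFamily_osc hm hmn
  have hhigh : ∀ a, 0 < a → ∃ z, (a, z) ∈ D ∧ 2 * α ≤ τ a z := fun a ha => by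
    -- Below the saddle `b < (6 + a) / 2`, so this number bounds `a + b`.
    obtain ⟨δ₀, hδ₀, hδ⟩ := exists_lt_pendTime (3 + 3 / 2 * a) (2 * α) (by positivity)
    obtain ⟨b, hb₁, hb₂⟩ := exists_between
      (show max 0 ((6 + a - δ₀) / 2) < (6 + a) / 2 from max_lt (by linarith) (by linarith))
    have hb₃ := (le_max_left _ _).trans_lt hb₁
    have hb₄ := (le_max_right _ _).trans_lt hb₁
    have hosc : Osc a b := ⟨ha, hb₃, by linarith⟩
    refine ⟨-b, show Osc a (- -b) by rwa [neg_neg], ?_⟩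
    simp only [hτ, neg_neg]
    exact (hδ a b hosc.add_nonneg (by linarith) (by linarith) (by linarith)).le.trans
      (hosc.pendTime_le_oscTime hm hn)
  have hup : ∀ a ∈ levelParams D τ (2 * α), ∀ a', a < a' → a' ∈ levelParams D τ (2 * α) := by
    rintro a ⟨z, hz, hT⟩ a' hlt
    have hz' : Osc a (-z) := hz
    have ha' : 0 < a' := hz'.pos_left.trans hlt
    obtain ⟨z₁, hz₁, hT₁⟩ := hhigh a' ha'
    have hz₂ : Osc a' (-z) := ⟨ha', hz'.pos_right, by linarith [hz'.saddle]⟩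
    exact hfam.mem_levelParams hz₁ (y₂ := z) hz₂ hT₁
      ((oscTime_le_of_lt_left hz' hz₂ hlt hmn).trans hT.le)
  obtain ⟨a₀, ha₀⟩ : ∃ a₀, a₀ ∈ levelParams D τ (2 * α) := by
    -- At `a = 1 + K`, `b = 1` the saddle distance `6 + a - 2 b = 5 + K` exceeds `K`, which makes
    -- `n` periods last at most `2 α`.
    set K := (n * (Real.pi * √6) / (2 * α)) ^ 2 with hK
    have hK0 : 0 ≤ K := sq_nonneg _
    have hpos : 0 < 6 + (1 + K) - 2 * 1 := by linarith
    have hosc : Osc (1 + K) 1 := ⟨by linarith, one_pos, by linarith⟩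
    obtain ⟨z₁, hz₁, hT₁⟩ := hhigh (1 + K) hosc.pos_left
    refine ⟨1 + K, hfam.mem_levelParams hz₁ (y₂ := -1)
      (show Osc (1 + K) (- -1) by rwa [neg_neg]) hT₁ ?_⟩
    simp only [hτ, neg_neg]
    refine (hosc.oscTime_le (M := n) (by exact_mod_cast hmn) le_rfl).trans
      ((mul_le_mul_of_nonneg_left (pendTime_le hosc.add_nonneg hosc.saddle)
        (Nat.cast_nonneg n)).trans ?_)
    rw [← mul_div_assoc, div_le_iff₀ (Real.sqrt_pos.2 hpos), ← div_le_iff₀' (by positivity)]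
    exact Real.le_sqrt_of_sq_le (by linarith)
  obtain ⟨C, hC⟩ := exists_oscFlux_le hα₀ m n
  obtain ⟨Φmax, -, hex, hnex⟩ := hfam.exists_threshold (κ := 2 * α)
    (F := fun a z => oscFlux m n a (-z))
    (ContinuousOn.comp (f := fun p : ℝ × ℝ => (p.1, -p.2)) (continuousOn_oscFlux m n)
      (by fun_prop) fun p hp => hp)
    ⟨fun x hx y hy z hz => by
      rcases hz.1.eq_or_lt with h | h
      · exact h ▸ hx
      · exact hup x hx z h⟩
    (E := ExistsProfile α m n)
    (fun Φ h => by
      obtain ⟨a, b, hab, hT, hF⟩ := ExistsProfile.params_osc hα₀ hm hn h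
      refine ⟨a, -b, show Osc a (- -b) by rwa [neg_neg], ?_, ?_⟩
      · simp only [hτ, neg_neg]
        exact hT
      · simp only [neg_neg]
        exact hF)
    (fun a z hz hT _ _ => existsProfile_of_osc hz habs hT)
    (C := C) (fun a z (hz : Osc a (-z)) hT => (hC a (-z) hz hT).trans (by
      have := hz.pos_left
      have : 0 ≤ α / 2 * a := by positivity
      linarith))
  refine ⟨Φmax, fun Φ hΦ => hex Φ hΦ ?_, hnex⟩
  -- The first entry keeps the height admissible; the second makes `C - α a / 2` at most `Φ - 1`.
  obtain ⟨z, hz, hT⟩ : max (a₀ + 1) (2 * (C + 1 - Φ) / α) ∈ levelParams D τ (2 * α) :=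
    hup a₀ ha₀ _ (lt_of_lt_of_le (by linarith) (le_max_left _ _))
  refine ⟨_, z, hz, hT, (hC _ _ hz hT).trans_lt ?_⟩
  have h1 := mul_le_mul_of_nonneg_left (le_max_right (a₀ + 1) (2 * (C + 1 - Φ) / α))
    (show 0 ≤ α / 2 by positivity)
  have h2 : α / 2 * (2 * (C + 1 - Φ) / α) = C + 1 - Φ := by field_simp
  linarith

/-! ### Types with more positive than negative humps -/

theorem tendsto_integral_one_div_sqrt {δ : ℝ} (hδ : 0 < δ) :
    Filter.Tendsto (fun L : ℝ => ∫ ϕ in (0 : ℝ)..(Real.pi / 2), 1 / √(δ + L * Real.cos ϕ ^ 2))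
      Filter.atTop (nhds 0) := by
  have h : Filter.Tendsto (fun L : ℝ => ∫ ϕ in (0 : ℝ)..(Real.pi / 2),
      1 / √(δ + L * Real.cos ϕ ^ 2)) Filter.atTop
      (nhds (∫ ϕ in (0 : ℝ)..(Real.pi / 2), (0 : ℝ))) := by
    refine intervalIntegral.tendsto_integral_filter_of_dominated_convergence
      (fun _ => 1 / √δ) ?_ ?_ intervalIntegrable_const ?_
    · refine Filter.Eventually.of_forall fun L => Measurable.aestronglyMeasurable ?_
      fun_prop
    · filter_upwards [Filter.eventually_ge_atTop 0] with L hL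
      refine Filter.Eventually.of_forall fun ϕ _ => ?_
      rw [Real.norm_of_nonneg (by positivity)]
      exact one_div_le_one_div_of_le (Real.sqrt_pos.2 hδ)
        (Real.sqrt_le_sqrt (le_add_of_nonneg_right (by positivity)))
    · filter_upwards [MeasureTheory.measure_eq_zero_iff_ae_notMem.1
        (Real.volume_singleton (a := Real.pi / 2))] with ϕ hne hϕ
      rw [uIoc_of_le (by positivity)] at hϕ
      have hlt : ϕ < Real.pi / 2 := lt_of_le_of_ne hϕ.2 hne
      have hc : 0 < Real.cos ϕ ^ 2 :=
        pow_pos (Real.cos_pos_of_mem_Ioo ⟨by linarith [hϕ.1, Real.pi_pos], hlt⟩) 2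
      simp only [one_div]
      exact (Real.tendsto_sqrt_atTop.comp (Filter.tendsto_atTop_add_const_left _ _
        (Filter.tendsto_id.atTop_mul_const hc))).inv_tendsto_atTop
  simpa using h

/-- On the line `a - 2 b = c` the squared speed is `6 + c + (3 a - c) / 2 * cos ϕ ^ 2`. It tends to
infinity away from the single angle `π / 2`, while `6 + c > 0` provides domination. -/
theorem exists_pendTime_le {c κ : ℝ} (hc : -6 < c) (hκ : 0 < κ) :
    ∃ A, ∀ a, A ≤ a → pendTime a ((a - c) / 2) ≤ κ := by
  have h6 : 0 < 2 * √6 := by positivity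
  have hlim : Filter.Tendsto (fun a : ℝ => (3 * a - c) / 2) Filter.atTop Filter.atTop := by
    refine Filter.Tendsto.atTop_div_const two_pos (Filter.tendsto_atTop_add_const_right _ _
      (Filter.tendsto_id.const_mul_atTop (by norm_num)))
  have h := ((tendsto_integral_one_div_sqrt (show 0 < 6 + c by linarith)).comp hlim).eventually
    (gt_mem_nhds (show 0 < κ / (2 * √6) by positivity))
  obtain ⟨A, hA⟩ := Filter.eventually_atTop.1 h
  refine ⟨A, fun a ha => ?_⟩
  have h1 := hA a ha
  simp only [Function.comp, lt_div_iff₀' h6] at h1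
  rw [pendTime]
  refine le_trans (le_of_eq ?_) h1.le
  refine congrArg ((2 * √6) * ·) (intervalIntegral.integral_congr fun ϕ _ => ?_)
  simp only [pendSq, Real.sin_sq]
  congr 2
  ring

/-- Along the lines `a - 2 * b = c`, the parameters for which the durations decrease with the
height. -/
def saddleRegion : Set (ℝ × ℝ) :=
  {p | -6 < p.1 ∧ 0 < p.2 ∧ p.1 < p.2 ∧ -p.1 * (12 + p.1) < p.2 ^ 2}

theorem osc_of_mem_saddleRegion {c a : ℝ} (h : (c, a) ∈ saddleRegion) : Osc a ((a - c) / 2) := by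
  obtain ⟨h1, h2, h3, -⟩ := h
  simp only at h1 h2 h3
  exact ⟨h2, by linarith, by linarith⟩

theorem plusQ_saddle {c a : ℝ} (ha : 0 < a) :
    plusQ a ((a - c) / 2) = (a + 12 - c * (12 + c) / a) / 4 := by
  rw [plusQ]
  field_simp
  ring

/-- The difference has the sign of `a a' + c (12 + c)`. The last condition defining `saddleRegion`
makes this positive. -/
theorem plusQ_saddle_lt {c a a' : ℝ} (h : (c, a) ∈ saddleRegion) (hlt : a < a') :
    plusQ a ((a - c) / 2) < plusQ a' ((a' - c) / 2) := by
  obtain ⟨-, ha, -, hD⟩ := h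
  simp only at ha hD
  have ha' : 0 < a' := ha.trans hlt
  rw [plusQ_saddle ha, plusQ_saddle ha', ← sub_pos]
  have e : (a' + 12 - c * (12 + c) / a') / 4 - (a + 12 - c * (12 + c) / a) / 4 =
      (a' - a) * (a * a' + c * (12 + c)) / (4 * (a * a')) := by
    field_simp
    ring
  rw [e]
  have : 0 < a * a' + c * (12 + c) := by nlinarith
  exact div_pos (mul_pos (sub_pos.2 hlt) this) (by positivity)

theorem pendTime_saddle_lt {c a a' : ℝ} (h : Osc a ((a - c) / 2)) (h' : Osc a' ((a' - c) / 2))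
    (hlt : a < a') : pendTime a' ((a' - c) / 2) < pendTime a ((a - c) / 2) := by
  refine pendTime_lt h.add_nonneg h.saddle h'.add_nonneg h'.saddle fun S hS => ?_
  rw [pendSq, pendSq]
  nlinarith [mul_pos (sub_pos.2 hlt) (sub_pos.2 hS.2)]

theorem oscTime_succ_eq {a b : ℝ} (h : Osc a b) (m : ℕ) :
    oscTime (m + 1) m a b = m * pendTime a b + humpTime a (plusQ a b) := by
  rw [oscTime, h.pendTime_eq]
  push_cast
  ring

/-- With one extra positive hump the duration is `m` periods plus `T₊`, two terms that move in
opposite directions as `b` varies at fixed `a`. Along `a - 2 b = c` both decrease in `a`, as long as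
`plusQ` increases. -/
theorem isDecreasingFamily_saddle (m : ℕ) :
    IsDecreasingFamily saddleRegion fun c a => oscTime (m + 1) m a ((a - c) / 2) where
  continuousOn := ContinuousOn.comp (f := fun p : ℝ × ℝ => (p.2, (p.2 - p.1) / 2))
    (continuousOn_oscTime (m + 1) m) (by fun_prop) fun p hp => osc_of_mem_saddleRegion hp
  anti c a a' h h' hlt := by
    have ho := osc_of_mem_saddleRegion h
    have ho' := osc_of_mem_saddleRegion h'
    rw [oscTime_succ_eq ho, oscTime_succ_eq ho']
    exact add_lt_add_of_le_of_lt (mul_le_mul_of_nonneg_left (pendTime_saddle_lt ho ho' hlt).le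
      (Nat.cast_nonneg m))
      (humpTime_lt_of_lt_left ho.adm_plus hlt (plusQ_saddle_lt h hlt).le)
  ordConnected c := ⟨fun a ha a' _ z hz => by
    obtain ⟨h1, h2, h3, h4⟩ := ha
    simp only at h1 h2 h3 h4
    exact ⟨h1, h2.trans_le hz.1, h3.trans_le hz.1,
      h4.trans_le (pow_le_pow_left₀ h2.le hz.1 2)⟩⟩
  eventually_mem c a h := by
    obtain ⟨h1, h2, h3, h4⟩ := h
    have hc : Continuous fun c : ℝ => -c * (12 + c) := by fun_prop
    filter_upwards [lt_mem_nhds h1, gt_mem_nhds h3, hc.continuousAt.eventually (gt_mem_nhds h4)]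
      with c' g1 g3 g4
    exact ⟨g1, h2, g3, g4⟩
  exists_gt c a h := by
    obtain ⟨h1, h2, h3, h4⟩ := h
    simp only at h1 h2 h3 h4
    exact ⟨a + 1, by simp, h1, by simp only; linarith, by simp only; linarith,
      by simp only; nlinarith⟩
  exists_lt_or c a h := by
    obtain ⟨h1, h2, h3, h4⟩ := h
    simp only at h1 h2 h3 h4
    obtain ⟨z, hz, hza⟩ := exists_between (max_lt (max_lt h2 h3) ((Real.sqrt_lt' h2).2 h4))
    have hz0 : 0 < z := ((le_max_left _ _).trans (le_max_left _ _)).trans_lt hz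
    exact Or.inl ⟨z, hza, h1, hz0, ((le_max_right _ _).trans (le_max_left _ _)).trans_lt hz,
      (Real.sqrt_lt' hz0).1 ((le_max_right _ _).trans_lt hz)⟩

/-- The Jensen bound for the period involves `6 + 3/4 (a + c)`. If `a + c ≤ 0`, two periods already
last `2 π`; otherwise two periods fall short by little and the positive hump makes up for it. -/
theorem two_pi_lt_of_saddle {c a : ℝ} (hc : -6 < c) (hc₀ : c ≤ 0) (ha : 0 < a) (ha₆ : a < 6)
    (hac : a < 5 / 2 - c) (h : Osc a ((a - c) / 2)) :
    2 * Real.pi <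
      2 * pendTime a ((a - c) / 2) + humpTime a (plusQ a ((a - c) / 2)) := by
  have hle := le_pendTime h.add_nonneg h.saddle
  have hpi := Real.pi_pos
  have hpos : 0 < 6 + 3 / 2 * (a - (a - c) / 2) := by linarith
  rcases le_or_gt (a + c) 0 with hneg | hgt
  · have h1 : Real.pi ≤ pendTime a ((a - c) / 2) := by
      refine le_trans ?_ hle
      rw [le_div_iff₀ (Real.sqrt_pos.2 hpos)]
      exact mul_le_mul_of_nonneg_left (Real.sqrt_le_sqrt (by linarith)) hpi.le
    linarith [h.humpTime_plus_pos]
  -- As `a + c < 5 / 2`, the mean squared speed is at most `63 / 8`, and `109 / 125` is slightly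
  -- below `√(6 / (63 / 8)) = √(16 / 21)`.
  · have h1 : 109 / 125 * Real.pi ≤ pendTime a ((a - c) / 2) := by
      refine le_trans ?_ hle
      rw [le_div_iff₀ (Real.sqrt_pos.2 hpos), mul_comm (109 / 125), mul_assoc]
      refine mul_le_mul_of_nonneg_left (Real.le_sqrt_of_sq_le ?_) hpi.le
      rw [mul_pow, Real.sq_sqrt hpos.le]
      linarith
    -- The two factors of the quadratic are at most `6 + 5/4 + 6 = 53/4` and `2 a`, the latter
    -- because `-c < a`. The resulting duration, at least `19 / 20`, exceeds the missing `(2 - 218 /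
    -- 125) π`.
    have hquad := le_humpTime_of_le_const (K := 53 / 2) h.adm_plus fun s hs => by
      rw [humpQuad_plusQ ha.ne', div_le_iff₀ ha]
      have e1 : 6 + a - (a - c) / 2 + a * s ≤ 53 / 4 := by nlinarith [hs.1, hs.2]
      have e2 : (a - c) / 2 + a * s ≤ 2 * a := by nlinarith [hs.1, hs.2]
      have e3 : 0 ≤ (a - c) / 2 + a * s := by nlinarith [hs.1, hs.2]
      nlinarith
    have h2 : 19 / 20 ≤ 2 * √6 / √(53 / 2) := by
      rw [le_div_iff₀ (by positivity), show 2 * √6 = √24 by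
        rw [show (24 : ℝ) = 2 ^ 2 * 6 by norm_num, Real.sqrt_mul (by norm_num),
          Real.sqrt_sq (by norm_num)]]
      refine Real.le_sqrt_of_sq_le ?_
      rw [mul_pow, Real.sq_sqrt (by norm_num)]
      norm_num
    linarith [Real.pi_lt_d2]

/-- The expression `-c (12 + c) = 36 - (6 + c) ^ 2` is below `36`, and `(5/2 - c) ^ 2 + c (12 + c) =
((4 c + 7) ^ 2 + 1) / 8` is positive. So whatever lies outside the region with `c ≤ 0` satisfies the
smallness conditions of `two_pi_lt_of_saddle`. -/
theorem lt_sq_of_saddle {c a : ℝ} (hc : -6 < c) (ha : 0 < a) (h : 6 ≤ a ∨ 5 / 2 - c ≤ a)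
    (hc₀ : c ≤ 0) : -c * (12 + c) < a ^ 2 := by
  rcases h with h | h
  · nlinarith [mul_pos (show 0 < 6 + c by linarith) (show 0 < 6 + c by linarith)]
  · nlinarith [sq_nonneg (4 * c + 7), mul_nonneg (sub_nonneg.2 h)
      (show 0 ≤ a + (5 / 2 - c) by linarith)]

/-- For `m ≥ 2` the duration contains two periods and a positive hump, more than `2 π`. For `m = 1`
doubling the duration adds one further positive hump to these, so only a duration above `π` follows,
and `α ≤ π / 2` is needed. -/
theorem two_mul_lt_oscTime {α : ℝ} (hα : α < Real.pi) {m : ℕ} (hm : m ≠ 0)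
    (hα₁ : m = 1 → α ≤ Real.pi / 2) {a b : ℝ} (h : Osc a b)
    (hT : 2 * Real.pi < 2 * pendTime a b + humpTime a (plusQ a b)) :
    2 * α < oscTime (m + 1) m a b := by
  have hP := h.humpTime_plus_pos
  have hN := h.humpTime_minus_pos
  have hf := h.pendTime_eq
  rw [oscTime_succ_eq h]
  rcases eq_or_ne m 1 with rfl | hne
  · have := hα₁ rfl
    push_cast
    linarith
  · have h2 : (2 : ℝ) ≤ m := by exact_mod_cast (show 2 ≤ m by omega)
    have := mul_le_mul_of_nonneg_right h2 (show 0 ≤ pendTime a b by linarith)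
    linarith

/-- In the coordinates `(c, a)` with `c = a - 2 b`, every `c` in `(-6, 0]` carries a point of the
required duration, and admissibility passes from `c` down to smaller values. Towards `c = -6` the
height on the level curve must grow without bound, so the flux tends to `-∞`. -/
theorem exists_threshold_succ {α : ℝ} (hα₀ : 0 < α) (hα : α < Real.pi) {m : ℕ} (hm : m ≠ 0)
    (hα₁ : m = 1 → α ≤ Real.pi / 2) :
    ∃ Φmax : ℝ, (∀ Φ, Φ < Φmax → ExistsProfile α (m + 1) m Φ) ∧
      ∀ Φ, Φmax < Φ → ¬ExistsProfile α (m + 1) m Φ := by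
  set τ : ℝ → ℝ → ℝ := fun c a => oscTime (m + 1) m a ((a - c) / 2) with hτ
  have hfam : IsDecreasingFamily saddleRegion τ := isDecreasingFamily_saddle m
  have hlow : ∀ c, -6 < c → ∃ a, (c, a) ∈ saddleRegion ∧ τ c a ≤ 2 * α := fun c hc => by
    have hm1 : (0 : ℝ) < ((m + 1 : ℕ) : ℝ) := by positivity
    obtain ⟨A, hA⟩ := exists_pendTime_le hc (show 0 < 2 * α / ((m + 1 : ℕ) : ℝ) by positivity)
    set a := max A (7 + |c|) with ha
    have ha7 : 7 + |c| ≤ a := le_max_right _ _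
    have hc1 := le_abs_self c
    have hc2 := abs_nonneg c
    have hD : (c, a) ∈ saddleRegion := by
      refine ⟨hc, ?_, ?_, ?_⟩ <;> simp only
      · linarith
      · linarith
      · nlinarith [sq_nonneg (6 + c)]
    refine ⟨a, hD, ((osc_of_mem_saddleRegion hD).oscTime_le (M := ((m + 1 : ℕ) : ℝ)) le_rfl
      (by push_cast; linarith)).trans ?_⟩
    have := hA a (le_max_left _ _)
    rwa [le_div_iff₀' hm1] at this
  have hneg : ∀ c, -6 < c → c ≤ 0 → c ∈ levelParams saddleRegion τ (2 * α) := fun c hc hc₀ => by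
    obtain ⟨a', ha', hT'⟩ := hlow c hc
    have hB : 0 ≤ -c * (12 + c) := mul_nonneg (by linarith) (by linarith)
    -- A height between these numbers lies inside the monotone region and still satisfies the
    -- smallness conditions that force a long duration.
    have h6 : √(-c * (12 + c)) < min 6 (5 / 2 - c) := by
      refine lt_min ((Real.sqrt_lt' (by norm_num)).2 (lt_sq_of_saddle hc (by norm_num)
        (Or.inl le_rfl) hc₀)) ((Real.sqrt_lt' (by linarith)).2 (lt_sq_of_saddle hc (by linarith)
        (Or.inr le_rfl) hc₀))
    obtain ⟨a, ha₁, ha₂⟩ := exists_between h6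
    have ha : 0 < a := (Real.sqrt_nonneg _).trans_lt ha₁
    have hD : (c, a) ∈ saddleRegion := ⟨hc, ha, by simp only; linarith, (Real.sqrt_lt' ha).1 ha₁⟩
    have ho := osc_of_mem_saddleRegion hD
    exact hfam.mem_levelParams hD ha' (two_mul_lt_oscTime hα hm hα₁ ho (two_pi_lt_of_saddle hc hc₀
      ha (ha₂.trans_le (min_le_left _ _)) (ha₂.trans_le (min_le_right _ _)) ho)).le hT'
  have hdown : ∀ c ∈ levelParams saddleRegion τ (2 * α), ∀ c', -6 < c' → c' < c →
      c' ∈ levelParams saddleRegion τ (2 * α) := by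
    rintro c ⟨a, ha, hT⟩ c' hc' hlt
    rcases le_or_gt c' 0 with h0 | h0
    · exact hneg c' hc' h0
    · obtain ⟨a', ha', hT'⟩ := hlow c' hc'
      have ho := osc_of_mem_saddleRegion ha
      obtain ⟨-, ha₀, hca, -⟩ := ha
      simp only at ha₀ hca
      have hQ : 0 < plusQ a ((a - c) / 2) :=
        mul_pos (div_pos ho.pos_right ho.pos_left) (by linarith [ho.saddle])
      -- The comparison point on the line of `c'` is `(c' + 2 b, b)`. The first bound makes the
      -- height and the squared speed smaller than at `(c, a)`; the second makes `plusQ` no larger.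
      -- Both the period and the positive hump are then at least as long.
      set b := min ((a - c) / 2) (c' * plusQ a ((a - c) / 2) / (6 + a)) with hb
      have hb₀ : 0 < b := lt_min (by linarith) (div_pos (mul_pos h0 hQ) (by linarith))
      have hb₁ : b ≤ (a - c) / 2 := min_le_left _ _
      have hb₂ : b * (6 + a) ≤ c' * plusQ a ((a - c) / 2) := by
        rw [← le_div_iff₀ (by linarith)]
        exact min_le_right _ _
      have hD₁ : (c', c' + 2 * b) ∈ saddleRegion := by
        refine ⟨hc', ?_, ?_, ?_⟩ <;> simp only
        · linarith
        · linarith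
        · nlinarith [mul_pos h0 hb₀]
      have ho₁ := osc_of_mem_saddleRegion hD₁
      refine hfam.mem_levelParams hD₁ ha' ?_ hT'
      rw [← hT]
      simp only [hτ]
      rw [oscTime_succ_eq ho, oscTime_succ_eq ho₁]
      rw [show (c' + 2 * b - c') / 2 = b by ring] at ho₁ ⊢
      refine add_le_add (mul_le_mul_of_nonneg_left ?_ (Nat.cast_nonneg m)) ?_
      · refine (pendTime_lt ho₁.add_nonneg ho₁.saddle ho.add_nonneg ho.saddle fun S hS => ?_).le
        rw [pendSq, pendSq]
        nlinarith [mul_pos (sub_pos.2 hlt) hS.1, mul_pos (sub_pos.2 hlt) (sub_pos.2 hS.2),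
          mul_nonneg (sub_nonneg.2 hb₁) (sub_pos.2 hS.2).le]
      · refine (humpTime_lt_of_lt_left ho₁.adm_plus (by linarith) ?_).le
        have h1 : b / (c' + 2 * b) ≤ b / c' :=
          div_le_div_of_nonneg_left hb₀.le h0 (by linarith)
        calc plusQ (c' + 2 * b) b = b / (c' + 2 * b) * (6 + (c' + 2 * b) - b) := rfl
          _ ≤ b / c' * (6 + a) := mul_le_mul h1 (by linarith) (by linarith) (by positivity)
          _ = b * (6 + a) / c' := by ring
          _ ≤ _ := by rwa [div_le_iff₀' h0]
  obtain ⟨C, hC⟩ := exists_oscFlux_le hα₀ (m + 1) m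
  obtain ⟨Φmax, -, hex, hnex⟩ := hfam.exists_threshold (κ := 2 * α)
    (F := fun c a => oscFlux (m + 1) m a ((a - c) / 2))
    (ContinuousOn.comp (f := fun p : ℝ × ℝ => (p.2, (p.2 - p.1) / 2))
      (continuousOn_oscFlux (m + 1) m) (by fun_prop) fun p hp => osc_of_mem_saddleRegion hp)
    ⟨fun x hx y hy z hz => by
      rcases hz.2.eq_or_lt with h | h
      · exact h ▸ hy
      · obtain ⟨a, ha, -⟩ := hx
        exact hdown y hy z (lt_of_lt_of_le ha.1 hz.1) h⟩
    (E := ExistsProfile α (m + 1) m)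
    (fun Φ h => by
      obtain ⟨a, b, hab, hT, hF⟩ := ExistsProfile.params_osc hα₀ m.succ_ne_zero hm h
      have ha := hab.pos_left
      have hs := hab.saddle
      have e : (a - (a - 2 * b)) / 2 = b := by ring
      refine ⟨a - 2 * b, a, ⟨by simp only; linarith, ha, by simp only; linarith [hab.pos_right],
        ?_⟩, ?_, ?_⟩
      · simp only
        -- No solution is lost by restricting to `saddleRegion`: a parameter violating its last
        -- condition has duration greater than `2 α`.
        rcases le_or_gt (a - 2 * b) 0 with h0 | h0
        · refine lt_sq_of_saddle (by linarith) ha ?_ h0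
          by_contra! hcon
          have h1 := two_pi_lt_of_saddle (c := a - 2 * b) (by linarith) h0 ha hcon.1 hcon.2
            (by rwa [e])
          rw [e] at h1
          exact (two_mul_lt_oscTime hα hm hα₁ hab h1).ne' hT
        · nlinarith [mul_pos h0 h0]
      · simp only [hτ]
        rw [e]
        exact hT
      · rw [e]
        exact hF)
    (fun c a h hT _ _ => existsProfile_of_osc (osc_of_mem_saddleRegion h) (by simp) hT)
    (C := C) (fun c a h hT => (hC a _ (osc_of_mem_saddleRegion h) hT).trans (by
      have := (osc_of_mem_saddleRegion h).pos_left
      have : 0 ≤ α / 2 * a := by positivity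
      linarith))
  refine ⟨Φmax, fun Φ hΦ => hex Φ hΦ ?_, hnex⟩
  -- A height above `N` brings the bound `C - α a / 2` below `Φ`. Such a height is forced by taking
  -- `c` close to `-6`, since bounded heights would give too long a period.
  set N := 1 + 2 * |C - Φ| / α with hN
  have hN0 : 0 < N := by positivity
  obtain ⟨δ₀, hδ₀, hδ⟩ := exists_lt_pendTime (3 + 3 / 2 * N) (2 * α) (by positivity)
  obtain ⟨c, hc₁, hc₂⟩ := exists_between (show (-6 : ℝ) < min 0 (-6 + δ₀) from
    lt_min (by norm_num) (by linarith))
  have hc₃ := hc₂.trans_le (min_le_left _ _)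
  have hc₄ := hc₂.trans_le (min_le_right _ _)
  obtain ⟨a, ha, hT⟩ := hneg c hc₁ hc₃.le
  have ho := osc_of_mem_saddleRegion ha
  have haN : N < a := by
    by_contra! hle
    have h1 := hδ a ((a - c) / 2) ho.add_nonneg (by linarith) ho.saddle (by linarith)
    exact (h1.trans_le (ho.pendTime_le_oscTime m.succ_ne_zero hm)).ne' hT
  refine ⟨c, a, ha, hT, (hC a _ ho hT).trans_lt ?_⟩
  have h1 := mul_lt_mul_of_pos_left haN (show 0 < α / 2 by positivity)
  have h2 : α / 2 * N = α / 2 + |C - Φ| := by rw [hN]; field_simp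
  linarith [le_abs_self (C - Φ)]

/-! ### Assembly of the four statements -/

theorem exists_threshold_existsSolution {α : ℝ} (hα₀ : 0 < α) (hα : α < Real.pi) {m n : ℕ}
    (h : ∃ Φmax : ℝ, (∀ Φ, Φ < Φmax → ExistsProfile α m n Φ) ∧
      ∀ Φ, Φmax < Φ → ¬ExistsProfile α m n Φ) :
    ∃ Φmax : ℝ, (∀ Φ, Φ < Φmax → ExistsSolution α m n Φ) ∧
      ∀ Φ, Φmax < Φ → ¬ExistsSolution α m n Φ := by
  simpa only [existsSolution_iff hα₀ hα] using h

theorem theorem1p2 (α : ℝ) (hα₀ : 0 < α) (hα : α < Real.pi) :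
    -- (1) the angular component vanishes
    (∀ (u : Plane → Plane) (p : Plane → ℝ), IsSelfSimilarSolution α u p →
      ∀ r : ℝ, 0 < r → ∀ θ ∈ Set.Ioo (-α) α, angularPart u r θ = 0) ∧
    -- (2) type (1,0)
    ((Real.pi / 2 ≤ α → ¬ ∃ (u : Plane → Plane) (p : Plane → ℝ),
        IsSelfSimilarSolution α u p ∧ HasType α u 1 0) ∧
      (α < Real.pi / 2 → ∃ Φmax : ℝ, 0 < Φmax ∧
        (∀ Φ : ℝ, 0 < Φ → Φ < Φmax → ExistsSolution α 1 0 Φ) ∧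
        (∀ Φ : ℝ, Φmax < Φ → ¬ ExistsSolution α 1 0 Φ))) ∧
    -- (3) all other types, except (2,1)
    (∀ mPlus mMinus : ℕ, |(mPlus : ℤ) - (mMinus : ℤ)| ≤ 1 →
      (mPlus, mMinus) ≠ (0, 0) → (mPlus, mMinus) ≠ (1, 0) → (mPlus, mMinus) ≠ (2, 1) →
      ∃ Φmax : ℝ,
        (∀ Φ : ℝ, Φ < Φmax → ExistsSolution α mPlus mMinus Φ) ∧
        (∀ Φ : ℝ, Φmax < Φ → ¬ ExistsSolution α mPlus mMinus Φ)) ∧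
    -- (4) type (2,1)
    (α ≤ Real.pi / 2 → ∃ Φmax : ℝ,
      (∀ Φ : ℝ, Φ < Φmax → ExistsSolution α 2 1 Φ) ∧
      (∀ Φ : ℝ, Φmax < Φ → ¬ ExistsSolution α 2 1 Φ)) := by
  refine ⟨fun u p h r hr θ hθ => h.angularPart_eq_zero hα₀ hα hr hθ,
    ⟨?_, fun hlt => ?_⟩, fun m n habs h00 h10 h21 => ?_, fun hle => ?_⟩
  · rintro hle ⟨u, p, hu, ht⟩
    -- No flux is prescribed here, so the solution is given the integral of its own profile as flux;
    -- a positive hump lasts less than `π ≤ 2 α`.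
    have hsol : ExistsSolution α 1 0 (∫ θ in (-α)..α, radialPart u 1 θ) :=
      ⟨u, p, hu, (hasFlux_iff hα₀ hα hu _).2 rfl, ht⟩
    rw [existsSolution_iff hα₀ hα] at hsol
    obtain ⟨a, Q, ha, hA, hT, -⟩ := ExistsProfile.params_one_zero hα₀ hsol
    linarith [humpTime_lt_pi ha hA.1]
  · simp only [existsSolution_iff hα₀ hα]
    exact exists_threshold_one_zero hα₀ hlt
  · refine exists_threshold_existsSolution hα₀ hα ?_
    rcases eq_or_ne m 0 with rfl | hm
    · have hn : n = 1 := by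
        have : n ≠ 0 := fun h => h00 (by rw [h])
        rw [abs_le] at habs
        omega
      rw [hn]
      exact exists_threshold_zero_one hα₀
    · rcases le_or_gt m n with hmn | hmn
      · exact exists_threshold_of_le hα₀ hm hmn habs
      · obtain rfl : m = n + 1 := by
          rw [abs_le] at habs
          omega
        exact exists_threshold_succ hα₀ hα (fun h => h10 (by rw [h]))
          fun h => absurd (by rw [h]) h21
  · exact exists_threshold_existsSolution hα₀ hα
      (exists_threshold_succ hα₀ hα one_ne_zero fun _ => hle)
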